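/- Let $\mathbb G$ be a homogeneous group: a real Lie group whose exponential map $\exp:\mathfrak g\to\mathbb G$ is a diffeomorphism, together with a basis $X_1,\dots,X_m$ ($m\ge 1$) of $\mathfrak g$ and exponents $1=d_1\le\dots\le d_m$ such that the linear maps $\delta_\lambda X_j=\lambda^{d_j}X_j$, $\lambda>0$, define through $\exp$ automorphisms (again written $\delta_\lambda$) of $\mathbb G$. Let $Q=d_1+\dots+d_m$, and let $dg$ be the push-forward by $\exp$ of the Lebesgue measure of $\mathfrak g$ in the coordinates of the basis $X_j$. Fix a homogeneous norm $|\cdot|:\mathbb G\to[0,\infty)$, i.e. a continuous function, $C^\infty$ away from the identity $e$, with $|g|=0$ iff $g=e$, $|g^{-1}|=|g|$, $|\delta_\lambda g|=\lambda|g|$ and $|gh|\le|g|+|h|$; let $B(g,R)=\{h:|g^{-1}h|<R\}$. Let $0<s<1$ with $2s<Q$, and put $$\mathscr Q_s(u,\phi)=\int_{\mathbb G}\int_{\mathbb G}\frac{(u(g)-u(h))(\phi(g)-\phi(h))}{|g^{-1}h|^{Q+2s}}\,dg\,dh,\qquad [u]_{s,2}=\mathscr Q_s(u,u)^{1/2}.$$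 Let $\mathcal D^{s,2}(\mathbb G)$ be the closure of $C_0^\infty(\mathbb G)$ with respect to $[\cdot]_{s,2}$, realized as a space of functions modulo null sets: $u\in\mathcal D^{s,2}(\mathbb G)$ iff there are $\phi_k\in C_0^\infty(\mathbb G)$ with $[u-\phi_k]_{s,2}\to0$ and $\phi_k\to u$ almost everywhere. A function $u\in\mathcal D^{s,2}(\mathbb G)$ is a subsolution of $\mathcal L_su=Vu$ if $\mathscr Q_s(u,\phi)\le\int_{\mathbb G}Vu\phi\,dg$ for every $\phi\in C_0^\infty(\mathbb G)$ with $\phi\ge0$. **Theorem.** Let $t_0>\frac Q{2s}$ and $K_0\in\mathbb R$. There is a constant $C>0$, depending only on $\mathbb G$ and $|\cdot|$ (in particular on $Q$), $s$, $t_0$ and $K_0$, with the following property. Let $u\in\mathcal D^{s,2}(\mathbb G)$ be a nonnegative subsolution of $\mathcal L_su=Vu$, where $V\in L^{Q/(2s)}(\mathbb G)\cap L^{t_0}(\mathbb G)$, and suppose that for some $\bar R_0\ge0$ $$\int_{\{|g|>R\}}|V(g)|^{t_0}\,dg\le\frac{K_0}{R^{2st_0-Q}}\qquad\text{for all }R>\bar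 R_0.$$ Then for all $g_0\in\mathbb G$ with $|g_0|=2R_0\ge4\bar R_0$ and all $0<R\le R_0$, $$\sup_{B(g_0,R/2)}u\ \le\ C\,\frac1{|B(g_0,R)|}\int_{B(g_0,R)}u\,dh\ +\ C\,T(u;g_0,R/2),$$ where $\sup$ is the essential supremum, $|B(g_0,R)|$ is the measure of the ball, and $$T(u;g_0,R)=R^{2s}\int_{|g_0^{-1}h|>R}\frac{u(h)}{|g_0^{-1}h|^{Q+2s}}\,dh;$$ moreover, both integrals on the right-hand side converge. -/

import Mathlib

open MeasureTheory Filter Topology Manifold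
open scoped ContDiff ENNReal

noncomputable section

/-- A homogeneous group. `G` is a real Lie group with model space `E`, so that `E` is the underlying
vector space of its Lie algebra `T_1 G`. The exponential map `exp` is a global diffeomorphism of the
Lie algebra onto `G` (so `G` is connected and simply connected); it is pinned down by the fact that
`t ↦ exp (t X)` is a one-parameter subgroup with velocity `X` at `t = 0`. There are a basis
`X_0, …, X_n` of the Lie algebra and exponents `1 = d_0 ≤ d_1 ≤ … ≤ d_n` such that the dilations
`δ_r X_j = r ^ d_j X_j`, `r > 0`, are, through `exp`, automorphisms of the group `G`.
(Nilpotency of `G` is a consequence of the existence of such dilations.) -/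
structure HomogeneousGroup (n : ℕ) (E G : Type*) [NormedAddCommGroup E] [NormedSpace ℝ E]
    [Group G] [TopologicalSpace G] [ChartedSpace E G] where
  /-- the exponential map -/
  exp : Diffeomorph 𝓘(ℝ, E) 𝓘(ℝ, E) E G ∞
  exp_add_smul : ∀ (a b : ℝ) (X : E), exp ((a + b) • X) = exp (a • X) * exp (b • X)
  mfderiv_exp_zero : ∀ X : E, mfderiv 𝓘(ℝ, E) 𝓘(ℝ, E) exp 0 X = X
  /-- the basis of the Lie algebra that diagonalizes the dilations -/
  basis : Module.Basis (Fin (n + 1)) ℝ E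
  /-- the exponents of the dilations -/
  weight : Fin (n + 1) → ℝ
  weight_zero : weight 0 = 1
  weight_mono : Monotone weight
  /-- the dilations of the Lie algebra -/
  algDilation : ℝ → E →ₗ[ℝ] E
  algDilation_basis : ∀ r : ℝ, 0 < r → ∀ j, algDilation r (basis j) = r ^ weight j • basis j
  exp_algDilation_mul : ∀ r : ℝ, 0 < r → ∀ g h : G,
    exp (algDilation r (exp.symm (g * h))) =
      exp (algDilation r (exp.symm g)) * exp (algDilation r (exp.symm h))

namespace HomogeneousGroup

variable {n : ℕ} {E G : Type*} [NormedAddCommGroup E] [NormedSpace ℝ E]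
  [Group G] [TopologicalSpace G] [ChartedSpace E G]

/-- The dilations `exp ∘ δ_r ∘ exp⁻¹` of the group. -/
def dilation (H : HomogeneousGroup n E G) (r : ℝ) (g : G) : G :=
  H.exp (H.algDilation r (H.exp.symm g))

/-- The homogeneous dimension. -/
def homDim (H : HomogeneousGroup n E G) : ℝ := ∑ j, H.weight j

/-- The Haar measure `dg`: push-forward under `exp` of the Lebesgue measure on the Lie algebra
(in the coordinates with respect to the basis `X_0, …, X_n`). -/
def haar [MeasurableSpace G] (H : HomogeneousGroup n E G) : Measure G :=
  Measure.map (fun x : Fin (n + 1) → ℝ => H.exp (∑ j, x j • H.basis j)) volume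

/-- A homogeneous norm on `G`: continuous, smooth away from the identity, vanishing exactly at the
identity, symmetric, homogeneous of degree one, and satisfying the triangle inequality. -/
structure IsHomogeneousNorm (H : HomogeneousGroup n E G) (N : G → ℝ) : Prop where
  continuous : Continuous N
  smooth : ContMDiffOn 𝓘(ℝ, E) 𝓘(ℝ, ℝ) ∞ N {1}ᶜ
  nonneg : ∀ g, 0 ≤ N g
  eq_zero_iff : ∀ g, N g = 0 ↔ g = 1
  inv : ∀ g, N g⁻¹ = N g
  dilation : ∀ r : ℝ, 0 < r → ∀ g, N (H.dilation r g) = r * N g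
  mul_le : ∀ g h, N (g * h) ≤ N g + N h

/-- The open ball `B(g, R) = {h : |g⁻¹ h| < R}` of a homogeneous norm. -/
def gaugeBall (N : G → ℝ) (g : G) (R : ℝ) : Set G := {h | N (g⁻¹ * h) < R}

variable (E) in
/-- The test functions `C_0^∞(G)`. -/
def IsTestFunction (φ : G → ℝ) : Prop :=
  ContMDiff 𝓘(ℝ, E) 𝓘(ℝ, ℝ) ∞ φ ∧ HasCompactSupport φ

variable [MeasurableSpace G]

/-- The square `[u]_{s,2}²` of the fractional seminorm, with values in `[0, ∞]`. -/
def seminormSq (H : HomogeneousGroup n E G) (N : G → ℝ) (s : ℝ) (u : G → ℝ) : ℝ≥0∞ :=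
  ∫⁻ p : G × G, ENNReal.ofReal ((u p.1 - u p.2) ^ 2 / N (p.1⁻¹ * p.2) ^ (H.homDim + 2 * s))
    ∂(H.haar.prod H.haar)

/-- The quadratic form `𝒬_s(u, φ)`. -/
def quadForm (H : HomogeneousGroup n E G) (N : G → ℝ) (s : ℝ) (u φ : G → ℝ) : ℝ :=
  ∫ p : G × G, (u p.1 - u p.2) * (φ p.1 - φ p.2) / N (p.1⁻¹ * p.2) ^ (H.homDim + 2 * s)
    ∂(H.haar.prod H.haar)

/-- The homogeneous fractional Sobolev space `𝒟^{s,2}(G)`, the closure of `C_0^∞(G)` in the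
seminorm `[·]_{s,2}`. Its elements are realized as functions (up to null sets): `u` is the limit of
test functions in the seminorm and almost everywhere. The second requirement removes the additive
constants, on which the seminorm vanishes. -/
def MemFracSobolev (H : HomogeneousGroup n E G) (N : G → ℝ) (s : ℝ) (u : G → ℝ) : Prop :=
  ∃ φ : ℕ → G → ℝ, (∀ k, IsTestFunction E (φ k)) ∧
    Tendsto (fun k => H.seminormSq N s (fun g => u g - φ k g)) atTop (𝓝 0) ∧
    ∀ᵐ g ∂H.haar, Tendsto (fun k => φ k g) atTop (𝓝 (u g))

/-- `u` is a weak subsolution of `ℒ_s u = F`: `u ∈ 𝒟^{s,2}(G)` and `𝒬_s(u, φ) ≤ ∫ F φ` for every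
nonnegative test function `φ`. -/
def IsWeakSubsolution (H : HomogeneousGroup n E G) (N : G → ℝ) (s : ℝ) (u F : G → ℝ) : Prop :=
  H.MemFracSobolev N s u ∧
    ∀ φ : G → ℝ, IsTestFunction E φ → (∀ g, 0 ≤ φ g) →
      H.quadForm N s u φ ≤ ∫ g, F g * φ g ∂H.haar

/-- The integrand of the nonlocal tail centred at `g₀`. -/
def tailIntegrand (H : HomogeneousGroup n E G) (N : G → ℝ) (s : ℝ) (u : G → ℝ) (g₀ h : G) : ℝ :=
  u h / N (g₀⁻¹ * h) ^ (H.homDim + 2 * s)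

/-- The nonlocal tail `T(u; g₀, R)`. -/
def tail (H : HomogeneousGroup n E G) (N : G → ℝ) (s : ℝ) (u : G → ℝ) (g₀ : G) (R : ℝ) : ℝ :=
  R ^ (2 * s) * ∫ h in {h | R < N (g₀⁻¹ * h)}, H.tailIntegrand N s u g₀ h ∂H.haar

end HomogeneousGroup

end

/-! This is De Giorgi's method, carried out in a space of which only one thing is remembered: a
metric `d` and a measure for which every ball of radius `r` has measure `c r^Q`. A homogeneous group
is such a space because left translations have Jacobian one in exponential coordinates
(`det_leftDeriv`) and dilations have Jacobian `r^Q`.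

Two estimates come from the volume growth alone. Dyadic annuli give a bound for the kernel against
functions that are Lipschitz at scale `ℓ` (`exists_lintegral_kernel_le`). A pointwise Chebyshev
argument gives the fractional Sobolev inequality (`exists_sobolev`).

The equation enters only through a Caccioppoli inequality for the truncations `(u - k)_+`
(`caccioppoliIneq`). The natural test function `(u - k)_+ η²` is not smooth, so the inequality is
tested with smoothed truncations of the approximating test functions, multiplied by `η²`. These have
bounded energy (`exists_fracEnergy_softPos_le`) and converge almost everywhere, hence weakly in
`L²`, and that suffices to pass to the limit in both sides.

In one step (`DeGiorgiData.step`) the level rises and the ball shrinks. Chebyshev makes the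
superlevel set small. Since `t₀ > Q/(2s)`, the potential then has a small norm there and part of its
contribution is absorbed. The rest, the cutoff terms and the tail give a power `1 + β` of the
previous quantity, where `β = 2s/Q - 1/t₀ > 0`. Iteration shows that `u ≤ k` on the smaller ball as
soon as `k` dominates the tail and a multiple of the `L²` mean (`exists_le_of_sq_lintegral_le`). The
`L²` mean is then replaced by the `L¹` mean by bounding `∫ u²` by `sup u · ∫ u` on a family of
growing balls and absorbing the supremum (`exists_le_of_lintegral_le`).

The decay of `V` makes the constant uniform. A ball `B(g₀, R)` with `R ≤ R₀` and `|g₀| = 2 R₀` lies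
in `{|g| > R₀}`, so the norm of `V` in `L^{t₀}` on it is at most a constant times `R^(-Qβ)`, the
scale-invariant bound that the iteration needs (`lintegral_potential_le`). -/

noncomputable section

/-! ### Ahlfors regular spaces: kernel bounds, the fractional Sobolev inequality, Hölder estimates.
-/

/-- A metric `d` and a measure `μ` for which every ball of radius `r` has measure `c r ^ Q`. -/
structure IsAhlforsRegular {X : Type*} [MeasurableSpace X] (μ : Measure X) (d : X → X → ℝ)
    (Q c : ℝ) : Prop where
  measurable_dist : Measurable fun p : X × X => d p.1 p.2
  nonneg : ∀ x y, 0 ≤ d x y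
  pos_of_ne : ∀ x y, x ≠ y → 0 < d x y
  symm : ∀ x y, d x y = d y x
  triangle : ∀ x y z, d x z ≤ d x y + d y z
  dim_pos : 0 < Q
  density_pos : 0 < c
  measure_ball : ∀ x r, 0 < r → μ {y | d x y < r} = ENNReal.ofReal (c * r ^ Q)

/-- The fractional energy `∫∫ (u x - u y)² / d(x, y) ^ q`. -/
def fracEnergy {X : Type*} [MeasurableSpace X] (μ : Measure X) (d : X → X → ℝ) (q : ℝ)
    (u : X → ℝ) : ℝ≥0∞ :=
  ∫⁻ z : X × X, ENNReal.ofReal ((u z.1 - u z.2) ^ 2 / d z.1 z.2 ^ q) ∂(μ.prod μ)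

namespace IsAhlforsRegular

variable {X : Type*} [MeasurableSpace X] {μ : Measure X} {d : X → X → ℝ} {Q c : ℝ}

lemma measurable_dist_right (h : IsAhlforsRegular μ d Q c) (x : X) : Measurable (d x) :=
  h.measurable_dist.comp measurable_prodMk_left

lemma measurableSet_ball (h : IsAhlforsRegular μ d Q c) (x : X) (r : ℝ) :
    MeasurableSet {y | d x y < r} :=
  measurableSet_lt (h.measurable_dist_right x) measurable_const

lemma lintegral_annulus_le (h : IsAhlforsRegular μ d Q c) {q : ℝ} (hq : 0 ≤ q) (x : X) {b ℓ : ℝ}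
    (hb : 0 < b) (hℓ : 0 < ℓ) :
    ∫⁻ y in {y | b ≤ d x y ∧ d x y < 2 * b},
        ENNReal.ofReal (min 1 ((d x y / ℓ) ^ 2) / d x y ^ q) ∂μ ≤
      ENNReal.ofReal (min 1 ((2 * b / ℓ) ^ 2) / b ^ q * (c * (2 * b) ^ Q)) := by
  have hms : MeasurableSet {y | b ≤ d x y ∧ d x y < 2 * b} :=
    (measurableSet_le measurable_const (h.measurable_dist_right x)).inter
      (h.measurableSet_ball x _)
  calc _ ≤ ∫⁻ y in {y | b ≤ d x y ∧ d x y < 2 * b},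
        ENNReal.ofReal (min 1 ((2 * b / ℓ) ^ 2) / b ^ q) ∂μ := by
        refine setLIntegral_mono' hms fun y hy => ENNReal.ofReal_le_ofReal ?_
        have h0 := h.nonneg x y
        have h2 : (d x y / ℓ) ^ 2 ≤ (2 * b / ℓ) ^ 2 := by
          gcongr
          exact hy.2.le
        gcongr
        exact hy.1
    _ = ENNReal.ofReal (min 1 ((2 * b / ℓ) ^ 2) / b ^ q) * μ {y | b ≤ d x y ∧ d x y < 2 * b} := by
        rw [setLIntegral_const]
    _ ≤ ENNReal.ofReal (min 1 ((2 * b / ℓ) ^ 2) / b ^ q) * μ {y | d x y < 2 * b} := by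
        gcongr
        exact And.right
    _ = _ := by
        rw [h.measure_ball x _ (by positivity), ← ENNReal.ofReal_mul (by positivity)]

/-- At large scales the terms decay like `2^(-2sn)`, which needs `s > 0`. At small scales the square
wins and leaves a geometric series of ratio `2^(2s-2)`, which needs `s < 1`. -/
lemma summable_dyadic_kernel {s : ℝ} (hs0 : 0 < s) (hs1 : s < 1) :
    Summable fun n : ℤ => min 1 ((2 * (2 : ℝ) ^ n) ^ 2) * ((2 : ℝ) ^ n) ^ (-(2 * s)) := by
  apply Summable.of_nat_of_neg
  · have h1 : (2 : ℝ) ^ (-(2 * s)) < 1 := Real.rpow_lt_one_of_one_lt_of_neg one_lt_two (by linarith)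
    refine Summable.of_nonneg_of_le (fun n => by positivity) (fun n => ?_)
      (summable_geometric_of_lt_one (by positivity) h1)
    rw [← Real.rpow_natCast ((2 : ℝ) ^ (-(2 * s))) n, ← Real.rpow_mul (by norm_num),
      zpow_natCast, ← Real.rpow_natCast 2 n, ← Real.rpow_mul (by norm_num), mul_comm (n : ℝ)]
    exact mul_le_of_le_one_left (by positivity) (min_le_left _ _)
  · have h1 : (2 : ℝ) ^ (2 * s - 2) < 1 := Real.rpow_lt_one_of_one_lt_of_neg one_lt_two (by linarith)
    refine Summable.of_nonneg_of_le (fun n => by positivity) (fun n => ?_)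
      ((summable_geometric_of_lt_one (by positivity) h1).mul_left 4)
    have e1 : ((2 : ℝ) ^ (-(n : ℤ))) = (2 : ℝ) ^ (-(n : ℝ)) := by
      rw [Real.rpow_neg (by norm_num), Real.rpow_natCast, zpow_neg, zpow_natCast]
    rw [e1]
    calc _ ≤ (2 * (2 : ℝ) ^ (-(n : ℝ))) ^ 2 * ((2 : ℝ) ^ (-(n : ℝ))) ^ (-(2 * s)) := by
          gcongr
          exact min_le_right _ _
      _ = 4 * ((2 : ℝ) ^ (2 * s - 2)) ^ n := by
          rw [mul_pow, ← Real.rpow_natCast _ n, ← Real.rpow_natCast _ 2, ← Real.rpow_natCast _ 2,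
            ← Real.rpow_mul (by norm_num), ← Real.rpow_mul (by norm_num),
            ← Real.rpow_mul (by norm_num), mul_assoc, ← Real.rpow_add (by norm_num)]
          congr 1
          · norm_num
          · congr 1
            push_cast
            ring

/-- On the annulus of radius about `2^n ℓ` the volume cancels the power `Q` of the kernel and only
`(2^n ℓ)^(-2s)` remains, so the dyadic sum converges. Every energy of a Lipschitz function is
estimated through this bound. -/
lemma exists_lintegral_kernel_le (h : IsAhlforsRegular μ d Q c) {s : ℝ} (hs0 : 0 < s)
    (hs1 : s < 1) :
    ∃ C : ℝ, 0 < C ∧ ∀ (x : X) (ℓ : ℝ), 0 < ℓ →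
      ∫⁻ y, ENNReal.ofReal (min 1 ((d x y / ℓ) ^ 2) / d x y ^ (Q + 2 * s)) ∂μ ≤
        ENNReal.ofReal (C * ℓ ^ (-(2 * s))) := by
  have hQ := h.dim_pos
  have hc := h.density_pos
  set g : ℤ → ℝ := fun n => min 1 ((2 * (2 : ℝ) ^ n) ^ 2) * ((2 : ℝ) ^ n) ^ (-(2 * s)) with hg
  have hg0 : ∀ n, 0 ≤ g n := fun n => by positivity
  have hgs : Summable g := summable_dyadic_kernel hs0 hs1
  have hgpos : 0 < ∑' n, g n := hgs.tsum_pos hg0 0 (by simp [hg])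
  refine ⟨c * 2 ^ Q * ∑' n, g n, by positivity, fun x ℓ hℓ => ?_⟩
  set A : ℤ → Set X := fun n => {y | 2 ^ n * ℓ ≤ d x y ∧ d x y < 2 * (2 ^ n * ℓ)} with hA
  -- The annuli miss only points at distance zero, where the numerator vanishes.
  have hcover : ∀ y ∉ ⋃ n, A n,
      ENNReal.ofReal (min 1 ((d x y / ℓ) ^ 2) / d x y ^ (Q + 2 * s)) = 0 := by
    intro y hy
    rcases (h.nonneg x y).eq_or_lt with h0 | h0
    · simp [← h0]
    · exfalso
      apply hy
      obtain ⟨n, hn1, hn2⟩ := exists_mem_Ico_zpow (div_pos h0 hℓ) (one_lt_two (α := ℝ))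
      refine Set.mem_iUnion.2 ⟨n, ?_, ?_⟩
      · rwa [le_div_iff₀ hℓ] at hn1
      · rw [div_lt_iff₀ hℓ, zpow_add_one₀ two_ne_zero] at hn2
        linarith
  have hAm : MeasurableSet (⋃ n, A n) := MeasurableSet.iUnion fun n =>
    (measurableSet_le measurable_const (h.measurable_dist_right x)).inter
      (h.measurableSet_ball x _)
  calc _ = ∫⁻ y in ⋃ n, A n,
        ENNReal.ofReal (min 1 ((d x y / ℓ) ^ 2) / d x y ^ (Q + 2 * s)) ∂μ := by
        rw [← lintegral_indicator hAm]
        refine lintegral_congr fun y => ?_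
        by_cases hy : y ∈ ⋃ n, A n
        · rw [Set.indicator_of_mem hy]
        · rw [Set.indicator_of_notMem hy, hcover y hy]
    _ ≤ ∑' n, ∫⁻ y in A n,
        ENNReal.ofReal (min 1 ((d x y / ℓ) ^ 2) / d x y ^ (Q + 2 * s)) ∂μ :=
        lintegral_iUnion_le _ _
    _ ≤ ∑' n, ENNReal.ofReal (c * 2 ^ Q * ℓ ^ (-(2 * s)) * g n) := by
        refine ENNReal.tsum_le_tsum fun n => ?_
        refine (h.lintegral_annulus_le (by positivity) x (b := 2 ^ n * ℓ)
          (by positivity) hℓ).trans (ENNReal.ofReal_le_ofReal (le_of_eq ?_))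
        have e : 2 * (2 ^ n * ℓ) / ℓ = 2 * (2 : ℝ) ^ n := by field_simp
        have hp : (0 : ℝ) < 2 ^ n := by positivity
        simp only [hg]
        rw [e, Real.mul_rpow (x := 2) (by norm_num) (by positivity),
          Real.rpow_add (x := 2 ^ n * ℓ) (by positivity), Real.mul_rpow hp.le hℓ.le (z := 2 * s),
          Real.rpow_neg hp.le, Real.rpow_neg hℓ.le]
        have : (2 ^ n * ℓ) ^ Q ≠ 0 := by positivity
        field_simp
    _ = ENNReal.ofReal (c * 2 ^ Q * (∑' n, g n) * ℓ ^ (-(2 * s))) := by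
        rw [← ENNReal.ofReal_tsum_of_nonneg (fun n => mul_nonneg (by positivity) (hg0 n))
          (hgs.mul_left _), tsum_mul_left]
        congr 1
        ring

lemma measurable_energy_integrand (h : IsAhlforsRegular μ d Q c) (q : ℝ) {u : X → ℝ}
    (hu : Measurable u) :
    Measurable fun z : X × X => (u z.1 - u z.2) ^ 2 / d z.1 z.2 ^ q :=
  (((hu.comp measurable_fst).sub (hu.comp measurable_snd)).pow_const 2).div
    (h.measurable_dist.pow_const q)

lemma fracEnergy_eq_lintegral [SFinite μ] (h : IsAhlforsRegular μ d Q c) (q : ℝ) {u : X → ℝ}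
    (hu : Measurable u) :
    fracEnergy μ d q u = ∫⁻ x, ∫⁻ y, ENNReal.ofReal ((u x - u y) ^ 2 / d x y ^ q) ∂μ ∂μ :=
  lintegral_prod _ (h.measurable_energy_integrand q hu).ennreal_ofReal.aemeasurable

/-- The pointwise form of the fractional Sobolev inequality. -/
lemma rpow_abs_le_mul_lintegral (h : IsAhlforsRegular μ d Q c) {s : ℝ} (hs0 : 0 < s)
    (hsQ : 2 * s < Q) {u : X → ℝ} (hu : Measurable u) {S : ℝ} (hS : 0 < S)
    (huS : ∫⁻ x, ENNReal.ofReal (|u x| ^ (2 * Q / (Q - 2 * s))) ∂μ ≤ ENNReal.ofReal S) (x : X) :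
    ENNReal.ofReal (|u x| ^ (2 * Q / (Q - 2 * s))) ≤
      ENNReal.ofReal (8 / c * (2 ^ (2 * Q / (Q - 2 * s) + 1) / c) ^ (2 * s / Q) * S ^ (2 * s / Q)) *
        ∫⁻ y, ENNReal.ofReal ((u x - u y) ^ 2 / d x y ^ (Q + 2 * s)) ∂μ := by
  have hQ := h.dim_pos
  have hc := h.density_pos
  set p := 2 * Q / (Q - 2 * s) with hp
  have hQs : 0 < Q - 2 * s := by linarith
  have hp0 : 0 < p := by positivity
  rcases (abs_nonneg (u x)).eq_or_lt with ha | ha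
  · rw [← ha, Real.zero_rpow hp0.ne']
    simp
  set a := |u x| with hadef
  -- `m` is twice the Chebyshev bound for the measure of `{|u| ≥ a/2}`, and `r` is the radius of a
  -- ball of measure `m`. Hence on at least half of that ball around `x` the difference `|u x - u
  -- y|` is at least `a/2`.
  set m := 2 ^ (p + 1) * S / a ^ p with hm
  have hm0 : 0 < m := by positivity
  set r := (m / c) ^ (1 / Q) with hr
  have hr0 : 0 < r := by positivity
  have hrQ : c * r ^ Q = m := by
    rw [hr, ← Real.rpow_mul (by positivity), one_div_mul_cancel hQ.ne', Real.rpow_one]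
    field_simp
  set B := {y | d x y < r}
  set Bad := {y | ENNReal.ofReal ((a / 2) ^ p) ≤ ENNReal.ofReal (|u y| ^ p)} with hBad
  have hmeas : Measurable fun y => ENNReal.ofReal (|u y| ^ p) :=
    (hu.abs.pow_const p).ennreal_ofReal
  have hμB : μ B = ENNReal.ofReal m := by rw [h.measure_ball x r hr0, hrQ]
  have hμBad : μ Bad ≤ ENNReal.ofReal (m / 2) := by
    have h1 := (mul_meas_ge_le_lintegral₀ (μ := μ) hmeas.aemeasurable
      (ENNReal.ofReal ((a / 2) ^ p))).trans huS
    have hpos : 0 < (a / 2) ^ p := by positivity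
    have h2 : ENNReal.ofReal S = ENNReal.ofReal ((a / 2) ^ p) * ENNReal.ofReal (m / 2) := by
      rw [← ENNReal.ofReal_mul hpos.le, hm, Real.div_rpow ha.le (by norm_num),
        Real.rpow_add (by norm_num), Real.rpow_one]
      congr 1
      field_simp
    rw [h2] at h1
    exact (ENNReal.mul_le_mul_iff_right (by simpa using hpos) ENNReal.ofReal_ne_top).1 h1
  have hμdiff : ENNReal.ofReal (m / 2) ≤ μ (B \ Bad) := by
    refine le_trans ?_ (le_measure_sdiff)
    rw [hμB]
    refine le_trans ?_ (tsub_le_tsub_left hμBad _)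
    rw [← ENNReal.ofReal_sub _ (by positivity)]
    exact ENNReal.ofReal_le_ofReal (by linarith)
  have hmsd : MeasurableSet (B \ Bad) :=
    (h.measurableSet_ball x r).diff (measurableSet_le measurable_const hmeas)
  have hD : ENNReal.ofReal ((a / 2) ^ 2 / r ^ (Q + 2 * s) * (m / 2)) ≤
      ∫⁻ y, ENNReal.ofReal ((u x - u y) ^ 2 / d x y ^ (Q + 2 * s)) ∂μ := by
    calc _ = ENNReal.ofReal ((a / 2) ^ 2 / r ^ (Q + 2 * s)) * ENNReal.ofReal (m / 2) :=
          ENNReal.ofReal_mul (by positivity)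
      _ ≤ ENNReal.ofReal ((a / 2) ^ 2 / r ^ (Q + 2 * s)) * μ (B \ Bad) := by gcongr
      _ = ∫⁻ y in B \ Bad, ENNReal.ofReal ((a / 2) ^ 2 / r ^ (Q + 2 * s)) ∂μ := by
          rw [setLIntegral_const]
      _ ≤ ∫⁻ y in B \ Bad, ENNReal.ofReal ((u x - u y) ^ 2 / d x y ^ (Q + 2 * s)) ∂μ := by
          refine setLIntegral_mono' hmsd fun y hy => ENNReal.ofReal_le_ofReal ?_
          have hyB : d x y < r := hy.1
          have hy2 : |u y| < a / 2 := by
            by_contra hcon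
            push Not at hcon
            exact hy.2 (ENNReal.ofReal_le_ofReal
              (Real.rpow_le_rpow (by positivity) hcon hp0.le))
          have hne : x ≠ y := by
            rintro rfl
            linarith
          have hd := h.pos_of_ne x y hne
          have hsub : a / 2 ≤ |u x - u y| := by
            have := abs_sub_abs_le_abs_sub (u x) (u y)
            linarith
          have : (a / 2) ^ 2 ≤ (u x - u y) ^ 2 := by
            rw [← sq_abs (u x - u y)]
            gcongr
          gcongr
      _ ≤ _ := setLIntegral_le_lintegral _ _
  refine le_trans ?_ (mul_le_mul_right hD _)
  rw [← ENNReal.ofReal_mul (by positivity)]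
  refine ENNReal.ofReal_le_ofReal (le_of_eq ?_)
  have hrq : r ^ (Q + 2 * s) = (m / c) * ((2 ^ (p + 1) / c) ^ (2 * s / Q) * S ^ (2 * s / Q) /
      a ^ (p * (2 * s / Q))) := by
    rw [hr, ← Real.rpow_mul (by positivity),
      show 1 / Q * (Q + 2 * s) = 1 + 2 * s / Q by field_simp,
      Real.rpow_add (by positivity), Real.rpow_one, Real.rpow_mul ha.le,
      ← Real.mul_rpow (by positivity) (by positivity), ← Real.div_rpow (by positivity)
        (by positivity)]
    congr 2
    rw [hm]
    field_simp
  -- The critical exponent is the one for which `p = 2 + 2sp/Q`.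
  have hap : a ^ p = a ^ 2 * a ^ (p * (2 * s / Q)) := by
    rw [← Real.rpow_natCast a 2, ← Real.rpow_add ha]
    congr 1
    rw [hp]
    field_simp
    push_cast
    ring
  rw [hrq, hap]
  field_simp
  norm_num

/-- The fractional Sobolev inequality. -/
lemma exists_sobolev [SFinite μ] (h : IsAhlforsRegular μ d Q c) {s : ℝ} (hs0 : 0 < s)
    (hsQ : 2 * s < Q) :
    ∃ C : ℝ, 0 < C ∧ ∀ u : X → ℝ, Measurable u →
      ∫⁻ x, ENNReal.ofReal (|u x| ^ (2 * Q / (Q - 2 * s))) ∂μ ≠ ⊤ →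
      (∫⁻ x, ENNReal.ofReal (|u x| ^ (2 * Q / (Q - 2 * s))) ∂μ) ^ ((Q - 2 * s) / Q) ≤
        ENNReal.ofReal C * fracEnergy μ d (Q + 2 * s) u := by
  have hQ := h.dim_pos
  have hc := h.density_pos
  have hQs : 0 < Q - 2 * s := by linarith
  refine ⟨8 / c * (2 ^ (2 * Q / (Q - 2 * s) + 1) / c) ^ (2 * s / Q), by positivity,
    fun u hu hfin => ?_⟩
  set C := 8 / c * (2 ^ (2 * Q / (Q - 2 * s) + 1) / c) ^ (2 * s / Q) with hC
  set p := 2 * Q / (Q - 2 * s) with hp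
  have hC0 : 0 < C := by positivity
  set I := ∫⁻ x, ENNReal.ofReal (|u x| ^ p) ∂μ with hI
  rcases eq_or_ne I 0 with h0 | h0
  · rw [h0, ENNReal.zero_rpow_of_pos (by positivity)]
    exact zero_le
  set S := I.toReal with hSdef
  have hS : 0 < S := ENNReal.toReal_pos h0 hfin
  have hIS : I = ENNReal.ofReal S := (ENNReal.ofReal_toReal hfin).symm
  have hS' : 0 < S ^ (2 * s / Q) := by positivity
  have key : I ≤ ENNReal.ofReal (C * S ^ (2 * s / Q)) * fracEnergy μ d (Q + 2 * s) u := by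
    rw [h.fracEnergy_eq_lintegral _ hu, ← lintegral_const_mul' _ _ ENNReal.ofReal_ne_top]
    exact lintegral_mono fun x => h.rpow_abs_le_mul_lintegral hs0 hsQ hu hS hIS.le x
  -- The integrated pointwise bound has `S^(2s/Q)` on the right. It is cancelled against the same
  -- factor of `I`, which is why `I` must be known to be finite.
  have hsplit : I = ENNReal.ofReal (S ^ (2 * s / Q)) * I ^ ((Q - 2 * s) / Q) := by
    rw [hIS, ENNReal.ofReal_rpow_of_pos hS, ← ENNReal.ofReal_mul hS'.le, ← Real.rpow_add hS]
    congr 1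
    rw [show 2 * s / Q + (Q - 2 * s) / Q = 1 by field_simp; ring, Real.rpow_one]
  rw [mul_comm C, ENNReal.ofReal_mul hS'.le, mul_assoc] at key
  nth_rewrite 1 [hsplit] at key
  exact (ENNReal.mul_le_mul_iff_right (by simpa using hS') ENNReal.ofReal_ne_top).1 key

end IsAhlforsRegular

/-- Hölder against the constant function on `A`. The power of `μ A` that comes out is the source of
all gains in the De Giorgi step. -/
lemma setLIntegral_rpow_le {X : Type*} [MeasurableSpace X] {μ : Measure X} {f : X → ℝ≥0∞}
    (hf : AEMeasurable f μ) {a b : ℝ} (ha : 0 < a) (hab : a < b) (A : Set X) :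
    ∫⁻ x in A, f x ^ a ∂μ ≤ (∫⁻ x in A, f x ^ b ∂μ) ^ (a / b) * μ A ^ (1 - a / b) := by
  have hb : 0 < b := ha.trans hab
  have hpq : (b / a).HolderConjugate (b / (b - a)) := by
    refine Real.holderConjugate_iff.2 ⟨(one_lt_div ha).2 hab, ?_⟩
    field_simp
    ring
  have := ENNReal.lintegral_mul_le_Lp_mul_Lq (μ.restrict A) hpq (f := fun x => f x ^ a)
    (g := fun _ => 1) (hf.restrict.pow_const a) aemeasurable_const
  simp only [Pi.mul_apply, mul_one, ENNReal.one_rpow, lintegral_const, one_mul,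
    Measure.restrict_apply MeasurableSet.univ, Set.univ_inter] at this
  refine this.trans (le_of_eq ?_)
  congr 1
  · congr 1
    · refine lintegral_congr fun x => ?_
      rw [← ENNReal.rpow_mul, mul_div_cancel₀ _ ha.ne']
    · field_simp
  · congr 1
    field_simp

/-- Hölder with the conjugate pair `Q/(2s)`, `Q/(Q - 2s)`. Together with the Sobolev inequality it
bounds a weight in the critical Lebesgue space by the energy. -/
lemma lintegral_mul_sq_le {X : Type*} [MeasurableSpace X] {μ : Measure X} {W f : X → ℝ≥0∞}
    (hW : AEMeasurable W μ) (hf : AEMeasurable f μ) {Q s : ℝ} (hs0 : 0 < s) (hsQ : 2 * s < Q) :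
    ∫⁻ x, W x * f x ^ (2 : ℝ) ∂μ ≤ (∫⁻ x, W x ^ (Q / (2 * s)) ∂μ) ^ (2 * s / Q) *
      (∫⁻ x, f x ^ (2 * Q / (Q - 2 * s)) ∂μ) ^ ((Q - 2 * s) / Q) := by
  have hQ : 0 < Q := by linarith
  have hQs : 0 < Q - 2 * s := by linarith
  have hpq : (Q / (2 * s)).HolderConjugate (Q / (Q - 2 * s)) := by
    refine Real.holderConjugate_iff.2 ⟨(one_lt_div (by linarith)).2 hsQ, ?_⟩
    field_simp
    ring
  have := ENNReal.lintegral_mul_le_Lp_mul_Lq μ hpq (f := W)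
    (g := fun x => f x ^ (2 : ℝ)) hW (hf.pow_const 2)
  refine this.trans (le_of_eq ?_)
  congr 1
  · congr 1
    field_simp
  · congr 1
    · refine lintegral_congr fun x => ?_
      rw [← ENNReal.rpow_mul]
      congr 1
      ring
    · field_simp
end

/-! ### Cutoffs and the nonlocal term of the Caccioppoli inequality. -/

noncomputable section

/-- `η` is a cutoff function between the balls of radii `r < ρ` around `x₀`. -/
structure IsCutoff {X : Type*} [MeasurableSpace X] (d : X → X → ℝ) (L : ℝ) (x₀ : X) (r ρ : ℝ)
    (η : X → ℝ) : Prop where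
  measurable : Measurable η
  nonneg : ∀ x, 0 ≤ η x
  le_one : ∀ x, η x ≤ 1
  eq_one : ∀ x, d x₀ x < r → η x = 1
  eq_zero : ∀ x, ρ ≤ d x₀ x → η x = 0
  sq_sub_le : ∀ x y, (η x - η y) ^ 2 ≤ L * min 1 ((d x y / (ρ - r)) ^ 2)

/-- The nonlocal Caccioppoli inequality for the truncations of `u`, localized by `η`. -/
def CaccioppoliIneq {X : Type*} [MeasurableSpace X] (μ : Measure X) (d : X → X → ℝ) (q : ℝ)
    (u V η : X → ℝ) : Prop :=
  ∀ k : ℝ, 0 ≤ k → fracEnergy μ d q (fun x => max (u x - k) 0 * η x) ≤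
    ∫⁻ x, ENNReal.ofReal (|V x| * (u x * max (u x - k) 0 * η x ^ 2)) ∂μ +
    ∫⁻ z : X × X, ENNReal.ofReal (max (u z.1 - k) 0 * max (u z.2 - k) 0 *
      (η z.1 - η z.2) ^ 2 / d z.1 z.2 ^ q) ∂(μ.prod μ)

namespace IsAhlforsRegular

variable {X : Type*} [MeasurableSpace X] {μ : Measure X} {d : X → X → ℝ} {Q c : ℝ}

/-- Since `d x₀ y ≥ ρ`, the loss `ρ'` in the triangle inequality is at most the fraction `ρ'/ρ` of
`d x₀ y`. So the kernel seen from `x` may be replaced by the kernel seen from the centre, as the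
tail requires. -/
lemma inv_kernel_le (h : IsAhlforsRegular μ d Q c) {q : ℝ} (hq : 0 < q) {x₀ x y : X} {ρ' ρ : ℝ}
    (hρ' : 0 < ρ') (hρ : ρ' < ρ) (hx : d x₀ x < ρ') (hy : ρ ≤ d x₀ y) :
    1 / d x y ^ q ≤ (ρ / (ρ - ρ')) ^ q / d x₀ y ^ q := by
  have h1 : 0 < ρ - ρ' := by linarith
  have h2 : 0 < d x₀ y := by linarith
  have h3 : d x₀ y * ((ρ - ρ') / ρ) ≤ d x y := by
    have := h.triangle x₀ x y
    have h4 : d x₀ y * ((ρ - ρ') / ρ) = d x₀ y - d x₀ y / ρ * ρ' := by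
      field_simp
      rw [sub_div, div_self (by linarith : ρ ≠ 0)]
    have h5 : 1 ≤ d x₀ y / ρ := by
      rw [one_le_div (by linarith)]
      exact hy
    rw [h4]
    nlinarith
  have h6 : 0 < d x₀ y * ((ρ - ρ') / ρ) := by
    have : 0 < ρ := by linarith
    positivity
  calc 1 / d x y ^ q ≤ 1 / (d x₀ y * ((ρ - ρ') / ρ)) ^ q := by gcongr
    _ = _ := by
      have : 0 < ρ := by linarith
      rw [Real.mul_rpow h2.le (by positivity), Real.div_rpow h1.le this.le,
        Real.div_rpow this.le h1.le]
      field_simp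

lemma lintegral_prod_swap_eq [SFinite μ] (F : X × X → ℝ≥0∞) (hF : Measurable F) :
    ∫⁻ z : X × X, F z.swap ∂(μ.prod μ) = ∫⁻ z : X × X, F z ∂(μ.prod μ) :=
  (Measure.measurePreserving_swap (μ := μ) (ν := μ)).lintegral_comp hF

set_option maxHeartbeats 400000 in
/-- The nonlocal term of the Caccioppoli inequality is controlled by local norms and the tail. -/
lemma lintegral_cutoff_le [SFinite μ] (h : IsAhlforsRegular μ d Q c) {s Ck L : ℝ} (hs0 : 0 < s)
    (hL : 0 < L) (hCk : 0 < Ck)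
    (hker : ∀ (x : X) (ℓ : ℝ), 0 < ℓ →
      ∫⁻ y, ENNReal.ofReal (min 1 ((d x y / ℓ) ^ 2) / d x y ^ (Q + 2 * s)) ∂μ ≤
        ENNReal.ofReal (Ck * ℓ ^ (-(2 * s))))
    {u w η : X → ℝ} (hu : Measurable u) (hw : Measurable w) (hw0 : ∀ x, 0 ≤ w x)
    (hwu : ∀ x, w x ≤ u x) {x₀ : X} {R r ρ T : ℝ} (hR : 0 < R) (hr : R / 2 ≤ r) (hrρ : r < ρ)
    (hρ : ρ ≤ R) (hη : IsCutoff d L x₀ r ((r + ρ) / 2) η)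
    (hT0 : 0 ≤ T)
    (hT : ∫⁻ y in {y | R / 2 < d x₀ y}, ENNReal.ofReal (u y / d x₀ y ^ (Q + 2 * s)) ∂μ ≤
      ENNReal.ofReal (T * R ^ (-(2 * s)))) :
    ∫⁻ z : X × X, ENNReal.ofReal (w z.1 * w z.2 * (η z.1 - η z.2) ^ 2 /
        d z.1 z.2 ^ (Q + 2 * s)) ∂(μ.prod μ) ≤
      ENNReal.ofReal (2 * (L * Ck + 1) * 2 ^ (Q + 2 * s) * (R / (ρ - r)) ^ (Q + 2 * s) *
        R ^ (-(2 * s))) *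
      (∫⁻ x in {x | d x₀ x < ρ}, ENNReal.ofReal (w x ^ 2) ∂μ +
        ENNReal.ofReal T * ∫⁻ x in {x | d x₀ x < ρ}, ENNReal.ofReal (w x) ∂μ) := by
  have hQ := h.dim_pos
  set q := Q + 2 * s with hq
  have hq0 : 0 < q := by positivity
  have hr0 : 0 < r := by linarith
  have hρr : 0 < ρ - r := by linarith
  set B := {x | d x₀ x < ρ} with hB
  have hBm : MeasurableSet B := h.measurableSet_ball x₀ ρ
  set M := (2 * R / (ρ - r)) ^ q with hM
  have hM0 : 0 < M := by positivity
  -- `F₁` treats pairs inside `B`, and `a ⊗ b` treats pairs with the second point outside. In the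
  -- second case the gap between the support of `η`, of radius `(r + ρ)/2`, and the complement of
  -- `B` keeps the kernel comparable to that of the tail.
  set F₁ : X × X → ℝ≥0∞ := fun z => B.indicator (fun x => ENNReal.ofReal (w x ^ 2)) z.1 *
    ENNReal.ofReal ((η z.1 - η z.2) ^ 2 / d z.1 z.2 ^ q) with hF₁
  set a : X → ℝ≥0∞ := B.indicator fun x => ENNReal.ofReal (w x) with ha
  set b : X → ℝ≥0∞ := {y | R / 2 < d x₀ y}.indicator fun y =>
    ENNReal.ofReal (M * (u y / d x₀ y ^ q)) with hb
  have hmη : Measurable fun z : X × X => ENNReal.ofReal ((η z.1 - η z.2) ^ 2 / d z.1 z.2 ^ q) :=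
    (h.measurable_energy_integrand q hη.measurable).ennreal_ofReal
  have hTm : MeasurableSet {y | R / 2 < d x₀ y} :=
    measurableSet_lt measurable_const (h.measurable_dist_right x₀)
  have hmF₁ : Measurable F₁ :=
    (((hw.pow_const 2).ennreal_ofReal.indicator hBm).comp measurable_fst).mul hmη
  have hma : Measurable a := hw.ennreal_ofReal.indicator hBm
  have hmb : Measurable b := (measurable_const.mul
    (hu.div ((h.measurable_dist_right x₀).pow_const q))).ennreal_ofReal.indicator hTm
  have hfar : ∀ x y, d x₀ x < ρ → ρ ≤ d x₀ y →
      ENNReal.ofReal (w x * w y * (η x - η y) ^ 2 / d x y ^ q) ≤ a x * b y := by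
    intro x y hx hy
    have hηy : η y = 0 := hη.eq_zero y (by linarith)
    have hxa : a x = ENNReal.ofReal (w x) := Set.indicator_of_mem (s := B) hx _
    have hyb : b y = ENNReal.ofReal (M * (u y / d x₀ y ^ q)) :=
      Set.indicator_of_mem (s := {y | R / 2 < d x₀ y}) (by simp only [Set.mem_ofPred_eq]; linarith) _
    rcases lt_or_ge (d x₀ x) ((r + ρ) / 2) with hx' | hx'
    · rw [hxa, hyb, ← ENNReal.ofReal_mul (hw0 x)]
      apply ENNReal.ofReal_le_ofReal
      have h1 := h.inv_kernel_le hq0 (by linarith) (by linarith : (r + ρ) / 2 < ρ) hx' hy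
      have h2 : (ρ / (ρ - (r + ρ) / 2)) ^ q ≤ M := by
        have e : ρ / (ρ - (r + ρ) / 2) = 2 * ρ / (ρ - r) := by
          rw [div_eq_div_iff (by linarith) hρr.ne']
          ring
        rw [hM, e]
        have : 0 ≤ ρ := by linarith
        gcongr
      have hd : 0 ≤ d x₀ y ^ q := Real.rpow_nonneg (h.nonneg _ _) _
      have hd' : 0 ≤ 1 / d x y ^ q := div_nonneg zero_le_one (Real.rpow_nonneg (h.nonneg _ _) _)
      have h3 : (η x - η y) ^ 2 ≤ 1 := by
        rw [hηy, sub_zero]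
        exact pow_le_one₀ (hη.nonneg x) (hη.le_one x)
      have hwx := hw0 x
      have hwy := hw0 y
      calc w x * w y * (η x - η y) ^ 2 / d x y ^ q
          = w x * w y * (η x - η y) ^ 2 * (1 / d x y ^ q) := by ring
        _ ≤ w x * u y * 1 * (M / d x₀ y ^ q) := by
          have := hwu y
          have hu0 : 0 ≤ u y := hwy.trans this
          have h4 := h1.trans (div_le_div_of_nonneg_right h2 hd)
          gcongr ?_ * ?_ * ?_ * ?_
        _ = _ := by ring
    · have hηx : η x = 0 := hη.eq_zero x hx'
      simp [hηx, hηy]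
  -- Both points in `B`: the product `w x * w y` is at most the sum of the squares. One point
  -- outside: `hfar`, up to symmetry. Both outside: `η` vanishes twice.
  have hpt : ∀ z : X × X, ENNReal.ofReal (w z.1 * w z.2 * (η z.1 - η z.2) ^ 2 / d z.1 z.2 ^ q) ≤
      (F₁ z + a z.1 * b z.2) + (F₁ z.swap + a z.swap.1 * b z.swap.2) := by
    rintro ⟨x, y⟩
    simp only [Prod.swap_prod_mk]
    have hsym : w x * w y * (η x - η y) ^ 2 / d x y ^ q =
        w y * w x * (η y - η x) ^ 2 / d y x ^ q := by
      rw [h.symm x y]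
      ring
    rcases lt_or_ge (d x₀ x) ρ with hx | hx <;> rcases lt_or_ge (d x₀ y) ρ with hy | hy
    · have e1 : F₁ (x, y) = ENNReal.ofReal (w x ^ 2 * ((η x - η y) ^ 2 / d x y ^ q)) := by
        simp only [hF₁]
        rw [Set.indicator_of_mem (s := B) hx, ENNReal.ofReal_mul (by positivity)]
      have e2 : F₁ (y, x) = ENNReal.ofReal (w y ^ 2 * ((η x - η y) ^ 2 / d x y ^ q)) := by
        simp only [hF₁]
        rw [Set.indicator_of_mem (s := B) hy, ENNReal.ofReal_mul (by positivity), h.symm y x,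
          sub_sq_comm]
      have h0 : 0 ≤ (η x - η y) ^ 2 / d x y ^ q :=
        div_nonneg (sq_nonneg _) (Real.rpow_nonneg (h.nonneg _ _) _)
      calc _ ≤ F₁ (x, y) + F₁ (y, x) := by
            rw [e1, e2, ← ENNReal.ofReal_add (by positivity) (by positivity)]
            apply ENNReal.ofReal_le_ofReal
            rw [mul_div_assoc, ← add_mul]
            gcongr
            nlinarith [sq_nonneg (w x - w y), sq_nonneg (w x), sq_nonneg (w y)]
        _ ≤ _ := by gcongr <;> exact le_self_add
    · exact (hfar x y hx hy).trans (le_add_self.trans le_self_add)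
    · rw [hsym]
      exact (hfar y x hy hx).trans (le_add_self.trans le_add_self)
    · simp [hη.eq_zero x (by linarith), hη.eq_zero y (by linarith)]
  have hI₁ : ∫⁻ z : X × X, F₁ z ∂(μ.prod μ) ≤
      ENNReal.ofReal (L * (Ck * ((r + ρ) / 2 - r) ^ (-(2 * s)))) *
        ∫⁻ x in B, ENNReal.ofReal (w x ^ 2) ∂μ := by
    rw [lintegral_prod _ hmF₁.aemeasurable, ← lintegral_indicator hBm,
      ← lintegral_const_mul' _ _ ENNReal.ofReal_ne_top]
    refine lintegral_mono fun x => ?_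
    simp only [hF₁]
    have hmηx : Measurable fun y => ENNReal.ofReal ((η x - η y) ^ 2 / d x y ^ q) :=
      (((measurable_const.sub hη.measurable).pow_const 2).div
        ((h.measurable_dist_right x).pow_const q)).ennreal_ofReal
    rw [lintegral_const_mul _ hmηx, mul_comm]
    gcongr
    calc _ ≤ ∫⁻ y, ENNReal.ofReal L * ENNReal.ofReal
          (min 1 ((d x y / ((r + ρ) / 2 - r)) ^ 2) / d x y ^ q) ∂μ := by
          refine lintegral_mono fun y => ?_
          rw [← ENNReal.ofReal_mul hL.le]
          apply ENNReal.ofReal_le_ofReal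
          rw [← mul_div_assoc]
          have := Real.rpow_nonneg (h.nonneg x y) q
          gcongr
          exact hη.sq_sub_le x y
      _ ≤ _ := by
          rw [lintegral_const_mul' _ _ ENNReal.ofReal_ne_top, ENNReal.ofReal_mul hL.le]
          gcongr
          exact hker x _ (by linarith)
  have hI₂ : ∫⁻ z : X × X, a z.1 * b z.2 ∂(μ.prod μ) ≤
      (∫⁻ x in B, ENNReal.ofReal (w x) ∂μ) * ENNReal.ofReal (M * (T * R ^ (-(2 * s)))) := by
    rw [lintegral_prod_mul hma.aemeasurable hmb.aemeasurable, ha, lintegral_indicator hBm, hb,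
      lintegral_indicator hTm]
    gcongr
    simp_rw [ENNReal.ofReal_mul hM0.le]
    rw [lintegral_const_mul' _ _ ENNReal.ofReal_ne_top]
    gcongr
  have hmF : Measurable fun z : X × X => F₁ z + a z.1 * b z.2 :=
    hmF₁.add ((hma.comp measurable_fst).mul (hmb.comp measurable_snd))
  set τ := R / (ρ - r) with hτ
  have hτ1 : 1 ≤ 2 * τ := by
    rw [hτ, ← mul_div_assoc, one_le_div hρr]
    linarith
  have hMτ : M = (2 * τ) ^ q := by rw [hM, hτ, mul_div_assoc]
  -- As `2τ ≥ 1`, the exponent `2s` may be raised to `q`, so that the local and the tail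
  -- contribution carry the same factor `M R^(-2s)`.
  have hℓ : ((r + ρ) / 2 - r) ^ (-(2 * s)) ≤ M * R ^ (-(2 * s)) := by
    have e : (r + ρ) / 2 - r = R / (2 * τ) := by
      rw [hτ]
      field_simp
      ring
    have hτ0 : 0 < 2 * τ := by linarith
    rw [e, Real.div_rpow hR.le hτ0.le, div_eq_mul_inv, ← Real.rpow_neg hτ0.le, neg_neg, mul_comm,
      hMτ]
    gcongr
    linarith
  calc _ ≤ ∫⁻ z : X × X, (F₁ z + a z.1 * b z.2) + (F₁ z.swap + a z.swap.1 * b z.swap.2)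
        ∂(μ.prod μ) := lintegral_mono hpt
    _ = 2 * ∫⁻ z : X × X, (F₁ z + a z.1 * b z.2) ∂(μ.prod μ) := by
        rw [lintegral_add_left hmF, lintegral_prod_swap_eq (fun z => F₁ z + a z.1 * b z.2) hmF,
          two_mul]
    _ ≤ 2 * (ENNReal.ofReal (L * (Ck * ((r + ρ) / 2 - r) ^ (-(2 * s)))) *
        ∫⁻ x in B, ENNReal.ofReal (w x ^ 2) ∂μ +
        (∫⁻ x in B, ENNReal.ofReal (w x) ∂μ) * ENNReal.ofReal (M * (T * R ^ (-(2 * s))))) := by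
        rw [lintegral_add_left hmF₁]
        gcongr
    _ ≤ 2 * (ENNReal.ofReal ((L * Ck + 1) * M * R ^ (-(2 * s))) *
        ∫⁻ x in B, ENNReal.ofReal (w x ^ 2) ∂μ +
        (∫⁻ x in B, ENNReal.ofReal (w x) ∂μ) *
          (ENNReal.ofReal ((L * Ck + 1) * M * R ^ (-(2 * s))) * ENNReal.ofReal T)) := by
        have hR' : 0 < R ^ (-(2 * s)) := by positivity
        gcongr 2 * (ENNReal.ofReal ?_ * _ + _ * ?_)
        · calc L * (Ck * ((r + ρ) / 2 - r) ^ (-(2 * s))) ≤ L * (Ck * (M * R ^ (-(2 * s)))) := by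
                gcongr
            _ ≤ _ := by nlinarith [mul_pos hM0 hR']
        · rw [← ENNReal.ofReal_mul (by positivity)]
          apply ENNReal.ofReal_le_ofReal
          have : 0 ≤ M * (T * R ^ (-(2 * s))) := by positivity
          have h2 : 0 ≤ L * Ck * (M * (T * R ^ (-(2 * s)))) := by positivity
          nlinarith
    _ = _ := by
        have e : 2 * (L * Ck + 1) * 2 ^ q * τ ^ q * R ^ (-(2 * s)) =
            2 * ((L * Ck + 1) * M * R ^ (-(2 * s))) := by
          rw [hMτ, Real.mul_rpow (by norm_num) (by linarith)]
          ring
        rw [e, ENNReal.ofReal_mul (p := 2) (by norm_num), ENNReal.ofReal_ofNat]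
        ring

end IsAhlforsRegular
end

/-! ### One step of the De Giorgi iteration. -/

noncomputable section

/-- The data of the De Giorgi iteration on the ball `B(x₀, R)`: a nonnegative function `u` whose
truncations satisfy Caccioppoli inequalities, a scale-invariant bound `K` for the potential `V`,
a bound `T` for the tail of `u`, and the constants of the kernel and Sobolev estimates. -/
structure DeGiorgiData {X : Type*} [MeasurableSpace X] (μ : Measure X) (d : X → X → ℝ)
    (Q c s t₀ L Ck CS K : ℝ) (u V : X → ℝ) (x₀ : X) (R T : ℝ) : Prop where
  regular : IsAhlforsRegular μ d Q c
  s_pos : 0 < s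
  two_s_lt : 2 * s < Q
  lt_exponent : Q / (2 * s) < t₀
  L_pos : 0 < L
  Ck_pos : 0 < Ck
  CS_pos : 0 < CS
  K_pos : 0 < K
  R_pos : 0 < R
  T_nonneg : 0 ≤ T
  kernel : ∀ (x : X) (ℓ : ℝ), 0 < ℓ →
    ∫⁻ y, ENNReal.ofReal (min 1 ((d x y / ℓ) ^ 2) / d x y ^ (Q + 2 * s)) ∂μ ≤
      ENNReal.ofReal (Ck * ℓ ^ (-(2 * s)))
  sobolev : ∀ u : X → ℝ, Measurable u →
    ∫⁻ x, ENNReal.ofReal (|u x| ^ (2 * Q / (Q - 2 * s))) ∂μ ≠ ⊤ →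
    (∫⁻ x, ENNReal.ofReal (|u x| ^ (2 * Q / (Q - 2 * s))) ∂μ) ^ ((Q - 2 * s) / Q) ≤
      ENNReal.ofReal CS * fracEnergy μ d (Q + 2 * s) u
  measurable_u : Measurable u
  nonneg_u : ∀ x, 0 ≤ u x
  measurable_V : Measurable V
  lintegral_u_ne_top : ∫⁻ x, ENNReal.ofReal (|u x| ^ (2 * Q / (Q - 2 * s))) ∂μ ≠ ⊤
  potential : (∫⁻ x in {x | d x₀ x < R}, ENNReal.ofReal |V x| ^ t₀ ∂μ) ^ (1 / t₀) ≤
    ENNReal.ofReal (K * R ^ (-(Q * (2 * s / Q - 1 / t₀))))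
  tail : ∫⁻ y in {y | R / 2 < d x₀ y}, ENNReal.ofReal (u y / d x₀ y ^ (Q + 2 * s)) ∂μ ≤
    ENNReal.ofReal (T * R ^ (-(2 * s)))
  caccioppoli : ∀ r ρ : ℝ, 0 < r → r < ρ → ρ ≤ R →
    ∃ η, IsCutoff d L x₀ r ρ η ∧ CaccioppoliIneq μ d (Q + 2 * s) u V η

/-- Bookkeeping of exponents, with `z` the normalized measure of the superlevel set. The powers of
`R` collapse to `R^Q`. The power of `z` from Hölder, `2s/Q`, adds up with the power `1 - 1/t₀` from
the potential to more than one. The nonlocal part has the larger exponent `1 + 2s/Q`, which may be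
lowered because `z ≤ 1`. -/
lemma deGiorgi_numeric {Q s t₀ K CS C₂ R z k θ τ q : ℝ} (hQ : 0 < Q) (hs0 : 0 < s)
    (ht₀ : 1 ≤ t₀) (hK : 0 < K) (hCS : 0 < CS) (hC₂ : 0 < C₂) (hR : 0 < R) (hz0 : 0 < z)
    (hz1 : z ≤ 1) (hk : 0 < k) (hθ0 : 0 < θ) (hθ1 : θ ≤ 1) (hτ : 1 ≤ τ) (hq : 0 < q) :
    (R ^ Q * z) ^ (2 * s / Q) * (2 * (CS * (k ^ 2 * (K * R ^ (-(Q * (2 * s / Q - 1 / t₀))) *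
        (R ^ Q * z) ^ (1 - 1 / t₀)) +
        C₂ * τ ^ q * R ^ (-(2 * s)) * (2 / θ * (z * θ ^ 2 * (k ^ 2 * R ^ Q)))))) ≤
      2 * CS * (K + 2 * C₂) * τ ^ q / θ * z ^ (1 + (2 * s / Q - 1 / t₀)) * (k ^ 2 * R ^ Q) := by
  have ht0 : 0 < t₀ := by linarith
  have hRQ : 0 < R ^ Q := by positivity
  have e1 : (R ^ Q * z) ^ (2 * s / Q) = R ^ (2 * s) * z ^ (2 * s / Q) := by
    rw [Real.mul_rpow hRQ.le hz0.le, ← Real.rpow_mul hR.le]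
    congr 2
    field_simp
  have e2 : (R ^ Q * z) ^ (1 - 1 / t₀) = R ^ (Q * (1 - 1 / t₀)) * z ^ (1 - 1 / t₀) := by
    rw [Real.mul_rpow hRQ.le hz0.le, ← Real.rpow_mul hR.le]
  have e3 : R ^ (2 * s) * (R ^ (-(Q * (2 * s / Q - 1 / t₀))) * R ^ (Q * (1 - 1 / t₀))) = R ^ Q := by
    rw [← Real.rpow_add hR, ← Real.rpow_add hR]
    congr 1
    field_simp
    ring
  have e4 : z ^ (2 * s / Q) * z ^ (1 - 1 / t₀) = z ^ (1 + (2 * s / Q - 1 / t₀)) := by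
    rw [← Real.rpow_add hz0]
    congr 1
    ring
  have e5 : R ^ (2 * s) * R ^ (-(2 * s)) = 1 := by
    rw [← Real.rpow_add hR, add_neg_cancel, Real.rpow_zero]
  have e6 : z ^ (2 * s / Q) * z ≤ z ^ (1 + (2 * s / Q - 1 / t₀)) := by
    calc z ^ (2 * s / Q) * z = z ^ (1 + 2 * s / Q) := by
          rw [Real.rpow_add hz0, Real.rpow_one, mul_comm]
      _ ≤ _ := Real.rpow_le_rpow_of_exponent_ge hz0 hz1 (by
          have : 0 < 1 / t₀ := by positivity
          linarith)
  set Z := z ^ (1 + (2 * s / Q - 1 / t₀))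
  have hZ : 0 < Z := by positivity
  have hτq : 1 ≤ τ ^ q := Real.one_le_rpow hτ hq.le
  have hθi : 1 ≤ τ ^ q / θ := by
    rw [le_div_iff₀ hθ0]
    linarith
  have hθθ : 2 / θ * θ ^ 2 ≤ 2 / θ := by
    have : θ ^ 2 ≤ 1 := pow_le_one₀ hθ0.le hθ1
    have h2 : 0 < 2 / θ := by positivity
    nlinarith
  calc _ = 2 * CS * (k ^ 2 * K * (R ^ (2 * s) * (R ^ (-(Q * (2 * s / Q - 1 / t₀))) *
          R ^ (Q * (1 - 1 / t₀)))) * (z ^ (2 * s / Q) * z ^ (1 - 1 / t₀)) +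
          C₂ * τ ^ q * (R ^ (2 * s) * R ^ (-(2 * s))) * (2 / θ * θ ^ 2) *
            (z ^ (2 * s / Q) * z) * (k ^ 2 * R ^ Q)) := by
        rw [e1, e2]
        ring
    _ = 2 * CS * (k ^ 2 * K * R ^ Q * Z + C₂ * τ ^ q * 1 * (2 / θ * θ ^ 2) *
            (z ^ (2 * s / Q) * z) * (k ^ 2 * R ^ Q)) := by rw [e3, e4, e5]
    _ ≤ 2 * CS * (k ^ 2 * K * R ^ Q * Z * (τ ^ q / θ) + C₂ * τ ^ q * 1 * (2 / θ) *
            Z * (k ^ 2 * R ^ Q)) := by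
        have : 0 ≤ k ^ 2 * K * R ^ Q * Z := by positivity
        have h1 := le_mul_of_one_le_right this hθi
        gcongr 2 * CS * (?_ + ?_)
        gcongr
    _ = _ := by ring

lemma ofReal_abs_rpow {p : ℝ} (hp : 0 ≤ p) (a : ℝ) :
    ENNReal.ofReal (|a| ^ p) = ENNReal.ofReal |a| ^ p :=
  (ENNReal.ofReal_rpow_of_nonneg (abs_nonneg a) hp).symm

namespace DeGiorgiData

variable {X : Type*} [MeasurableSpace X] {μ : Measure X} {d : X → X → ℝ}
  {Q c s t₀ L Ck CS K : ℝ} {u V : X → ℝ} {x₀ : X} {R T : ℝ}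

lemma one_lt_exponent (D : DeGiorgiData μ d Q c s t₀ L Ck CS K u V x₀ R T) : 1 < t₀ :=
  ((one_lt_div (by linarith [D.s_pos])).2 D.two_s_lt).trans D.lt_exponent

/-- The two bounds for the potential on a small set. -/
lemma setLIntegral_potential_le (D : DeGiorgiData μ d Q c s t₀ L Ck CS K u V x₀ R T) {A : Set X}
    (hA : A ⊆ {x | d x₀ x < R}) {m : ℝ} (hm0 : 0 < m) (hm : μ A ≤ ENNReal.ofReal m) {a : ℝ}
    (ha : 0 < a) (hat : a < t₀) :
    (∫⁻ x in A, ENNReal.ofReal |V x| ^ a ∂μ) ^ (1 / a) ≤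
      ENNReal.ofReal (K * R ^ (-(Q * (2 * s / Q - 1 / t₀))) * m ^ (1 / a - 1 / t₀)) := by
  have ht : 0 < t₀ := ha.trans hat
  have hR := D.R_pos
  have hK := D.K_pos
  have h1 := setLIntegral_rpow_le (D.measurable_V.abs.ennreal_ofReal.aemeasurable (μ := μ)) ha hat A
  have hexp : 0 ≤ 1 / a - 1 / t₀ := by
    rw [sub_nonneg]
    exact one_div_le_one_div_of_le ha hat.le
  calc _ ≤ ((∫⁻ x in A, ENNReal.ofReal |V x| ^ t₀ ∂μ) ^ (a / t₀) * μ A ^ (1 - a / t₀)) ^ (1 / a) := by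
        gcongr
    _ = (∫⁻ x in A, ENNReal.ofReal |V x| ^ t₀ ∂μ) ^ (1 / t₀) * μ A ^ (1 / a - 1 / t₀) := by
        rw [ENNReal.mul_rpow_of_nonneg _ _ (by positivity), ← ENNReal.rpow_mul,
          ← ENNReal.rpow_mul]
        congr 2
        · field_simp
        · field_simp
    _ ≤ ENNReal.ofReal (K * R ^ (-(Q * (2 * s / Q - 1 / t₀)))) *
        ENNReal.ofReal m ^ (1 / a - 1 / t₀) := by
        gcongr
        refine le_trans ?_ D.potential
        gcongr
    _ = _ := by
        rw [ENNReal.ofReal_rpow_of_pos hm0, ← ENNReal.ofReal_mul (by positivity)]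

set_option maxHeartbeats 800000 in
/-- One step of the De Giorgi iteration. -/
lemma step [SFinite μ] (D : DeGiorgiData μ d Q c s t₀ L Ck CS K u V x₀ R T) {r ρ k k' θ z : ℝ}
    (hr : R / 2 ≤ r) (hrρ : r < ρ) (hρ : ρ ≤ R) (hk : 0 < k) (hTk : T ≤ k) (hk' : 0 ≤ k')
    (hk'' : k' + θ * k ≤ k) (hθ0 : 0 < θ) (hθ1 : θ ≤ 1) (hz0 : 0 < z) (hz1 : z ≤ 1)
    (hzβ : 4 * CS * K * z ^ (2 * s / Q - 1 / t₀) ≤ 1)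
    (hY : ∫⁻ x in {x | d x₀ x < ρ}, ENNReal.ofReal (max (u x - k') 0 ^ 2) ∂μ ≤
      ENNReal.ofReal (z * θ ^ 2 * (k ^ 2 * R ^ Q))) :
    ∫⁻ x in {x | d x₀ x < r}, ENNReal.ofReal (max (u x - (k' + θ * k)) 0 ^ 2) ∂μ ≤
      ENNReal.ofReal (2 * CS * (K + 2 * (2 * (L * Ck + 1) * 2 ^ (Q + 2 * s))) *
        (R / (ρ - r)) ^ (Q + 2 * s) / θ * z ^ (1 + (2 * s / Q - 1 / t₀)) * (k ^ 2 * R ^ Q)) := by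
  have h := D.regular
  have hQ := h.dim_pos
  have hs0 := D.s_pos
  have hsQ := D.two_s_lt
  have hR := D.R_pos
  have hK := D.K_pos
  have hCS := D.CS_pos
  have hT0 := D.T_nonneg
  have hL := D.L_pos
  have hCk := D.Ck_pos
  have ht1 := D.one_lt_exponent
  have hQs : 0 < Q - 2 * s := by linarith
  have hu := D.measurable_u
  set β := 2 * s / Q - 1 / t₀ with hβ
  set p := 2 * Q / (Q - 2 * s) with hp
  have hp0 : 0 < p := by positivity
  set w : X → ℝ := fun x => max (u x - (k' + θ * k)) 0 with hw
  have hwm : Measurable w := (hu.sub_const _).max measurable_const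
  have hw0 : ∀ x, 0 ≤ w x := fun x => le_max_right _ _
  have hθk : 0 < θ * k := by positivity
  -- The cutoff already vanishes at the midpoint, which leaves the gap required by
  -- `lintegral_cutoff_le`.
  obtain ⟨η, hη, hcac⟩ := D.caccioppoli r ((r + ρ) / 2) (by linarith) (by linarith) (by linarith)
  set B := {x | d x₀ x < ρ} with hB
  have hBm : MeasurableSet B := h.measurableSet_ball x₀ ρ
  set A := B ∩ {x | k' + θ * k < u x} with hA
  have hAm : MeasurableSet A := hBm.inter (measurableSet_lt measurable_const hu)
  set v : X → ℝ := fun x => w x * η x with hv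
  have hvm : Measurable v := hwm.mul hη.measurable
  have hwu : ∀ x, w x ≤ u x := fun x => max_le (by linarith) (D.nonneg_u x)
  have hvu : ∀ x, |v x| ≤ |u x| := fun x => by
    rw [abs_of_nonneg (mul_nonneg (hw0 x) (hη.nonneg x)), abs_of_nonneg (D.nonneg_u x)]
    exact (mul_le_of_le_one_right (hw0 x) (hη.le_one x)).trans (hwu x)
  have hvA : ∀ x, x ∉ A → v x = 0 := by
    intro x hx
    by_cases hxB : x ∈ B
    · have : w x = 0 := max_eq_right (by
        by_contra hcon
        exact hx ⟨hxB, by simp only [Set.mem_ofPred_eq]; linarith⟩)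
      simp [hv, this]
    · have : ρ ≤ d x₀ x := not_lt.1 hxB
      simp [hv, hη.eq_zero x (by linarith)]
  set m := R ^ Q * z with hm
  have hm0 : 0 < m := by positivity
  have hwk : ∀ x, w x ≤ max (u x - k') 0 := fun x => max_le_max_right _ (by linarith)
  -- Chebyshev: on `A` the function `u - k'` exceeds `θ k`.
  have hμA : μ A ≤ ENNReal.ofReal m := by
    have h1 : ENNReal.ofReal ((θ * k) ^ 2) * μ A ≤ ENNReal.ofReal ((θ * k) ^ 2) * ENNReal.ofReal m := by
      calc _ = ∫⁻ x in A, ENNReal.ofReal ((θ * k) ^ 2) ∂μ := by rw [setLIntegral_const]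
        _ ≤ ∫⁻ x in A, ENNReal.ofReal (max (u x - k') 0 ^ 2) ∂μ := by
            refine setLIntegral_mono' hAm fun x hx => ENNReal.ofReal_le_ofReal ?_
            have : k' + θ * k < u x := hx.2
            gcongr
            exact le_max_of_le_left (by linarith)
        _ ≤ ∫⁻ x in B, ENNReal.ofReal (max (u x - k') 0 ^ 2) ∂μ :=
            lintegral_mono_set Set.inter_subset_left
        _ ≤ _ := hY
        _ = _ := by
            rw [← ENNReal.ofReal_mul (by positivity)]
            congr 1
            rw [hm]
            ring
    exact (ENNReal.mul_le_mul_iff_right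
      (ENNReal.ofReal_pos.2 (by positivity)).ne' ENNReal.ofReal_ne_top).1 h1
  have hAR : A ⊆ {x | d x₀ x < R} := fun x hx => lt_of_lt_of_le hx.1 hρ
  have hW2 : ∫⁻ x in B, ENNReal.ofReal (w x ^ 2) ∂μ ≤
      ENNReal.ofReal (z * θ ^ 2 * (k ^ 2 * R ^ Q)) :=
    le_trans (lintegral_mono fun x => ENNReal.ofReal_le_ofReal
      (pow_le_pow_left₀ (hw0 x) (hwk x) 2)) hY
  -- Where `w` is positive, `θ k ≤ u - k'`. Since `T ≤ k`, the term linear in `w` becomes quadratic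
  -- at the price of a factor `1/θ`.
  have hW1 : ENNReal.ofReal T * ∫⁻ x in B, ENNReal.ofReal (w x) ∂μ ≤
      ENNReal.ofReal (1 / θ * (z * θ ^ 2 * (k ^ 2 * R ^ Q))) := by
    rw [← lintegral_const_mul' _ _ ENNReal.ofReal_ne_top, ENNReal.ofReal_mul (by positivity)]
    refine le_trans ?_ (mul_le_mul_right hY _)
    rw [← lintegral_const_mul' _ _ ENNReal.ofReal_ne_top]
    refine lintegral_mono fun x => ?_
    rw [← ENNReal.ofReal_mul hT0, ← ENNReal.ofReal_mul (by positivity)]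
    apply ENNReal.ofReal_le_ofReal
    rcases (hw0 x).eq_or_lt with h0 | h0
    · rw [← h0, mul_zero]
      positivity
    · have h1 : k' + θ * k < u x := by
        by_contra hcon
        have : w x = 0 := max_eq_right (by linarith)
        linarith
      have h2 : θ * k ≤ max (u x - k') 0 := le_max_of_le_left (by linarith)
      calc T * w x ≤ k * max (u x - k') 0 := by
            have := hwk x
            gcongr
        _ = 1 / θ * (θ * k) * max (u x - k') 0 := by field_simp
        _ ≤ 1 / θ * max (u x - k') 0 * max (u x - k') 0 := by
            gcongr
        _ = _ := by ring
  set C₂ := 2 * (L * Ck + 1) * 2 ^ (Q + 2 * s) with hC₂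
  have hC₂0 : 0 < C₂ := by positivity
  set τ := R / (ρ - r) with hτ
  have hρr : 0 < ρ - r := by linarith
  have hτ0 : 0 < τ := by positivity
  have hτ1 : 1 ≤ τ := by
    rw [hτ, one_le_div hρr]
    linarith
  have hJ : ∫⁻ z : X × X, ENNReal.ofReal (w z.1 * w z.2 * (η z.1 - η z.2) ^ 2 /
        d z.1 z.2 ^ (Q + 2 * s)) ∂(μ.prod μ) ≤
      ENNReal.ofReal (C₂ * τ ^ (Q + 2 * s) * R ^ (-(2 * s)) *
        (2 / θ * (z * θ ^ 2 * (k ^ 2 * R ^ Q)))) := by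
    refine (h.lintegral_cutoff_le hs0 hL hCk D.kernel hu hwm hw0 hwu hR hr hrρ hρ hη hT0
      D.tail).trans ?_
    rw [ENNReal.ofReal_mul (p := C₂ * τ ^ (Q + 2 * s) * R ^ (-(2 * s))) (by positivity)]
    refine mul_le_mul_right ((add_le_add hW2 hW1).trans ?_) _
    rw [← ENNReal.ofReal_add (by positivity) (by positivity)]
    apply ENNReal.ofReal_le_ofReal
    have h1 : 1 ≤ 1 / θ := by
      rw [one_le_div hθ0]
      exact hθ1
    have h2 : 0 < z * θ ^ 2 * (k ^ 2 * R ^ Q) := by positivity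
    rw [show 2 / θ = 1 / θ + 1 / θ by ring]
    nlinarith
  set S' := (∫⁻ x, ENNReal.ofReal (|v x| ^ p) ∂μ) ^ ((Q - 2 * s) / Q) with hS'
  have hvfin : ∫⁻ x, ENNReal.ofReal (|v x| ^ p) ∂μ ≠ ⊤ := by
    refine ne_top_of_le_ne_top D.lintegral_u_ne_top (lintegral_mono fun x => ?_)
    exact ENNReal.ofReal_le_ofReal (Real.rpow_le_rpow (abs_nonneg _) (hvu x) hp0.le)
  have hS'fin : S' ≠ ⊤ := ENNReal.rpow_ne_top_of_nonneg (by positivity) hvfin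
  have hfv : Measurable fun x => ENNReal.ofReal |v x| := hvm.abs.ennreal_ofReal
  have hfV : Measurable fun x => ENNReal.ofReal |V x| := D.measurable_V.abs.ennreal_ofReal
  have hS'A : (∫⁻ x in A, ENNReal.ofReal |v x| ^ p ∂μ) ^ ((Q - 2 * s) / Q) ≤ S' := by
    rw [hS']
    refine ENNReal.rpow_le_rpow ?_ (by positivity)
    simp_rw [ofReal_abs_rpow hp0.le]
    exact setLIntegral_le_lintegral _ _
  -- The norm of `V` in `L^{Q/(2s)}` over `A` is at most `K z^β`: the powers of `R` cancel exactly,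
  -- and the remaining factor is small.
  have hVv : ∫⁻ x in A, ENNReal.ofReal |V x| * ENNReal.ofReal |v x| ^ (2 : ℝ) ∂μ ≤
      ENNReal.ofReal (K * z ^ β) * S' := by
    refine (lintegral_mul_sq_le hfV.aemeasurable hfv.aemeasurable hs0 hsQ).trans ?_
    gcongr
    have h1 := D.setLIntegral_potential_le hAR hm0 hμA (a := Q / (2 * s)) (by positivity)
      D.lt_exponent
    rw [one_div_div] at h1
    refine h1.trans (ENNReal.ofReal_le_ofReal (le_of_eq ?_))
    rw [hm, Real.mul_rpow (by positivity) hz0.le, ← Real.rpow_mul hR.le, mul_assoc,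
      ← mul_assoc (R ^ _), ← Real.rpow_add hR, neg_add_cancel,
      Real.rpow_zero, one_mul]
  have hVA : ∫⁻ x in A, ENNReal.ofReal |V x| ∂μ ≤
      ENNReal.ofReal (K * R ^ (-(Q * β)) * m ^ (1 - 1 / t₀)) := by
    have h1 := D.setLIntegral_potential_le hAR hm0 hμA (a := 1) one_pos ht1
    simpa [hβ] using h1
  have hVterm : ∫⁻ x, ENNReal.ofReal (|V x| * (u x * max (u x - (k' + θ * k)) 0 * η x ^ 2)) ∂μ ≤
      2 * (ENNReal.ofReal (K * z ^ β) * S') +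
      ENNReal.ofReal (k ^ 2) * ENNReal.ofReal (K * R ^ (-(Q * β)) * m ^ (1 - 1 / t₀)) := by
    calc _ ≤ ∫⁻ x in A, (2 * (ENNReal.ofReal |V x| * ENNReal.ofReal |v x| ^ (2 : ℝ)) +
          ENNReal.ofReal (k ^ 2) * ENNReal.ofReal |V x|) ∂μ := by
          rw [← lintegral_indicator hAm]
          refine lintegral_mono fun x => ?_
          by_cases hx : x ∈ A
          · rw [Set.indicator_of_mem hx, ← ofReal_abs_rpow (by norm_num), ← ENNReal.ofReal_ofNat 2,
              ← ENNReal.ofReal_mul (abs_nonneg _), ← ENNReal.ofReal_mul (by norm_num),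
              ← ENNReal.ofReal_mul (by positivity), ← ENNReal.ofReal_add (by positivity)
              (by positivity)]
            apply ENNReal.ofReal_le_ofReal
            rw [Real.rpow_two, sq_abs]
            have hux : u x = w x + (k' + θ * k) := by
              have : k' + θ * k < u x := hx.2
              have h2 : w x = u x - (k' + θ * k) := max_eq_left (by linarith)
              linarith
            have hη2 : η x ^ 2 ≤ 1 := pow_le_one₀ (hη.nonneg x) (hη.le_one x)
            -- On `A` the function `u` is `w` plus a level not exceeding `k`, so `u w ≤ w² + k w`.
            have h3 : u x * w x * η x ^ 2 ≤ 2 * v x ^ 2 + k ^ 2 := by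
              have hwx := hw0 x
              have h4 : (k' + θ * k) * w x ≤ k * w x := by gcongr
              have h5 : u x * w x ≤ 2 * w x ^ 2 + k ^ 2 := by
                rw [hux]
                nlinarith [sq_nonneg (k - w x), sq_nonneg k, sq_nonneg (w x)]
              calc u x * w x * η x ^ 2 ≤ (2 * w x ^ 2 + k ^ 2) * η x ^ 2 := by gcongr
                _ = 2 * v x ^ 2 + k ^ 2 * η x ^ 2 := by
                  simp only [hv]
                  ring
                _ ≤ 2 * v x ^ 2 + k ^ 2 * 1 := by gcongr
                _ = _ := by ring
            calc |V x| * (u x * w x * η x ^ 2) ≤ |V x| * (2 * v x ^ 2 + k ^ 2) := by gcongr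
              _ = _ := by ring
          · have h0 : w x * η x = 0 := hvA x hx
            rw [Set.indicator_of_notMem hx, show u x * w x * η x ^ 2 = u x * (w x * η x) * η x by ring,
              h0]
            simp
      _ = 2 * (∫⁻ x in A, ENNReal.ofReal |V x| * ENNReal.ofReal |v x| ^ (2 : ℝ) ∂μ) +
          ENNReal.ofReal (k ^ 2) * ∫⁻ x in A, ENNReal.ofReal |V x| ∂μ := by
          rw [lintegral_add_right _ (hfV.const_mul _), lintegral_const_mul' _ _ (by simp),
            lintegral_const_mul' _ _ ENNReal.ofReal_ne_top]
      _ ≤ _ := by gcongr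
  set N₁ := k ^ 2 * (K * R ^ (-(Q * β)) * m ^ (1 - 1 / t₀)) with hN₁
  set N₂ := C₂ * τ ^ (Q + 2 * s) * R ^ (-(2 * s)) * (2 / θ * (z * θ ^ 2 * (k ^ 2 * R ^ Q))) with hN₂
  have hN₁0 : 0 ≤ N₁ := by positivity
  have hN₂0 : 0 ≤ N₂ := by positivity
  -- By `hzβ` the share of `S'` on the right is at most one half. It can be absorbed because `S'` is
  -- finite.
  have hSob : S' ≤ ENNReal.ofReal (2 * (CS * (N₁ + N₂))) := by
    have h1 : S' ≤ ENNReal.ofReal CS * (2 * (ENNReal.ofReal (K * z ^ β) * S') +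
        ENNReal.ofReal (N₁ + N₂)) := by
      refine (D.sobolev v hvm hvfin).trans (mul_le_mul_right ?_ _)
      refine (hcac (k' + θ * k) (by positivity)).trans ?_
      rw [ENNReal.ofReal_add hN₁0 hN₂0, ← add_assoc, hN₁, ENNReal.ofReal_mul (p := k ^ 2)
        (by positivity)]
      exact add_le_add hVterm hJ
    have hS'r : S' = ENNReal.ofReal S'.toReal := (ENNReal.ofReal_toReal hS'fin).symm
    have hS'0 : 0 ≤ S'.toReal := ENNReal.toReal_nonneg
    rw [hS'r] at h1 ⊢
    rw [← ENNReal.ofReal_ofNat 2, ← ENNReal.ofReal_mul (by positivity),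
      ← ENNReal.ofReal_mul (by positivity), ← ENNReal.ofReal_add (by positivity) (by positivity),
      ← ENNReal.ofReal_mul (by positivity),
      ENNReal.ofReal_le_ofReal_iff (by positivity)] at h1
    apply ENNReal.ofReal_le_ofReal
    nlinarith
  calc _ ≤ ∫⁻ x in A, ENNReal.ofReal |v x| ^ (2 : ℝ) ∂μ := by
        rw [← lintegral_indicator hAm, ← lintegral_indicator (h.measurableSet_ball x₀ r)]
        refine lintegral_mono fun x => ?_
        by_cases hx : x ∈ {x | d x₀ x < r}
        · rw [Set.indicator_of_mem hx]
          have hηx : η x = 1 := hη.eq_one x hx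
          have hvx : v x = w x := by simp [hv, hηx]
          by_cases hxA : x ∈ A
          · rw [Set.indicator_of_mem hxA, ← ofReal_abs_rpow (by norm_num), Real.rpow_two, sq_abs,
              hvx]
          · have hwx : w x = 0 := by rw [← hvx, hvA x hxA]
            change ENNReal.ofReal (w x ^ 2) ≤ _
            rw [hwx]
            simp
        · rw [Set.indicator_of_notMem hx]
          exact zero_le
    _ ≤ (∫⁻ x in A, ENNReal.ofReal |v x| ^ p ∂μ) ^ (2 / p) * μ A ^ (1 - 2 / p) := by
        refine setLIntegral_rpow_le hfv.aemeasurable two_pos ?_ A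
        rw [hp, lt_div_iff₀ hQs]
        linarith
    _ ≤ S' * ENNReal.ofReal m ^ (2 * s / Q) := by
        have e1 : 2 / p = (Q - 2 * s) / Q := by
          rw [hp]
          field_simp
        have e2 : 1 - (Q - 2 * s) / Q = 2 * s / Q := by
          field_simp
          ring
        rw [e1, e2]
        gcongr
    _ ≤ ENNReal.ofReal (2 * (CS * (N₁ + N₂))) * ENNReal.ofReal (m ^ (2 * s / Q)) := by
        rw [ENNReal.ofReal_rpow_of_pos hm0]
        gcongr
    _ ≤ _ := by
        rw [mul_comm, ← ENNReal.ofReal_mul (by positivity)]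
        exact ENNReal.ofReal_le_ofReal (deGiorgi_numeric hQ hs0 ht1.le hK hCS hC₂0 hR hz0 hz1 hk
          hθ0 hθ1 hτ1 (by positivity))

end DeGiorgiData
end

/-! ### The iteration, and the passage from the `L²` mean to the `L¹` mean. -/

noncomputable section

/-- A recursion whose constant grows geometrically but whose power `1 + β` is superlinear preserves
geometric decay if the start is small. The step constant grows like `B^i`, and `λ = B^(1/β)` makes
the extra power `β` of `λ^(-i)` cancel it. In the same way `τ^(-q/β)` cancels `τ^q`. The factor
`4^(i + 1)` is `θ^(-2)` for the increment `θ = 2^(-(i+1))` of the levels. -/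
lemma exists_iteration_constants {β q C₁ C₂ : ℝ} (hβ0 : 0 < β) (hβ1 : β < 1) (hq : 0 < q)
    (hC₁ : 0 < C₁) (hC₂ : 0 < C₂) :
    ∃ ε₁ lam : ℝ, 0 < ε₁ ∧ 1 < lam ∧ ∀ τ : ℝ, 1 ≤ τ → ∀ i : ℕ,
      ε₁ * τ ^ (-(q / β)) * lam⁻¹ ^ i * 4 ^ (i + 1) ≤ 1 ∧
      C₂ * (ε₁ * τ ^ (-(q / β)) * lam⁻¹ ^ i * 4 ^ (i + 1)) ^ β ≤ 1 ∧
      C₁ * (τ * 2 ^ (i + 1)) ^ q / (1 / 2) ^ (i + 1) *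
        (ε₁ * τ ^ (-(q / β)) * lam⁻¹ ^ i * 4 ^ (i + 1)) ^ (1 + β) ≤
        ε₁ * τ ^ (-(q / β)) * lam⁻¹ ^ (i + 1) := by
  set B : ℝ := 2 ^ (q + 1 + 2 * (1 + β)) with hB
  have hB4 : 4 ≤ B := by
    calc (4 : ℝ) = 2 ^ (2 : ℝ) := by norm_num
      _ ≤ B := Real.rpow_le_rpow_of_exponent_le one_le_two (by linarith)
  have hB0 : 0 < B := by linarith
  set lam : ℝ := B ^ (1 / β) with hlam
  have hlam0 : 0 < lam := by positivity
  have hlamβ : lam ^ β = B := by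
    rw [hlam, ← Real.rpow_mul hB0.le, one_div_mul_cancel hβ0.ne', Real.rpow_one]
  have hlam4 : 4 ≤ lam := by
    refine hB4.trans ?_
    calc B = B ^ (1 : ℝ) := (Real.rpow_one B).symm
      _ ≤ lam := Real.rpow_le_rpow_of_exponent_le (by linarith)
        (by rw [le_div_iff₀ hβ0]; linarith)
  -- Each summand serves one conclusion: `4` for the first, `4 * C₂` for the second, `C₁ * B * lam`
  -- for the recursion.
  set M : ℝ := C₁ * B * lam + 4 * C₂ + 4 with hM
  have hM0 : 0 < M := by positivity
  have hM4 : 4 ≤ M := by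
    have : 0 < C₁ * B * lam + 4 * C₂ := by positivity
    linarith
  set ε₁ : ℝ := (M⁻¹) ^ (1 / β) with hε₁
  have hε₁0 : 0 < ε₁ := by positivity
  have hε₁β : ε₁ ^ β = M⁻¹ := by
    rw [hε₁, ← Real.rpow_mul (by positivity), one_div_mul_cancel hβ0.ne', Real.rpow_one]
  have hε₁4 : 4 * ε₁ ≤ 1 := by
    have h1 : ε₁ ≤ M⁻¹ := by
      calc ε₁ ≤ (M⁻¹) ^ (1 : ℝ) := Real.rpow_le_rpow_of_exponent_ge (by positivity)
            (inv_le_one_of_one_le₀ (by linarith)) (by rw [le_div_iff₀ hβ0]; linarith)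
        _ = M⁻¹ := Real.rpow_one _
    have h2 : M⁻¹ ≤ 4⁻¹ := inv_anti₀ (by norm_num) hM4
    linarith
  refine ⟨ε₁, lam, hε₁0, by linarith, fun τ hτ i => ?_⟩
  have hτ0 : 0 < τ := by linarith
  set ε := ε₁ * τ ^ (-(q / β)) with hε
  have hε0 : 0 < ε := by positivity
  have hεle : ε ≤ ε₁ := mul_le_of_le_one_right hε₁0.le
    (Real.rpow_le_one_of_one_le_of_nonpos hτ (by have : 0 < q / β := by positivity
                                                 linarith))
  have hεβ : ε ^ β = M⁻¹ * τ ^ (-q) := by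
    rw [hε, Real.mul_rpow hε₁0.le (by positivity), hε₁β, ← Real.rpow_mul hτ0.le]
    congr 2
    field_simp
  set z := ε * lam⁻¹ ^ i * 4 ^ (i + 1) with hz
  have hz0 : 0 < z := by positivity
  have hz4 : z ≤ 4 * ε₁ := by
    have h1 : (lam⁻¹ * 4) ^ i ≤ 1 := by
      refine pow_le_one₀ (by positivity) ?_
      rw [inv_mul_le_iff₀ hlam0]
      linarith
    calc z = 4 * ε * (lam⁻¹ * 4) ^ i := by
          rw [hz, mul_pow]
          ring
      _ ≤ 4 * ε * 1 := by gcongr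
      _ ≤ _ := by linarith
  refine ⟨hz4.trans hε₁4, ?_, ?_⟩
  · have h1 : z ^ β ≤ 4 * M⁻¹ := by
      calc z ^ β ≤ (4 * ε₁) ^ β := by gcongr
        _ = 4 ^ β * M⁻¹ := by rw [Real.mul_rpow (by norm_num) hε₁0.le, hε₁β]
        _ ≤ 4 * M⁻¹ := by
          gcongr
          calc (4 : ℝ) ^ β ≤ 4 ^ (1 : ℝ) :=
                Real.rpow_le_rpow_of_exponent_le (by norm_num) hβ1.le
            _ = 4 := Real.rpow_one 4
    calc C₂ * z ^ β ≤ C₂ * (4 * M⁻¹) := by gcongr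
      _ = 4 * C₂ / M := by ring
      _ ≤ 1 := by
        rw [div_le_one hM0]
        have : 0 < C₁ * B * lam := by positivity
        linarith
  · set x : ℝ := 2 ^ (i + 1) with hx
    have hx0 : 0 < x := by positivity
    have hxi : (1 / 2 : ℝ) ^ (i + 1) = x⁻¹ := by rw [hx, one_div, inv_pow]
    have h4x : (4 : ℝ) ^ (i + 1) = x ^ (2 : ℝ) := by
      rw [Real.rpow_two, hx, ← pow_mul, mul_comm, pow_mul]
      norm_num
    have hxB : x ^ q * x * x ^ (2 * (1 + β)) = B ^ (i + 1) := by
      have h1 : x ^ q * x * x ^ (2 * (1 + β)) = x ^ (q + 1 + 2 * (1 + β)) := by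
        rw [Real.rpow_add hx0, Real.rpow_add hx0, Real.rpow_one]
      rw [h1, hB, hx, ← Real.rpow_natCast, ← Real.rpow_natCast, ← Real.rpow_mul (by norm_num),
        ← Real.rpow_mul (by norm_num), mul_comm]
    have hzz : z ^ (1 + β) = ε * (M⁻¹ * τ ^ (-q)) * (lam⁻¹ ^ i * (B⁻¹) ^ i) * x ^ (2 * (1 + β)) := by
      have h1 : (lam⁻¹ ^ i) ^ (1 + β) = lam⁻¹ ^ i * (B⁻¹) ^ i := by
        rw [Real.rpow_add (by positivity), Real.rpow_one]
        congr 1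
        rw [← Real.rpow_natCast, ← Real.rpow_mul (by positivity), mul_comm, Real.rpow_mul
          (by positivity), Real.inv_rpow hlam0.le, hlamβ, Real.rpow_natCast]
      rw [hz, h4x, Real.mul_rpow (by positivity) (by positivity),
        Real.mul_rpow hε0.le (by positivity), h1, ← Real.rpow_mul hx0.le,
        Real.rpow_add hε0, Real.rpow_one, hεβ]
    have hττ : τ ^ q * τ ^ (-q) = 1 := by
      rw [← Real.rpow_add hτ0, add_neg_cancel, Real.rpow_zero]
    have hBB : B ^ i * (B⁻¹) ^ i = 1 := by
      rw [← mul_pow, mul_inv_cancel₀ hB0.ne', one_pow]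
    calc C₁ * (τ * x) ^ q / (1 / 2) ^ (i + 1) * z ^ (1 + β)
        = C₁ * (τ ^ q * τ ^ (-q)) * (x ^ q * x * x ^ (2 * (1 + β))) * M⁻¹ * ε *
          (lam⁻¹ ^ i * (B⁻¹) ^ i) := by
          rw [hxi, hzz, Real.mul_rpow hτ0.le hx0.le, div_inv_eq_mul]
          ring
      _ = C₁ * B * M⁻¹ * ε * lam⁻¹ ^ i * (B ^ i * (B⁻¹) ^ i) := by
          rw [hττ, hxB]
          ring
      _ = (C₁ * B * lam / M) * (ε * lam⁻¹ ^ (i + 1)) := by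
          rw [hBB, pow_succ]
          field_simp
      _ ≤ 1 * (ε * lam⁻¹ ^ (i + 1)) := by
          gcongr
          rw [div_le_one hM0]
          linarith
      _ = _ := one_mul _

section

variable {X : Type*} [MeasurableSpace X] {μ : Measure X} {d : X → X → ℝ}
  {Q c s t₀ L Ck CS K : ℝ}

/-- The local boundedness estimate in terms of the `L²` norm. -/
lemma exists_le_of_sq_lintegral_le [SFinite μ] (hs0 : 0 < s) (hsQ : 2 * s < Q)
    (ht₀ : Q / (2 * s) < t₀) (hL : 0 < L) (hCk : 0 < Ck) (hCS : 0 < CS) (hK : 0 < K) :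
    ∃ ε₁ γ : ℝ, 0 < ε₁ ∧ 0 < γ ∧ ∀ (u V : X → ℝ) (x₀ : X) (R T : ℝ),
      DeGiorgiData μ d Q c s t₀ L Ck CS K u V x₀ R T →
      ∀ r ρ k : ℝ, R / 2 ≤ r → r < ρ → ρ ≤ R → 0 < k → T ≤ k →
      ∫⁻ x in {x | d x₀ x < ρ}, ENNReal.ofReal (u x ^ 2) ∂μ ≤
        ENNReal.ofReal (ε₁ * (R / (ρ - r)) ^ (-γ) * (k ^ 2 * R ^ Q)) →
      ∀ᵐ x ∂μ, d x₀ x < r → u x ≤ k := by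
  have hQ : 0 < Q := by linarith
  have ht1 : 1 < t₀ := ((one_lt_div (by linarith)).2 hsQ).trans ht₀
  have hβ0 : 0 < 2 * s / Q - 1 / t₀ := by
    rw [div_lt_iff₀ (by positivity)] at ht₀
    rw [sub_pos, div_lt_div_iff₀ (by linarith) hQ]
    linarith
  have hβ1 : 2 * s / Q - 1 / t₀ < 1 := by
    have h1 : 2 * s / Q < 1 := (div_lt_one hQ).2 hsQ
    have h2 : 0 < 1 / t₀ := by positivity
    linarith
  obtain ⟨ε₁, lam, hε₁, hlam, hiter⟩ := exists_iteration_constants (q := Q + 2 * s) hβ0 hβ1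
    (by positivity)
    (by positivity : 0 < 2 * CS * (K + 2 * (2 * (L * Ck + 1) * 2 ^ (Q + 2 * s))))
    (by positivity : 0 < 4 * CS * K)
  refine ⟨ε₁, (Q + 2 * s) / (2 * s / Q - 1 / t₀), hε₁, by positivity, ?_⟩
  intro u V x₀ R T D r ρ k hr hrρ hρ hk hTk hY
  set γ := (Q + 2 * s) / (2 * s / Q - 1 / t₀)
  have hR := D.R_pos
  have hlam0 : 0 < lam := by linarith
  have hρr : 0 < ρ - r := by linarith
  set τ := R / (ρ - r) with hτ
  have hτ1 : 1 ≤ τ := by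
    rw [hτ, one_le_div hρr]
    linarith
  set ε := ε₁ * τ ^ (-γ) with hε
  have hε0 : 0 < ε := by positivity
  -- The radii shrink from `ρ` to `r` while the levels rise from `0` to `k`.
  have key : ∀ i : ℕ, ∫⁻ x in {x | d x₀ x < r + (ρ - r) * (1 / 2) ^ i},
      ENNReal.ofReal (max (u x - k * (1 - (1 / 2) ^ i)) 0 ^ 2) ∂μ ≤
        ENNReal.ofReal (ε * lam⁻¹ ^ i * (k ^ 2 * R ^ Q)) := by
    intro i
    induction i with
    | zero =>
      simp only [pow_zero, mul_one, sub_self, mul_zero, sub_zero, add_sub_cancel]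
      refine le_trans (le_of_eq ?_) hY
      refine lintegral_congr fun x => ?_
      rw [max_eq_left (D.nonneg_u x)]
    | succ i ih =>
      obtain ⟨hz1, hz2, hz3⟩ := hiter τ hτ1 i
      have hpow : (1 / 2 : ℝ) ^ i = 2 * (1 / 2) ^ (i + 1) := by
        rw [pow_succ]
        ring
      have hpi : (0 : ℝ) < (1 / 2) ^ (i + 1) := by positivity
      have hpi1 : (1 / 2 : ℝ) ^ i ≤ 1 := pow_le_one₀ (by norm_num) (by norm_num)
      have hpi2 : (1 / 2 : ℝ) ^ (i + 1) ≤ 1 := pow_le_one₀ (by norm_num) (by norm_num)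
      have h4 : (4 : ℝ) ^ (i + 1) * ((1 / 2) ^ (i + 1)) ^ 2 = 1 := by
        rw [← pow_mul, mul_comm (i + 1) 2, pow_mul, ← mul_pow]
        norm_num
      have hstep := D.step (r := r + (ρ - r) * (1 / 2) ^ (i + 1)) (ρ := r + (ρ - r) * (1 / 2) ^ i)
        (k := k) (k' := k * (1 - (1 / 2) ^ i)) (θ := (1 / 2) ^ (i + 1))
        (z := ε * lam⁻¹ ^ i * 4 ^ (i + 1))
        (by nlinarith) (by rw [hpow]; nlinarith) (by nlinarith) hk hTk
        (mul_nonneg hk.le (by linarith))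
        (by rw [hpow]; nlinarith) hpi hpi2 (by positivity) hz1 hz2
        (by
          refine ih.trans (ENNReal.ofReal_le_ofReal (le_of_eq ?_))
          rw [mul_assoc (ε * lam⁻¹ ^ i) (4 ^ (i + 1)), h4, mul_one])
      have e1 : k * (1 - (1 / 2) ^ i) + (1 / 2) ^ (i + 1) * k = k * (1 - (1 / 2) ^ (i + 1)) := by
        rw [hpow]
        ring
      have e2 : R / (r + (ρ - r) * (1 / 2) ^ i - (r + (ρ - r) * (1 / 2) ^ (i + 1))) =
          τ * 2 ^ (i + 1) := by
        rw [hpow, show r + (ρ - r) * (2 * (1 / 2) ^ (i + 1)) - (r + (ρ - r) * (1 / 2) ^ (i + 1)) =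
          (ρ - r) * (1 / 2) ^ (i + 1) by ring, hτ, one_div, inv_pow]
        field_simp
      rw [e1, e2] at hstep
      refine hstep.trans (ENNReal.ofReal_le_ofReal ?_)
      exact mul_le_mul_of_nonneg_right hz3 (by positivity)
  have hsm : Measurable fun x => max (u x - k) 0 ^ 2 :=
    ((D.measurable_u.sub_const k).max measurable_const).pow_const 2
  have hlim : ∫⁻ x in {x | d x₀ x < r}, ENNReal.ofReal (max (u x - k) 0 ^ 2) ∂μ ≤ 0 := by
    have htend : Tendsto (fun i : ℕ => ENNReal.ofReal (ε * lam⁻¹ ^ i * (k ^ 2 * R ^ Q))) atTop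
        (𝓝 0) := by
      rw [← ENNReal.ofReal_zero]
      apply ENNReal.tendsto_ofReal
      have h1 := (tendsto_pow_atTop_nhds_zero_of_lt_one (by positivity)
        (inv_lt_one_of_one_lt₀ hlam)).const_mul ε
      simpa using h1.mul_const (k ^ 2 * R ^ Q)
    refine ge_of_tendsto' htend fun i => le_trans ?_ (key i)
    have hpi : (0 : ℝ) < (1 / 2) ^ i := by positivity
    refine (lintegral_mono fun x => ?_).trans (lintegral_mono_set fun x hx => ?_)
    · apply ENNReal.ofReal_le_ofReal
      gcongr
      nlinarith
    · have hxr : d x₀ x < r := hx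
      have : 0 < (ρ - r) * (1 / 2) ^ i := by positivity
      exact lt_of_lt_of_le hxr (by linarith)
  have hzero := (lintegral_eq_zero_iff hsm.ennreal_ofReal).1 (le_antisymm hlim zero_le)
  rw [EventuallyEq, ae_restrict_iff' (D.regular.measurableSet_ball x₀ r)] at hzero
  filter_upwards [hzero] with x hx hxr
  have h1 := ENNReal.ofReal_eq_zero.1 (hx hxr)
  by_contra hcon
  have : 0 < max (u x - k) 0 := lt_max_of_lt_left (by linarith)
  have := pow_pos this 2
  linarith

/-- Hölder on the ball, as the Sobolev exponent exceeds two. Only finiteness matters: it provides a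
first bound for `u`, from which the absorption argument starts. -/
lemma DeGiorgiData.sq_lintegral_ne_top {u V : X → ℝ} {x₀ : X} {R T : ℝ}
    (D : DeGiorgiData μ d Q c s t₀ L Ck CS K u V x₀ R T) :
    ∫⁻ x in {x | d x₀ x < R}, ENNReal.ofReal (u x ^ 2) ∂μ ≠ ⊤ := by
  have hsQ := D.two_s_lt
  have hs := D.s_pos
  have hQ := D.regular.dim_pos
  have hQs : 0 < Q - 2 * s := by linarith
  have hp : 2 < 2 * Q / (Q - 2 * s) := by
    rw [lt_div_iff₀ hQs]
    linarith
  have h1 := setLIntegral_rpow_le (D.measurable_u.abs.ennreal_ofReal.aemeasurable (μ := μ))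
    two_pos hp {x | d x₀ x < R}
  simp_rw [← ofReal_abs_rpow zero_le_two, ← ofReal_abs_rpow (zero_le_two.trans hp.le),
    Real.rpow_two, sq_abs] at h1
  refine ne_top_of_le_ne_top (ENNReal.mul_ne_top ?_ ?_) h1
  · refine ENNReal.rpow_ne_top_of_nonneg (by positivity) ?_
    exact ne_top_of_le_ne_top D.lintegral_u_ne_top (setLIntegral_le_lintegral _ _)
  · refine ENNReal.rpow_ne_top_of_nonneg ?_ ?_
    · rw [sub_nonneg, div_le_one (by linarith)]
      exact hp.le
    · rw [D.regular.measure_ball x₀ R D.R_pos]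
      exact ENNReal.ofReal_ne_top

set_option maxHeartbeats 800000 in
/-- The local boundedness estimate in terms of the mean value and the tail. -/
theorem exists_le_of_lintegral_le [SFinite μ] (hs0 : 0 < s) (hsQ : 2 * s < Q)
    (ht₀ : Q / (2 * s) < t₀) (hL : 0 < L) (hCk : 0 < Ck) (hCS : 0 < CS) (hK : 0 < K) :
    ∃ C : ℝ, 0 < C ∧ ∀ (u V : X → ℝ) (x₀ : X) (R T : ℝ),
      DeGiorgiData μ d Q c s t₀ L Ck CS K u V x₀ R T → ∀ a : ℝ, 0 ≤ a →
      ∫⁻ x in {x | d x₀ x < R}, ENNReal.ofReal (u x) ∂μ ≤ ENNReal.ofReal (a * R ^ Q) →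
      ∀ᵐ x ∂μ, d x₀ x < R / 2 → u x ≤ C * a + 2 * T := by
  obtain ⟨ε₁, γ, hε₁, hγ, hbd⟩ := exists_le_of_sq_lintegral_le (X := X) (μ := μ) (d := d) (c := c)
    hs0 hsQ ht₀ hL hCk hCS hK
  -- `D₀` is the factor lost when the gap between two radii is halved. The choice `δ D₀ = 1/2` lets
  -- the absorption outrun this growth.
  set D₀ : ℝ := 2 ^ γ with hD₀
  have hD1 : 1 < D₀ := Real.one_lt_rpow one_lt_two hγ
  have hD0 : 0 < D₀ := by linarith
  set δ : ℝ := 1 / (2 * D₀) with hδ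
  have hδ0 : 0 < δ := by positivity
  have hδD : δ * D₀ = 1 / 2 := by
    rw [hδ]
    field_simp
  have hδ2 : δ ≤ 1 / 2 := by nlinarith
  set ε₂ := ε₁ * 8 ^ (-γ) with hε₂
  have hε₂0 : 0 < ε₂ := by positivity
  refine ⟨2 * (1 / (4 * δ * ε₂)), by positivity, ?_⟩
  intro u V x₀ R T D a ha haR
  have hR := D.R_pos
  have hT0 := D.T_nonneg
  have hRQ : 0 < R ^ Q := by positivity
  set a' := a / (4 * δ * ε₂) with ha'
  have ha'0 : 0 ≤ a' := by positivity
  -- A qualitative bound: `M₀` enters below only with the factor `δ ^ n` and disappears in the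
  -- limit.
  obtain ⟨M₀, hM₀0, hM₀⟩ : ∃ M₀ : ℝ, 0 < M₀ ∧ ∀ᵐ x ∂μ, d x₀ x < 3 * R / 4 → u x ≤ M₀ := by
    set I := ∫⁻ x in {x | d x₀ x < R}, ENNReal.ofReal (u x ^ 2) ∂μ with hI
    have hIfin : I ≠ ⊤ := D.sq_lintegral_ne_top
    set e := ε₁ * (R / (R - 3 * R / 4)) ^ (-γ) with he
    have he0 : 0 < e := by
      have : 0 < R - 3 * R / 4 := by linarith
      positivity
    have hIr0 : 0 ≤ I.toReal / (e * R ^ Q) := by positivity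
    set k := T + 1 + Real.sqrt (I.toReal / (e * R ^ Q)) with hk
    have hk0 : 0 < k := by positivity
    refine ⟨k, hk0, hbd u V x₀ R T D (3 * R / 4) R k (by linarith) (by linarith) le_rfl hk0
      (by have := Real.sqrt_nonneg (I.toReal / (e * R ^ Q)); linarith) ?_⟩
    rw [← hI, ← ENNReal.ofReal_toReal hIfin]
    apply ENNReal.ofReal_le_ofReal
    have h1 : I.toReal / (e * R ^ Q) ≤ k ^ 2 := by
      calc I.toReal / (e * R ^ Q) = Real.sqrt (I.toReal / (e * R ^ Q)) ^ 2 :=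
            (Real.sq_sqrt hIr0).symm
        _ ≤ k ^ 2 := by
            gcongr
            linarith
    rw [div_le_iff₀ (by positivity)] at h1
    linarith
  -- The radii grow with `i` from `R/2` to `3R/4`. The bound number `n + 1` on ball `i` comes from
  -- bound number `n` on ball `i + 1`, so the induction on `n` must run over all `i` at once. The
  -- constant `2 * T` reproduces itself because `T + 2δT ≤ 2T`.
  have key : ∀ n i : ℕ, ∀ᵐ x ∂μ, d x₀ x < 3 * R / 4 - R / 4 * (1 / 2) ^ i →
      u x ≤ δ ^ n * M₀ + 2 * T + 2 * a' * D₀ ^ i := by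
    intro n
    induction n with
    | zero =>
      intro i
      filter_upwards [hM₀] with x hx hxi
      have h1 : u x ≤ M₀ := hx (hxi.trans_le (by
        have : 0 ≤ R / 4 * (1 / 2) ^ i := by positivity
        linarith))
      have h2 : 0 ≤ 2 * a' * D₀ ^ i := by positivity
      rw [pow_zero, one_mul]
      linarith
    | succ n ih =>
      intro i
      set M := δ ^ n * M₀ + 2 * T + 2 * a' * D₀ ^ (i + 1) with hM
      have hM0 : 0 < M := by positivity
      set k := T + δ * M + a' * D₀ ^ i with hk
      have hk0 : 0 < k := by positivity
      have hpow : (1 / 2 : ℝ) ^ i = 2 * (1 / 2) ^ (i + 1) := by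
        rw [pow_succ]
        ring
      have hpi : (0 : ℝ) < (1 / 2) ^ (i + 1) := by positivity
      have hpi1 : (1 / 2 : ℝ) ^ i ≤ 1 := pow_le_one₀ (by norm_num) (by norm_num)
      -- On the larger ball `∫ u² ≤ M ∫ u ≤ M a R^Q`. The inequality `4xy ≤ (x + y)²` with `x = δM`,
      -- `y = a' D₀^i` makes `k` large enough, and `a'` is defined so that `4 δ ε₂ a' = a`.
      have hbig : a * M ≤ ε₂ * (D₀ ^ i)⁻¹ * k ^ 2 := by
        have h1 : 4 * (δ * M) * (a' * D₀ ^ i) ≤ k ^ 2 := by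
          have h2 : 0 ≤ δ * M := by positivity
          have h3 : 0 ≤ a' * D₀ ^ i := by positivity
          have h4 : (δ * M + a' * D₀ ^ i) ^ 2 ≤ k ^ 2 := by
            gcongr
            linarith
          nlinarith [sq_nonneg (δ * M - a' * D₀ ^ i)]
        calc a * M = ε₂ * (D₀ ^ i)⁻¹ * (4 * (δ * M) * (a' * D₀ ^ i)) := by
              rw [ha']
              field_simp
          _ ≤ _ := by gcongr
      have hτ : (R / (3 * R / 4 - R / 4 * (1 / 2) ^ (i + 1) -
          (3 * R / 4 - R / 4 * (1 / 2) ^ i))) ^ (-γ) = 8 ^ (-γ) * (D₀ ^ i)⁻¹ := by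
        have e1 : R / (3 * R / 4 - R / 4 * (1 / 2) ^ (i + 1) -
            (3 * R / 4 - R / 4 * (1 / 2) ^ i)) = 8 * 2 ^ i := by
          rw [show 3 * R / 4 - R / 4 * (1 / 2) ^ (i + 1) - (3 * R / 4 - R / 4 * (1 / 2) ^ i) =
            R / 4 * ((1 / 2) ^ i * (1 / 2)) by rw [pow_succ]; ring, one_div, inv_pow]
          field_simp
          norm_num
        rw [e1, Real.mul_rpow (by norm_num) (by positivity)]
        congr 1
        rw [hD₀, ← Real.rpow_natCast, ← Real.rpow_natCast, ← Real.rpow_mul (by norm_num),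
          ← Real.rpow_mul (by norm_num), ← Real.rpow_neg (by norm_num)]
        congr 1
        ring
      have hmain := hbd u V x₀ R T D (3 * R / 4 - R / 4 * (1 / 2) ^ i)
        (3 * R / 4 - R / 4 * (1 / 2) ^ (i + 1)) k (by nlinarith) (by rw [hpow]; nlinarith)
        (by nlinarith) hk0 (by have : 0 ≤ δ * M + a' * D₀ ^ i := by positivity
                               linarith) (by
          have hms := D.regular.measurableSet_ball x₀ (3 * R / 4 - R / 4 * (1 / 2) ^ (i + 1))
          calc _ ≤ ∫⁻ x in {x | d x₀ x < 3 * R / 4 - R / 4 * (1 / 2) ^ (i + 1)},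
                ENNReal.ofReal M * ENNReal.ofReal (u x) ∂μ := by
                apply lintegral_mono_ae
                rw [ae_restrict_iff' hms]
                filter_upwards [ih (i + 1)] with x hx hxi
                have h1 : u x ≤ M := hx hxi
                rw [← ENNReal.ofReal_mul hM0.le, sq]
                exact ENNReal.ofReal_le_ofReal
                  (mul_le_mul_of_nonneg_right h1 (D.nonneg_u x))
            _ = ENNReal.ofReal M * ∫⁻ x in {x | d x₀ x < 3 * R / 4 - R / 4 * (1 / 2) ^ (i + 1)},
                ENNReal.ofReal (u x) ∂μ := lintegral_const_mul' _ _ ENNReal.ofReal_ne_top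
            _ ≤ ENNReal.ofReal M * ENNReal.ofReal (a * R ^ Q) := by
                gcongr
                refine le_trans (lintegral_mono_set fun x hx => ?_) haR
                have hxr : d x₀ x < 3 * R / 4 - R / 4 * (1 / 2) ^ (i + 1) := hx
                have : 0 < R / 4 * (1 / 2) ^ (i + 1) := by positivity
                exact lt_of_lt_of_le hxr (by linarith)
            _ ≤ _ := by
                rw [← ENNReal.ofReal_mul hM0.le, hτ]
                apply ENNReal.ofReal_le_ofReal
                calc M * (a * R ^ Q) = (a * M) * R ^ Q := by ring
                  _ ≤ (ε₂ * (D₀ ^ i)⁻¹ * k ^ 2) * R ^ Q := by gcongr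
                  _ = _ := by
                    rw [hε₂]
                    ring)
      filter_upwards [hmain] with x hx hxi
      refine (hx hxi).trans ?_
      have hTδ : δ * T ≤ 1 / 2 * T := by gcongr
      calc k = δ ^ (n + 1) * M₀ + T + 2 * (δ * T) + 2 * a' * (δ * D₀) * D₀ ^ i + a' * D₀ ^ i := by
            rw [hk, hM, pow_succ, pow_succ]
            ring
        _ ≤ _ := by
            rw [hδD]
            linarith
  have hall := ae_all_iff.2 fun n => key n 0
  filter_upwards [hall] with x hx hxR
  have htend : Tendsto (fun n : ℕ => δ ^ n * M₀ + 2 * T + 2 * a' * D₀ ^ 0) atTop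
      (𝓝 (0 * M₀ + 2 * T + 2 * a' * D₀ ^ 0)) :=
    (((tendsto_pow_atTop_nhds_zero_of_lt_one hδ0.le (by linarith)).mul_const M₀).add_const
      (2 * T)).add_const _
  have h1 := ge_of_tendsto' htend fun n => hx n (by rw [pow_zero]; linarith)
  refine h1.trans (le_of_eq ?_)
  rw [ha']
  ring

end
end

/-! ### Weak convergence in `L²` and smooth truncations. -/

noncomputable section

lemma memLp_two_of_lintegral_sq_ne_top {Ω : Type*} [MeasurableSpace Ω] {ν : Measure Ω} {f : Ω → ℝ}
    (hf : AEStronglyMeasurable f ν) (h : ∫⁻ x, ENNReal.ofReal (f x ^ 2) ∂ν ≠ ⊤) : MemLp f 2 ν := by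
  rw [memLp_two_iff_integrable_sq hf]
  exact (lintegral_ofReal_ne_top_iff_integrable (hf.pow 2)
    (Eventually.of_forall fun x => sq_nonneg (f x))).1 h

/-- A sequence that is bounded in `L²` and converges almost everywhere converges weakly in `L²`. -/
lemma tendsto_integral_mul_of_lintegral_sq_le {Ω : Type*} [MeasurableSpace Ω] {ν : Measure Ω}
    {U G : Ω → ℝ} {F : ℕ → Ω → ℝ} {M : ℝ≥0∞} (hU : AEStronglyMeasurable U ν)
    (hG : AEStronglyMeasurable G ν) (hF : ∀ j, AEStronglyMeasurable (F j) ν)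
    (hU2 : ∫⁻ x, ENNReal.ofReal (U x ^ 2) ∂ν ≠ ⊤) (hM : M ≠ ⊤)
    (hF2 : ∀ j, ∫⁻ x, ENNReal.ofReal (F j x ^ 2) ∂ν ≤ M)
    (hlim : ∀ᵐ x ∂ν, Tendsto (fun j => F j x) atTop (𝓝 (G x))) :
    Integrable (fun x => U x * G x) ν ∧
      Tendsto (fun j => ∫ x, U x * F j x ∂ν) atTop (𝓝 (∫ x, U x * G x ∂ν)) := by
  have hsq : ∀ f : Ω → ℝ, AEStronglyMeasurable f ν →
      AEMeasurable (fun x => ENNReal.ofReal (f x ^ 2)) ν :=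
    fun f hf => (hf.aemeasurable.pow_const 2).ennreal_ofReal
  have hG2 : ∫⁻ x, ENNReal.ofReal (G x ^ 2) ∂ν ≤ M := by
    calc _ = ∫⁻ x, liminf (fun j => ENNReal.ofReal (F j x ^ 2)) atTop ∂ν := by
          apply lintegral_congr_ae
          filter_upwards [hlim] with x hx
          exact (ENNReal.tendsto_ofReal (hx.pow 2)).liminf_eq.symm
      _ ≤ liminf (fun j => ∫⁻ x, ENNReal.ofReal (F j x ^ 2) ∂ν) atTop :=
          lintegral_liminf_le' fun j => hsq _ (hF j)
      _ ≤ liminf (fun _ : ℕ => M) atTop := liminf_le_liminf (Eventually.of_forall hF2)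
      _ = M := liminf_const M
  have hUm := memLp_two_of_lintegral_sq_ne_top hU hU2
  have hGm := memLp_two_of_lintegral_sq_ne_top hG (ne_top_of_le_ne_top hM hG2)
  have hFm := fun j => memLp_two_of_lintegral_sq_ne_top (hF j) (ne_top_of_le_ne_top hM (hF2 j))
  have hUG : Integrable (fun x => U x * G x) ν := hUm.integrable_mul hGm
  refine ⟨hUG, ?_⟩
  refine tendsto_integral_of_L1 _ hUG.aestronglyMeasurable
    (Eventually.of_forall fun j => hUm.integrable_mul (hFm j)) ?_
  have hdiff : ∀ j, ∫⁻ x, ENNReal.ofReal ((F j x - G x) ^ 2) ∂ν ≤ 4 * M := by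
    intro j
    calc _ ≤ ∫⁻ x, (2 * ENNReal.ofReal (F j x ^ 2) + 2 * ENNReal.ofReal (G x ^ 2)) ∂ν := by
          refine lintegral_mono fun x => ?_
          rw [← ENNReal.ofReal_ofNat 2, ← ENNReal.ofReal_mul (by norm_num),
            ← ENNReal.ofReal_mul (by norm_num), ← ENNReal.ofReal_add (by positivity)
            (by positivity)]
          apply ENNReal.ofReal_le_ofReal
          nlinarith [sq_nonneg (F j x + G x)]
      _ = 2 * ∫⁻ x, ENNReal.ofReal (F j x ^ 2) ∂ν + 2 * ∫⁻ x, ENNReal.ofReal (G x ^ 2) ∂ν := by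
          rw [lintegral_add_left' ((hsq _ (hF j)).const_mul _),
            lintegral_const_mul' _ _ (by simp), lintegral_const_mul' _ _ (by simp)]
      _ ≤ 2 * M + 2 * M := by
          gcongr
          exact hF2 j
      _ = 4 * M := by ring
  rw [ENNReal.tendsto_nhds_zero]
  intro ε hε
  obtain ⟨n, hn⟩ := ENNReal.exists_nat_gt
    (ENNReal.div_ne_top (ENNReal.mul_ne_top (by simp : (4 : ℝ≥0∞) ≠ ⊤) hM)
      (ENNReal.half_pos hε.ne').ne')
  have hn0 : 0 < (n : ℝ) := by
    rcases Nat.eq_zero_or_pos n with h0 | h0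
    · simp [h0] at hn
    · exact_mod_cast h0
  have hnM : ENNReal.ofReal (n : ℝ)⁻¹ * (4 * M) ≤ ε / 2 := by
    have h1 : (n : ℝ≥0∞) ≠ 0 := by
      have : (n : ℕ) ≠ 0 := by exact_mod_cast hn0.ne'
      exact_mod_cast this
    rw [ENNReal.ofReal_inv_of_pos hn0, ENNReal.ofReal_natCast, mul_comm, ← div_eq_mul_inv]
    rw [ENNReal.div_le_iff h1 (by simp), mul_comm (ε / 2)]
    have := (ENNReal.div_le_iff_le_mul (Or.inl (ENNReal.half_pos hε.ne').ne')
      (Or.inr h1)).1 hn.le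
    exact this
  -- Where `|U (F j - G)|` exceeds `n U²`, it is at most `(F j - G)² / n`, whose integral is
  -- uniformly small. The remaining minimum is dominated by the integrable function `n U²`.
  have hbd : Tendsto (fun j => ∫⁻ x, ENNReal.ofReal (min |U x * (F j x - G x)| (n * U x ^ 2)) ∂ν)
      atTop (𝓝 0) := by
    have h0 : ∫⁻ _ : Ω, (0 : ℝ≥0∞) ∂ν = 0 := lintegral_zero
    rw [← h0]
    refine tendsto_lintegral_of_dominated_convergence' (fun x => ENNReal.ofReal (n * U x ^ 2))
      (fun j => ?_) (fun j => Eventually.of_forall fun x =>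
        ENNReal.ofReal_le_ofReal (min_le_right _ _)) ?_ ?_
    · exact ((hU.mul ((hF j).sub hG)).aemeasurable.abs.min
        ((hU.aemeasurable.pow_const 2).const_mul _)).ennreal_ofReal
    · simp_rw [ENNReal.ofReal_mul hn0.le]
      rw [lintegral_const_mul' _ _ ENNReal.ofReal_ne_top]
      exact ENNReal.mul_ne_top ENNReal.ofReal_ne_top hU2
    · filter_upwards [hlim] with x hx
      rw [← ENNReal.ofReal_zero]
      apply ENNReal.tendsto_ofReal
      have h1 : Tendsto (fun j => |U x * (F j x - G x)|) atTop (𝓝 0) := by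
        have := ((hx.sub_const (G x)).const_mul (U x)).abs
        simpa using this
      have h2 := h1.min (tendsto_const_nhds (x := (n : ℝ) * U x ^ 2))
      rwa [min_eq_left (by positivity)] at h2
  filter_upwards [(ENNReal.tendsto_nhds_zero.1 hbd) (ε / 2) (ENNReal.half_pos hε.ne')] with j hj
  calc _ ≤ ∫⁻ x, (ENNReal.ofReal (min |U x * (F j x - G x)| (n * U x ^ 2)) +
        ENNReal.ofReal (n : ℝ)⁻¹ * ENNReal.ofReal ((F j x - G x) ^ 2)) ∂ν := by
        refine lintegral_mono fun x => ?_
        rw [← mul_sub, Real.enorm_eq_ofReal_abs, ← ENNReal.ofReal_mul (by positivity),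
          ← ENNReal.ofReal_add (by positivity) (by positivity)]
        apply ENNReal.ofReal_le_ofReal
        set g := F j x - G x
        rcases le_total |U x * g| (n * U x ^ 2) with hle | hle
        · rw [min_eq_left hle]
          have : 0 ≤ (n : ℝ)⁻¹ * g ^ 2 := by positivity
          linarith
        · have h1 : n * |U x| * |U x| ≤ |g| * |U x| := by
            have : n * U x ^ 2 = n * |U x| * |U x| := by rw [← sq_abs]; ring
            rw [← this, mul_comm |g|, ← abs_mul]
            exact hle
          rcases (abs_nonneg (U x)).eq_or_lt with h0 | h0
          · rw [abs_mul, ← h0, zero_mul]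
            positivity
          · have h2 : n * |U x| ≤ |g| := le_of_mul_le_mul_right h1 h0
            have h3 : |U x| ≤ (n : ℝ)⁻¹ * |g| := by
              rw [le_inv_mul_iff₀ hn0]
              exact h2
            have h4 : |U x * g| ≤ (n : ℝ)⁻¹ * g ^ 2 := by
              rw [abs_mul, ← sq_abs g, sq, ← mul_assoc]
              gcongr
            have : 0 ≤ min |U x * g| (n * U x ^ 2) := by positivity
            linarith
    _ = ∫⁻ x, ENNReal.ofReal (min |U x * (F j x - G x)| (n * U x ^ 2)) ∂ν +
        ENNReal.ofReal (n : ℝ)⁻¹ * ∫⁻ x, ENNReal.ofReal ((F j x - G x) ^ 2) ∂ν := by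
        rw [lintegral_add_right', lintegral_const_mul' _ _ ENNReal.ofReal_ne_top]
        exact (hsq _ ((hF j).sub hG)).const_mul _
    _ ≤ ε / 2 + ε / 2 := by
        refine add_le_add hj (le_trans ?_ hnM)
        gcongr
        exact hdiff j
    _ = ε := ENNReal.add_halves ε

/-- A smooth approximation of `max (t - k) 0`. -/
def softPos (k ε t : ℝ) : ℝ := (t - k + Real.sqrt ((t - k) ^ 2 + ε ^ 2)) / 2

lemma softPos_nonneg (k ε t : ℝ) : 0 ≤ softPos k ε t := by
  have h1 : |t - k| ≤ Real.sqrt ((t - k) ^ 2 + ε ^ 2) := by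
    rw [← Real.sqrt_sq_eq_abs]
    exact Real.sqrt_le_sqrt (by nlinarith [sq_nonneg ε])
  have h2 := neg_abs_le (t - k)
  unfold softPos
  linarith

lemma sqrt_sq_add_sq_le (a b ε : ℝ) :
    Real.sqrt (a ^ 2 + ε ^ 2) ≤ Real.sqrt (b ^ 2 + ε ^ 2) + |a - b| := by
  have h0 : 0 ≤ b ^ 2 + ε ^ 2 := by positivity
  have h1 : |b| ≤ Real.sqrt (b ^ 2 + ε ^ 2) := by
    rw [← Real.sqrt_sq_eq_abs]
    exact Real.sqrt_le_sqrt (by nlinarith [sq_nonneg ε])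
  rw [Real.sqrt_le_left (by positivity), add_sq, Real.sq_sqrt h0, sq_abs]
  have h2 : b * (a - b) ≤ Real.sqrt (b ^ 2 + ε ^ 2) * |a - b| :=
    (le_abs_self _).trans (by rw [abs_mul]; gcongr)
  nlinarith

/-- The Lipschitz constant is one for every `ε`, so smoothing and truncating do not increase
differences, hence not the energy. -/
lemma abs_softPos_sub_le (k ε t t' : ℝ) : |softPos k ε t - softPos k ε t'| ≤ |t - t'| := by
  have h1 := sqrt_sq_add_sq_le (t - k) (t' - k) ε
  have h2 := sqrt_sq_add_sq_le (t' - k) (t - k) ε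
  rw [show t - k - (t' - k) = t - t' by ring] at h1
  rw [show t' - k - (t - k) = t' - t by ring, abs_sub_comm] at h2
  have h3 := le_abs_self (t - t')
  have h4 := neg_abs_le (t - t')
  unfold softPos
  rw [abs_le]
  constructor <;> linarith

lemma softPos_le {k ε : ℝ} (hk : 0 ≤ k) (hε : 0 ≤ ε) (t : ℝ) : softPos k ε t ≤ |t| + ε := by
  have h1 : softPos k ε t ≤ softPos k ε 0 + |t| := by
    have := (le_abs_self _).trans (abs_softPos_sub_le k ε t 0)
    rw [sub_zero] at this
    linarith
  have h2 : softPos k ε 0 ≤ ε := by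
    unfold softPos
    have := Real.sqrt_le_sqrt (show (0 - k) ^ 2 + ε ^ 2 ≤ (k + ε) ^ 2 by nlinarith)
    rw [Real.sqrt_sq (by positivity)] at this
    linarith
  linarith

/-- Joint continuity includes `ε = 0`, where the function is the positive part. So the smoothing may
be removed in the same limit in which the approximating functions converge. -/
lemma continuous_softPos (k : ℝ) : Continuous fun p : ℝ × ℝ => softPos k p.1 p.2 := by
  unfold softPos
  fun_prop

lemma softPos_zero (k t : ℝ) : softPos k 0 t = max (t - k) 0 := by
  unfold softPos
  rw [zero_pow two_ne_zero, add_zero, Real.sqrt_sq_eq_abs]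
  rcases le_total 0 (t - k) with h | h
  · rw [abs_of_nonneg h, max_eq_left h]
    ring
  · rw [abs_of_nonpos h, max_eq_right h]
    ring

lemma contDiff_softPos (k : ℝ) {ε : ℝ} (hε : 0 < ε) : ContDiff ℝ ∞ (softPos k ε) := by
  unfold softPos
  refine ContDiff.div_const (ContDiff.add (by fun_prop) (ContDiff.sqrt (by fun_prop) ?_)) 2
  intro t
  positivity
end

/-! ### The Caccioppoli inequality. -/

noncomputable section

namespace IsAhlforsRegular

variable {X : Type*} [MeasurableSpace X] {μ : Measure X} {d : X → X → ℝ} {Q c s : ℝ}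

lemma fracEnergy_le_two_mul_add (h : IsAhlforsRegular μ d Q c) (q : ℝ) {f g : X → ℝ}
    (hf : Measurable f) :
    fracEnergy μ d q g ≤ 2 * fracEnergy μ d q f + 2 * fracEnergy μ d q (fun x => g x - f x) := by
  unfold fracEnergy
  rw [← lintegral_const_mul' _ _ (by simp), ← lintegral_const_mul' _ _ (by simp),
    ← lintegral_add_left ((h.measurable_energy_integrand q hf).ennreal_ofReal.const_mul _)]
  refine lintegral_mono fun z => ?_
  have hd : 0 ≤ d z.1 z.2 ^ q := Real.rpow_nonneg (h.nonneg _ _) _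
  rw [← ENNReal.ofReal_ofNat 2, ← ENNReal.ofReal_mul (by norm_num),
    ← ENNReal.ofReal_mul (by norm_num), ← ENNReal.ofReal_add (by positivity) (by positivity)]
  apply ENNReal.ofReal_le_ofReal
  rw [← mul_div_assoc, ← mul_div_assoc, ← add_div]
  gcongr
  nlinarith [sq_nonneg (f z.1 - f z.2 - (g z.1 - f z.1 - (g z.2 - f z.2)))]

lemma lintegral_energy_slice_le (h : IsAhlforsRegular μ d Q c) {Ck A ℓ : ℝ} (hA : 0 ≤ A)
    (hℓ : 0 < ℓ)
    (hker : ∀ (x : X) (ℓ : ℝ), 0 < ℓ →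
      ∫⁻ y, ENNReal.ofReal (min 1 ((d x y / ℓ) ^ 2) / d x y ^ (Q + 2 * s)) ∂μ ≤
        ENNReal.ofReal (Ck * ℓ ^ (-(2 * s))))
    {ζ : X → ℝ} (hζ : ∀ x y, (ζ x - ζ y) ^ 2 ≤ A * min 1 ((d x y / ℓ) ^ 2)) (x : X) :
    ∫⁻ y, ENNReal.ofReal ((ζ x - ζ y) ^ 2 / d x y ^ (Q + 2 * s)) ∂μ ≤
      ENNReal.ofReal A * ENNReal.ofReal (Ck * ℓ ^ (-(2 * s))) := by
  refine le_trans ?_ (mul_le_mul_right (hker x ℓ hℓ) _)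
  rw [← lintegral_const_mul' _ _ ENNReal.ofReal_ne_top]
  refine lintegral_mono fun y => ?_
  rw [← ENNReal.ofReal_mul hA]
  apply ENNReal.ofReal_le_ofReal
  rw [← mul_div_assoc]
  have := Real.rpow_nonneg (h.nonneg x y) (Q + 2 * s)
  gcongr
  exact hζ x y

/-- Lipschitz functions supported in a set of finite measure have finite energy. -/
lemma fracEnergy_ne_top [SFinite μ] (h : IsAhlforsRegular μ d Q c) {Ck A ℓ : ℝ} (hA : 0 ≤ A)
    (hℓ : 0 < ℓ)
    (hker : ∀ (x : X) (ℓ : ℝ), 0 < ℓ →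
      ∫⁻ y, ENNReal.ofReal (min 1 ((d x y / ℓ) ^ 2) / d x y ^ (Q + 2 * s)) ∂μ ≤
        ENNReal.ofReal (Ck * ℓ ^ (-(2 * s))))
    {ζ : X → ℝ} (hζm : Measurable ζ) (hζ : ∀ x y, (ζ x - ζ y) ^ 2 ≤ A * min 1 ((d x y / ℓ) ^ 2))
    {B : Set X} (hBm : MeasurableSet B) (hB : μ B ≠ ⊤) (hζB : ∀ x ∉ B, ζ x = 0) :
    fracEnergy μ d (Q + 2 * s) ζ ≠ ⊤ := by
  set F : X × X → ℝ≥0∞ := fun z => B.indicator 1 z.1 *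
    ENNReal.ofReal ((ζ z.1 - ζ z.2) ^ 2 / d z.1 z.2 ^ (Q + 2 * s)) with hF
  have hFm : Measurable F := ((measurable_one.indicator hBm).comp measurable_fst).mul
    (h.measurable_energy_integrand _ hζm).ennreal_ofReal
  have hpt : ∀ z : X × X, ENNReal.ofReal ((ζ z.1 - ζ z.2) ^ 2 / d z.1 z.2 ^ (Q + 2 * s)) ≤
      F z + F z.swap := by
    rintro ⟨x, y⟩
    by_cases hx : x ∈ B
    · refine le_trans (le_of_eq ?_) le_self_add
      simp [hF, hx]
    · by_cases hy : y ∈ B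
      · refine le_trans (le_of_eq ?_) le_add_self
        simp only [hF, Prod.fst_swap, Prod.snd_swap, Set.indicator_of_mem hy, Pi.one_apply, one_mul]
        rw [h.symm x y, sub_sq_comm]
      · simp [hζB x hx, hζB y hy]
  have hI : ∫⁻ z, F z ∂(μ.prod μ) ≤
      μ B * (ENNReal.ofReal A * ENNReal.ofReal (Ck * ℓ ^ (-(2 * s)))) := by
    rw [lintegral_prod _ hFm.aemeasurable]
    calc _ ≤ ∫⁻ x, B.indicator 1 x *
          (ENNReal.ofReal A * ENNReal.ofReal (Ck * ℓ ^ (-(2 * s)))) ∂μ := by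
          refine lintegral_mono fun x => ?_
          simp only [hF]
          rw [lintegral_const_mul' _ _ (by by_cases hx : x ∈ B <;> simp [hx])]
          gcongr
          exact h.lintegral_energy_slice_le hA hℓ hker hζ x
      _ = _ := by
          rw [lintegral_mul_const _ (measurable_one.indicator hBm), lintegral_indicator_one hBm]
  refine ne_top_of_le_ne_top ?_ (lintegral_mono hpt)
  rw [lintegral_add_left hFm, lintegral_prod_swap_eq F hFm]
  have : ∫⁻ z, F z ∂(μ.prod μ) ≠ ⊤ := ne_top_of_le_ne_top
    (ENNReal.mul_ne_top hB (ENNReal.mul_ne_top ENNReal.ofReal_ne_top ENNReal.ofReal_ne_top)) hI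
  exact ENNReal.add_ne_top.2 ⟨this, this⟩

/-- The Sobolev inequality with a weight. -/
lemma lintegral_mul_sq_le_energy {CS : ℝ} (hs0 : 0 < s) (hsQ : 2 * s < Q)
    (hsob : ∀ u : X → ℝ, Measurable u →
      ∫⁻ x, ENNReal.ofReal (|u x| ^ (2 * Q / (Q - 2 * s))) ∂μ ≠ ⊤ →
      (∫⁻ x, ENNReal.ofReal (|u x| ^ (2 * Q / (Q - 2 * s))) ∂μ) ^ ((Q - 2 * s) / Q) ≤
        ENNReal.ofReal CS * fracEnergy μ d (Q + 2 * s) u)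
    {W : X → ℝ≥0∞} (hW : AEMeasurable W μ) {f : X → ℝ} (hf : Measurable f)
    (hffin : ∫⁻ x, ENNReal.ofReal (|f x| ^ (2 * Q / (Q - 2 * s))) ∂μ ≠ ⊤) :
    ∫⁻ x, W x * ENNReal.ofReal (f x ^ 2) ∂μ ≤ (∫⁻ x, W x ^ (Q / (2 * s)) ∂μ) ^ (2 * s / Q) *
      (ENNReal.ofReal CS * fracEnergy μ d (Q + 2 * s) f) := by
  have hQs : 0 < Q - 2 * s := by linarith
  have hQ : 0 < Q := by linarith
  have h1 := lintegral_mul_sq_le hW (hf.abs.ennreal_ofReal.aemeasurable (μ := μ)) hs0 hsQ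
  simp_rw [← ofReal_abs_rpow zero_le_two,
    ← ofReal_abs_rpow (by positivity : 0 ≤ 2 * Q / (Q - 2 * s)), Real.rpow_two, sq_abs] at h1
  exact h1.trans (mul_le_mul_right (hsob f hf hffin) _)

/-- Almost everywhere limits of sequences with bounded energy satisfy the Sobolev bound. -/
lemma lintegral_rpow_ne_top_of_tendsto {CS : ℝ} (hs0 : 0 < s) (hsQ : 2 * s < Q)
    (hsob : ∀ u : X → ℝ, Measurable u →
      ∫⁻ x, ENNReal.ofReal (|u x| ^ (2 * Q / (Q - 2 * s))) ∂μ ≠ ⊤ →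
      (∫⁻ x, ENNReal.ofReal (|u x| ^ (2 * Q / (Q - 2 * s))) ∂μ) ^ ((Q - 2 * s) / Q) ≤
        ENNReal.ofReal CS * fracEnergy μ d (Q + 2 * s) u)
    {u : X → ℝ} {φ : ℕ → X → ℝ} (hφ : ∀ j, Measurable (φ j))
    (hφp : ∀ j, ∫⁻ x, ENNReal.ofReal (|φ j x| ^ (2 * Q / (Q - 2 * s))) ∂μ ≠ ⊤)
    {M : ℝ≥0∞} (hM : M ≠ ⊤) (hφM : ∀ j, fracEnergy μ d (Q + 2 * s) (φ j) ≤ M)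
    (hlim : ∀ᵐ x ∂μ, Tendsto (fun j => φ j x) atTop (𝓝 (u x))) :
    ∫⁻ x, ENNReal.ofReal (|u x| ^ (2 * Q / (Q - 2 * s))) ∂μ ≠ ⊤ := by
  have hQs : 0 < Q - 2 * s := by linarith
  have hQ : 0 < Q := by linarith
  set p := 2 * Q / (Q - 2 * s) with hp
  have hp0 : 0 < p := by positivity
  have hbd : ∀ j, ∫⁻ x, ENNReal.ofReal (|φ j x| ^ p) ∂μ ≤
      (ENNReal.ofReal CS * M) ^ (Q / (Q - 2 * s)) := by
    intro j
    have h1 := (hsob (φ j) (hφ j) (hφp j)).trans (mul_le_mul_right (hφM j) _)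
    have h2 := ENNReal.rpow_le_rpow h1 (by positivity : 0 ≤ Q / (Q - 2 * s))
    rwa [← ENNReal.rpow_mul, div_mul_div_cancel₀ hQ.ne', div_self hQs.ne', ENNReal.rpow_one] at h2
  refine ne_top_of_le_ne_top (b := (ENNReal.ofReal CS * M) ^ (Q / (Q - 2 * s)))
    (ENNReal.rpow_ne_top_of_nonneg (by positivity) (ENNReal.mul_ne_top ENNReal.ofReal_ne_top hM)) ?_
  calc _ = ∫⁻ x, liminf (fun j => ENNReal.ofReal (|φ j x| ^ p)) atTop ∂μ := by
        apply lintegral_congr_ae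
        filter_upwards [hlim] with x hx
        exact (ENNReal.tendsto_ofReal
          (hx.abs.rpow_const (Or.inr hp0.le))).liminf_eq.symm
    _ ≤ liminf (fun j => ∫⁻ x, ENNReal.ofReal (|φ j x| ^ p) ∂μ) atTop :=
        lintegral_liminf_le fun j => ((hφ j).abs.pow_const p).ennreal_ofReal
    _ ≤ liminf (fun _ : ℕ => (ENNReal.ofReal CS * M) ^ (Q / (Q - 2 * s))) atTop :=
        liminf_le_liminf (Eventually.of_forall hbd)
    _ = _ := liminf_const _

/-- The energy of a truncation times a squared cutoff is controlled. -/
lemma exists_fracEnergy_softPos_le [SFinite μ] (h : IsAhlforsRegular μ d Q c) {Ck CS L : ℝ}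
    (hs0 : 0 < s) (hsQ : 2 * s < Q) (hL : 0 < L)
    (hker : ∀ (x : X) (ℓ : ℝ), 0 < ℓ →
      ∫⁻ y, ENNReal.ofReal (min 1 ((d x y / ℓ) ^ 2) / d x y ^ (Q + 2 * s)) ∂μ ≤
        ENNReal.ofReal (Ck * ℓ ^ (-(2 * s))))
    (hsob : ∀ u : X → ℝ, Measurable u →
      ∫⁻ x, ENNReal.ofReal (|u x| ^ (2 * Q / (Q - 2 * s))) ∂μ ≠ ⊤ →
      (∫⁻ x, ENNReal.ofReal (|u x| ^ (2 * Q / (Q - 2 * s))) ∂μ) ^ ((Q - 2 * s) / Q) ≤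
        ENNReal.ofReal CS * fracEnergy μ d (Q + 2 * s) u)
    {x₀ : X} {r ρ : ℝ} (hr : 0 < r) (hrρ : r < ρ) {η : X → ℝ} (hη : IsCutoff d L x₀ r ρ η)
    {k : ℝ} (hk : 0 ≤ k) {M : ℝ≥0∞} (hM : M ≠ ⊤) :
    ∃ M' : ℝ≥0∞, M' ≠ ⊤ ∧ ∀ (φ : X → ℝ) (ε : ℝ), Measurable φ → 0 ≤ ε → ε ≤ 1 →
      ∫⁻ x, ENNReal.ofReal (|φ x| ^ (2 * Q / (Q - 2 * s))) ∂μ ≠ ⊤ →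
      fracEnergy μ d (Q + 2 * s) φ ≤ M →
      fracEnergy μ d (Q + 2 * s) (fun x => softPos k ε (φ x) * η x ^ 2) ≤ M' := by
  have hQ := h.dim_pos
  have hℓ : 0 < ρ - r := by linarith
  set q := Q + 2 * s with hq
  set P := ENNReal.ofReal L * ENNReal.ofReal (Ck * (ρ - r) ^ (-(2 * s))) with hP
  have hPtop : P ≠ ⊤ := ENNReal.mul_ne_top ENNReal.ofReal_ne_top ENNReal.ofReal_ne_top
  set Γ : X → ℝ≥0∞ := fun x => ∫⁻ y, ENNReal.ofReal ((η x - η y) ^ 2 / d x y ^ q) ∂μ with hΓ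
  have hηm : Measurable fun z : X × X => ENNReal.ofReal ((η z.1 - η z.2) ^ 2 / d z.1 z.2 ^ q) :=
    (h.measurable_energy_integrand q hη.measurable).ennreal_ofReal
  have hΓm : Measurable Γ := hηm.lintegral_prod_right'
  have hΓP : ∀ x, Γ x ≤ P := fun x => h.lintegral_energy_slice_le hL.le hℓ hker hη.sq_sub_le x
  have hEη : fracEnergy μ d q η ≠ ⊤ := h.fracEnergy_ne_top hL.le hℓ hker hη.measurable
    hη.sq_sub_le (h.measurableSet_ball x₀ ρ)
    (by rw [h.measure_ball x₀ ρ (by linarith)]; exact ENNReal.ofReal_ne_top)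
    (fun x hx => hη.eq_zero x (not_lt.1 hx))
  have hΓI : ∫⁻ x, Γ x ∂μ = fracEnergy μ d q η :=
    (h.fracEnergy_eq_lintegral q hη.measurable).symm
  -- `Γ` is bounded and integrable, hence lies in `L^{Q/(2s)}`, and the cross term of the product
  -- rule, `∫ Γ φ²`, is controlled by the weighted Sobolev inequality.
  have hΓQ : ∫⁻ x, Γ x ^ (Q / (2 * s)) ∂μ ≠ ⊤ := by
    have hexp : 0 ≤ Q / (2 * s) - 1 := by
      rw [sub_nonneg, one_le_div (by positivity)]
      exact hsQ.le
    refine ne_top_of_le_ne_top (b := P ^ (Q / (2 * s) - 1) * fracEnergy μ d q η)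
      (ENNReal.mul_ne_top (ENNReal.rpow_ne_top_of_nonneg hexp hPtop) hEη) ?_
    rw [← hΓI, ← lintegral_const_mul _ hΓm]
    refine lintegral_mono fun x => ?_
    calc Γ x ^ (Q / (2 * s)) = Γ x ^ (Q / (2 * s) - 1) * Γ x := by
          nth_rewrite 3 [← ENNReal.rpow_one (Γ x)]
          rw [← ENNReal.rpow_add_of_nonneg _ _ hexp zero_le_one, sub_add_cancel]
      _ ≤ _ := by
          gcongr
          exact hΓP x
  refine ⟨2 * M + 16 * ((∫⁻ x, Γ x ^ (Q / (2 * s)) ∂μ) ^ (2 * s / Q) * (ENNReal.ofReal CS * M)) +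
    16 * fracEnergy μ d q η, ?_, ?_⟩
  · refine ENNReal.add_ne_top.2 ⟨ENNReal.add_ne_top.2 ⟨ENNReal.mul_ne_top (by simp) hM,
      ENNReal.mul_ne_top (by simp) (ENNReal.mul_ne_top
        (ENNReal.rpow_ne_top_of_nonneg (by positivity) hΓQ)
        (ENNReal.mul_ne_top ENNReal.ofReal_ne_top hM))⟩, ENNReal.mul_ne_top (by simp) hEη⟩
  intro φ ε hφ hε0 hε1 hφp hφM
  set e : X × X → ℝ≥0∞ := fun z => ENNReal.ofReal ((φ z.1 - φ z.2) ^ 2 / d z.1 z.2 ^ q) with he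
  set g : X × X → ℝ≥0∞ := fun z => ENNReal.ofReal ((η z.1 - η z.2) ^ 2 / d z.1 z.2 ^ q) with hg
  have hem : Measurable e := (h.measurable_energy_integrand q hφ).ennreal_ofReal
  have hφ2 : Measurable fun z : X × X => ENNReal.ofReal (φ z.1 ^ 2) :=
    ((hφ.comp measurable_fst).pow_const 2).ennreal_ofReal
  have hφη : Measurable fun z : X × X => ENNReal.ofReal (φ z.1 ^ 2) * g z := hφ2.mul hηm
  calc _ ≤ ∫⁻ z : X × X, (2 * e z + 16 * (ENNReal.ofReal (φ z.1 ^ 2) * g z) + 16 * g z)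
        ∂(μ.prod μ) := by
        refine lintegral_mono ?_
        rintro ⟨x, y⟩
        have hd : 0 ≤ d x y ^ q := Real.rpow_nonneg (h.nonneg _ _) _
        simp only [he, hg]
        rw [← ENNReal.ofReal_ofNat 2, ← ENNReal.ofReal_ofNat 16,
          ← ENNReal.ofReal_mul (by norm_num), ← ENNReal.ofReal_mul (by positivity),
          ← ENNReal.ofReal_mul (by norm_num), ← ENNReal.ofReal_mul (by norm_num),
          ← ENNReal.ofReal_add (by positivity) (by positivity),
          ← ENNReal.ofReal_add (by positivity) (by positivity)]
        apply ENNReal.ofReal_le_ofReal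
        rw [← mul_div_assoc, ← mul_div_assoc, ← mul_div_assoc, ← mul_div_assoc, ← add_div,
          ← add_div]
        gcongr
        have hfx0 := softPos_nonneg k ε (φ x)
        set fx := softPos k ε (φ x) with hfx
        set fy := softPos k ε (φ y) with hfy
        have h1 : (fx - fy) ^ 2 ≤ (φ x - φ y) ^ 2 := sq_le_sq.2 (abs_softPos_sub_le k ε _ _)
        have h2 : fx ^ 2 ≤ 2 * φ x ^ 2 + 2 := by
          have h3 : fx ≤ |φ x| + 1 := (softPos_le hk hε0 _).trans (by linarith)
          calc fx ^ 2 ≤ (|φ x| + 1) ^ 2 := by gcongr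
            _ ≤ 2 * φ x ^ 2 + 2 := by
              rw [← sq_abs (φ x)]
              nlinarith [sq_nonneg (|φ x| - 1)]
        have hx0 := hη.nonneg x
        have hx1 := hη.le_one x
        have hy0 := hη.nonneg y
        have hy1 := hη.le_one y
        have h3 : (η x ^ 2 - η y ^ 2) ^ 2 ≤ 4 * (η x - η y) ^ 2 := by
          have : (η x + η y) ^ 2 ≤ 4 := by nlinarith
          calc (η x ^ 2 - η y ^ 2) ^ 2 = (η x + η y) ^ 2 * (η x - η y) ^ 2 := by ring
            _ ≤ _ := by gcongr
        have h4 : (η y ^ 2) ^ 2 ≤ 1 := by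
          rw [← pow_mul]
          exact pow_le_one₀ hy0 hy1
        calc (fx * η x ^ 2 - fy * η y ^ 2) ^ 2
            = ((fx - fy) * η y ^ 2 + fx * (η x ^ 2 - η y ^ 2)) ^ 2 := by ring
          _ ≤ 2 * ((fx - fy) ^ 2 * (η y ^ 2) ^ 2) + 2 * (fx ^ 2 * (η x ^ 2 - η y ^ 2) ^ 2) := by
            nlinarith [sq_nonneg ((fx - fy) * η y ^ 2 - fx * (η x ^ 2 - η y ^ 2))]
          _ ≤ 2 * ((φ x - φ y) ^ 2 * 1) + 2 * ((2 * φ x ^ 2 + 2) * (4 * (η x - η y) ^ 2)) := by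
            gcongr
          _ = _ := by ring
    _ = 2 * fracEnergy μ d q φ + 16 * ∫⁻ x, Γ x * ENNReal.ofReal (φ x ^ 2) ∂μ +
        16 * fracEnergy μ d q η := by
        rw [lintegral_add_right _ (hηm.const_mul _), lintegral_add_left (hem.const_mul _),
          lintegral_const_mul' _ _ (by simp), lintegral_const_mul' _ _ (by simp),
          lintegral_const_mul' _ _ (by simp), lintegral_prod _ hφη.aemeasurable]
        congr 3
        refine lintegral_congr fun x => ?_
        simp only [hΓ, hg]
        rw [lintegral_const_mul' _ _ ENNReal.ofReal_ne_top, mul_comm]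
    _ ≤ _ := by
        gcongr
        refine (lintegral_mul_sq_le_energy hs0 hsQ hsob hΓm.aemeasurable hφ hφp).trans ?_
        gcongr

set_option maxHeartbeats 1000000 in
/-- The nonlocal Caccioppoli inequality for limits of admissible functions. -/
theorem caccioppoliIneq [SFinite μ] (h : IsAhlforsRegular μ d Q c) {Ck CS L : ℝ}
    (hs0 : 0 < s) (hsQ : 2 * s < Q) (hL : 0 < L)
    (hker : ∀ (x : X) (ℓ : ℝ), 0 < ℓ →
      ∫⁻ y, ENNReal.ofReal (min 1 ((d x y / ℓ) ^ 2) / d x y ^ (Q + 2 * s)) ∂μ ≤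
        ENNReal.ofReal (Ck * ℓ ^ (-(2 * s))))
    (hsob : ∀ u : X → ℝ, Measurable u →
      ∫⁻ x, ENNReal.ofReal (|u x| ^ (2 * Q / (Q - 2 * s))) ∂μ ≠ ⊤ →
      (∫⁻ x, ENNReal.ofReal (|u x| ^ (2 * Q / (Q - 2 * s))) ∂μ) ^ ((Q - 2 * s) / Q) ≤
        ENNReal.ofReal CS * fracEnergy μ d (Q + 2 * s) u)
    {x₀ : X} {r ρ : ℝ} (hr : 0 < r) (hrρ : r < ρ) {η : X → ℝ} (hη : IsCutoff d L x₀ r ρ η)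
    {u V : X → ℝ} (hu : Measurable u) (hu0 : ∀ x, 0 ≤ u x) (hV : Measurable V)
    (hVQ : ∫⁻ x, ENNReal.ofReal |V x| ^ (Q / (2 * s)) ∂μ ≠ ⊤)
    (huE : fracEnergy μ d (Q + 2 * s) u ≠ ⊤)
    (hup : ∫⁻ x, ENNReal.ofReal (|u x| ^ (2 * Q / (Q - 2 * s))) ∂μ ≠ ⊤)
    {φ : ℕ → X → ℝ} (hφ : ∀ j, Measurable (φ j))
    (hφp : ∀ j, ∫⁻ x, ENNReal.ofReal (|φ j x| ^ (2 * Q / (Q - 2 * s))) ∂μ ≠ ⊤)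
    {M : ℝ≥0∞} (hM : M ≠ ⊤) (hφM : ∀ j, fracEnergy μ d (Q + 2 * s) (φ j) ≤ M)
    (hlim : ∀ᵐ x ∂μ, Tendsto (fun j => φ j x) atTop (𝓝 (u x)))
    (hsub : ∀ k ε : ℝ, 0 ≤ k → 0 < ε → ∀ j,
      ∫ z : X × X, (u z.1 - u z.2) * (softPos k ε (φ j z.1) * η z.1 ^ 2 -
        softPos k ε (φ j z.2) * η z.2 ^ 2) / d z.1 z.2 ^ (Q + 2 * s) ∂(μ.prod μ) ≤
      ∫ x, V x * u x * (softPos k ε (φ j x) * η x ^ 2) ∂μ) :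
    CaccioppoliIneq μ d (Q + 2 * s) u V η := by
  intro k hk
  have hQ := h.dim_pos
  have hQs : 0 < Q - 2 * s := by linarith
  have hp0 : 0 < 2 * Q / (Q - 2 * s) := by positivity
  have hℓ : 0 < ρ - r := by linarith
  have hBtop : μ {y | d x₀ y < ρ} ≠ ⊤ := by
    rw [h.measure_ball x₀ ρ (by linarith)]
    exact ENNReal.ofReal_ne_top
  have hEη : fracEnergy μ d (Q + 2 * s) η ≠ ⊤ := h.fracEnergy_ne_top hL.le hℓ hker hη.measurable
    hη.sq_sub_le (h.measurableSet_ball x₀ ρ) hBtop (fun x hx => hη.eq_zero x (not_lt.1 hx))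
  have hηp : ∫⁻ x, ENNReal.ofReal (|η x| ^ (2 * Q / (Q - 2 * s))) ∂μ ≠ ⊤ := by
    refine ne_top_of_le_ne_top hBtop ?_
    rw [← lintegral_indicator_one (h.measurableSet_ball x₀ ρ)]
    refine lintegral_mono fun x => ?_
    by_cases hx : x ∈ {y | d x₀ y < ρ}
    · rw [Set.indicator_of_mem hx, Pi.one_apply, ← ENNReal.ofReal_one]
      apply ENNReal.ofReal_le_ofReal
      rw [abs_of_nonneg (hη.nonneg x)]
      exact Real.rpow_le_one (hη.nonneg x) (hη.le_one x) hp0.le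
    · rw [hη.eq_zero x (not_lt.1 hx), abs_zero, Real.zero_rpow hp0.ne']
      simp
  have hη2 : ∀ x, η x ^ 2 ≤ 1 := fun x => pow_le_one₀ (hη.nonneg x) (hη.le_one x)
  obtain ⟨M', hM', hbdd⟩ :=
    h.exists_fracEnergy_softPos_le hs0 hsQ hL hker hsob hr hrρ hη hk hM
  set q := Q + 2 * s with hq
  set w : X → ℝ := fun x => max (u x - k) 0 with hw
  have hwm : Measurable w := (hu.sub_const _).max measurable_const
  have hw0 : ∀ x, 0 ≤ w x := fun x => le_max_right _ _
  set v : X → ℝ := fun x => w x * η x ^ 2 with hv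
  have hvm : Measurable v := hwm.mul (hη.measurable.pow_const 2)
  -- The smoothing parameter is tied to the index of the approximation, so there is only one limit
  -- to take.
  set ε : ℕ → ℝ := fun j => 1 / ((j : ℝ) + 1) with hε
  have hε0 : ∀ j, 0 < ε j := fun j => by positivity
  have hε1 : ∀ j, ε j ≤ 1 := fun j => by
    rw [hε, div_le_one (by positivity)]
    have : (0 : ℝ) ≤ j := by positivity
    linarith
  have hεlim : Tendsto ε atTop (𝓝 0) := tendsto_one_div_add_atTop_nhds_zero_nat
  set vj : ℕ → X → ℝ := fun j x => softPos k (ε j) (φ j x) * η x ^ 2 with hvj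
  have hvjm : ∀ j, Measurable (vj j) := fun j =>
    (((continuous_softPos k).comp (Continuous.prodMk_right (ε j))).measurable.comp (hφ j)).mul
      (hη.measurable.pow_const 2)
  have hvlim : ∀ᵐ x ∂μ, Tendsto (fun j => vj j x) atTop (𝓝 (v x)) := by
    filter_upwards [hlim] with x hx
    have h1 := ((continuous_softPos k).tendsto (0, u x)).comp (hεlim.prodMk_nhds hx)
    simp only [softPos_zero] at h1
    exact h1.mul_const _
  have hκ : ∀ z : X × X, (d z.1 z.2 ^ (q / 2)) ^ 2 = d z.1 z.2 ^ q := fun z => by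
    rw [← Real.rpow_natCast, ← Real.rpow_mul (h.nonneg _ _)]
    congr 1
    push_cast
    ring
  have hquot : ∀ f : X → ℝ, Measurable f →
      Measurable fun z : X × X => (f z.1 - f z.2) / d z.1 z.2 ^ (q / 2) := fun f hf =>
    ((hf.comp measurable_fst).sub (hf.comp measurable_snd)).div (h.measurable_dist.pow_const _)
  have henergy : ∀ f : X → ℝ, ∫⁻ z : X × X,
      ENNReal.ofReal (((f z.1 - f z.2) / d z.1 z.2 ^ (q / 2)) ^ 2) ∂(μ.prod μ) =
      fracEnergy μ d q f := fun f => lintegral_congr fun z => by rw [div_pow, hκ]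
  have hprod : ∀ (f g : X → ℝ) (z : X × X), (f z.1 - f z.2) / d z.1 z.2 ^ (q / 2) *
      ((g z.1 - g z.2) / d z.1 z.2 ^ (q / 2)) = (f z.1 - f z.2) * (g z.1 - g z.2) /
        d z.1 z.2 ^ q := fun f g z => by rw [div_mul_div_comm, ← sq, hκ]
  -- Half of the kernel goes to each factor, so that the form becomes an `L²` inner product on `X ×
  -- X`.
  obtain ⟨hI₁, hT₁⟩ := tendsto_integral_mul_of_lintegral_sq_le (ν := μ.prod μ)
    (U := fun z : X × X => (u z.1 - u z.2) / d z.1 z.2 ^ (q / 2))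
    (G := fun z : X × X => (v z.1 - v z.2) / d z.1 z.2 ^ (q / 2))
    (F := fun j (z : X × X) => (vj j z.1 - vj j z.2) / d z.1 z.2 ^ (q / 2))
    (hquot u hu).aestronglyMeasurable (hquot v hvm).aestronglyMeasurable
    (fun j => (hquot _ (hvjm j)).aestronglyMeasurable) (by rwa [henergy]) hM'
    (fun j => by
      rw [henergy]
      exact hbdd (φ j) (ε j) (hφ j) (hε0 j).le (hε1 j) (hφp j) (hφM j))
    (by
      filter_upwards [Measure.quasiMeasurePreserving_fst.ae hvlim,
        Measure.quasiMeasurePreserving_snd.ae hvlim] with z hz1 hz2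
      exact (hz1.sub hz2).div_const _)
  simp_rw [hprod] at hI₁ hT₁
  have hfV : Measurable fun x => ENNReal.ofReal |V x| := hV.abs.ennreal_ofReal
  set N := (∫⁻ x, ENNReal.ofReal |V x| ^ (Q / (2 * s)) ∂μ) ^ (2 * s / Q) with hN
  have hNtop : N ≠ ⊤ := ENNReal.rpow_ne_top_of_nonneg (by positivity) hVQ
  have hsqrtV : ∀ x, Real.sqrt |V x| ^ 2 = |V x| := fun x => Real.sq_sqrt (abs_nonneg _)
  -- The potential is shared in the same way, `√|V|` to each factor. Where `V = 0`, division by zero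
  -- returns zero and the identity persists.
  have hVsplit : ∀ x a b : ℝ, x * a / Real.sqrt |x| * (Real.sqrt |x| * b) = x * a * b := by
    intro x a b
    rcases eq_or_ne x 0 with rfl | hx
    · simp
    · have : Real.sqrt |x| ≠ 0 := (Real.sqrt_pos.2 (abs_pos.2 hx)).ne'
      field_simp
  obtain ⟨hI₂, hT₂⟩ := tendsto_integral_mul_of_lintegral_sq_le (ν := μ)
    (U := fun x => V x * u x / Real.sqrt |V x|)
    (G := fun x => Real.sqrt |V x| * v x)
    (F := fun j x => Real.sqrt |V x| * vj j x)
    (M := 2 * (N * (ENNReal.ofReal CS * M)) + 2 * (N * (ENNReal.ofReal CS * fracEnergy μ d q η)))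
    ((hV.mul hu).div hV.abs.sqrt).aestronglyMeasurable
    (hV.abs.sqrt.mul hvm).aestronglyMeasurable
    (fun j => (hV.abs.sqrt.mul (hvjm j)).aestronglyMeasurable)
    (by
      refine ne_top_of_le_ne_top (b := N * (ENNReal.ofReal CS * fracEnergy μ d q u))
        (ENNReal.mul_ne_top hNtop (ENNReal.mul_ne_top ENNReal.ofReal_ne_top huE))
        (le_trans (lintegral_mono fun x => ?_)
          (lintegral_mul_sq_le_energy hs0 hsQ hsob hfV.aemeasurable hu hup))
      rw [← ENNReal.ofReal_mul (abs_nonneg _)]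
      apply ENNReal.ofReal_le_ofReal
      rw [div_pow, hsqrtV, mul_pow, ← sq_abs (V x), mul_div_right_comm]
      gcongr
      rw [sq, mul_self_div_self])
    (ENNReal.add_ne_top.2 ⟨ENNReal.mul_ne_top (by simp) (ENNReal.mul_ne_top hNtop
      (ENNReal.mul_ne_top ENNReal.ofReal_ne_top hM)), ENNReal.mul_ne_top (by simp)
      (ENNReal.mul_ne_top hNtop (ENNReal.mul_ne_top ENNReal.ofReal_ne_top hEη))⟩)
    (fun j => by
      have h1 := lintegral_mul_sq_le_energy hs0 hsQ hsob hfV.aemeasurable (hφ j) (hφp j)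
      have h2 := lintegral_mul_sq_le_energy hs0 hsQ hsob hfV.aemeasurable hη.measurable hηp
      have h3 : Measurable fun x => ENNReal.ofReal |V x| * ENNReal.ofReal (φ j x ^ 2) :=
        hfV.mul ((hφ j).pow_const 2).ennreal_ofReal
      calc _ ≤ ∫⁻ x, (2 * (ENNReal.ofReal |V x| * ENNReal.ofReal (φ j x ^ 2)) +
            2 * (ENNReal.ofReal |V x| * ENNReal.ofReal (η x ^ 2))) ∂μ := by
            refine lintegral_mono fun x => ?_
            rw [← ENNReal.ofReal_ofNat 2, ← ENNReal.ofReal_mul (abs_nonneg _),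
              ← ENNReal.ofReal_mul (abs_nonneg _), ← ENNReal.ofReal_mul (by norm_num),
              ← ENNReal.ofReal_mul (by norm_num),
              ← ENNReal.ofReal_add (by positivity) (by positivity)]
            apply ENNReal.ofReal_le_ofReal
            rw [mul_pow, hsqrtV]
            have h4 : vj j x ^ 2 ≤ 2 * φ j x ^ 2 + 2 * η x ^ 2 := by
              have h5 : softPos k (ε j) (φ j x) ≤ |φ j x| + 1 :=
                (softPos_le hk (hε0 j).le _).trans (by linarith [hε1 j])
              have h6 := softPos_nonneg k (ε j) (φ j x)
              have h7 : softPos k (ε j) (φ j x) ^ 2 ≤ 2 * φ j x ^ 2 + 2 := by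
                calc _ ≤ (|φ j x| + 1) ^ 2 := by gcongr
                  _ ≤ 2 * φ j x ^ 2 + 2 := by
                    rw [← sq_abs (φ j x)]
                    nlinarith [sq_nonneg (|φ j x| - 1)]
              have h8 : η x ^ 2 * η x ^ 2 ≤ η x ^ 2 :=
                mul_le_of_le_one_left (sq_nonneg _) (hη2 x)
              calc vj j x ^ 2 = softPos k (ε j) (φ j x) ^ 2 * (η x ^ 2 * η x ^ 2) := by
                    simp only [hvj]
                    ring
                _ ≤ (2 * φ j x ^ 2 + 2) * η x ^ 2 := by gcongr
                _ = 2 * φ j x ^ 2 * η x ^ 2 + 2 * η x ^ 2 := by ring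
                _ ≤ 2 * φ j x ^ 2 * 1 + 2 * η x ^ 2 := by
                    gcongr
                    exact hη2 x
                _ = _ := by ring
            calc |V x| * vj j x ^ 2 ≤ |V x| * (2 * φ j x ^ 2 + 2 * η x ^ 2) := by gcongr
              _ = _ := by ring
        _ = 2 * (∫⁻ x, ENNReal.ofReal |V x| * ENNReal.ofReal (φ j x ^ 2) ∂μ) +
            2 * ∫⁻ x, ENNReal.ofReal |V x| * ENNReal.ofReal (η x ^ 2) ∂μ := by
            rw [lintegral_add_left (h3.const_mul _), lintegral_const_mul' _ _ (by simp),
              lintegral_const_mul' _ _ (by simp)]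
        _ ≤ _ := by
            gcongr
            · refine h1.trans ?_
              gcongr
              exact hφM j)
    (by
      filter_upwards [hvlim] with x hx
      exact hx.const_mul _)
  simp_rw [hVsplit] at hI₂ hT₂
  have hweak : ∫ z : X × X, (u z.1 - u z.2) * (v z.1 - v z.2) / d z.1 z.2 ^ q ∂(μ.prod μ) ≤
      ∫ x, V x * u x * v x ∂μ :=
    le_of_tendsto_of_tendsto' hT₁ hT₂ fun j => hsub k (ε j) hk (hε0 j) j
  set b : X × X → ℝ := fun z => w z.1 * w z.2 * (η z.1 - η z.2) ^ 2 / d z.1 z.2 ^ q with hb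
  have hb0 : ∀ z, 0 ≤ b z := fun z => div_nonneg
    (mul_nonneg (mul_nonneg (hw0 _) (hw0 _)) (sq_nonneg _)) (Real.rpow_nonneg (h.nonneg _ _) _)
  have hbm : Measurable b :=
    (((hwm.comp measurable_fst).mul (hwm.comp measurable_snd)).mul
      (((hη.measurable.comp measurable_fst).sub
        (hη.measurable.comp measurable_snd)).pow_const 2)).div (h.measurable_dist.pow_const q)
  -- If the nonlocal term is infinite there is nothing to prove. Otherwise `b` is integrable and may
  -- be added inside the Bochner integral.
  rcases eq_or_ne (∫⁻ z, ENNReal.ofReal (b z) ∂(μ.prod μ)) ⊤ with hbt | hbt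
  · change _ ≤ _ + ∫⁻ z, ENNReal.ofReal (b z) ∂(μ.prod μ)
    rw [hbt, add_top]
    exact le_top
  have hbI : Integrable b (μ.prod μ) := (lintegral_ofReal_ne_top_iff_integrable
    hbm.aestronglyMeasurable (Eventually.of_forall hb0)).1 hbt
  -- An algebraic identity reduces this to replacing `w x - w y` by `u x - u y` against `v x - v y`.
  -- The two differences agree when both values are above `k`. If only one is, the change has the
  -- favourable sign.
  have hpt : ∀ z : X × X, (w z.1 * η z.1 - w z.2 * η z.2) ^ 2 / d z.1 z.2 ^ q ≤
      (u z.1 - u z.2) * (v z.1 - v z.2) / d z.1 z.2 ^ q + b z := by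
    rintro ⟨x, y⟩
    have hd : 0 ≤ d x y ^ q := Real.rpow_nonneg (h.nonneg _ _) _
    simp only [hb, hv]
    rw [← add_div]
    gcongr
    have h1 : (w x * η x - w y * η y) ^ 2 = (w x - w y) * (w x * η x ^ 2 - w y * η y ^ 2) +
      w x * w y * (η x - η y) ^ 2 := by ring
    rw [h1]
    gcongr ?_ + _
    simp only [hw]
    rcases le_total (u x) k with hx | hx <;> rcases le_total (u y) k with hy | hy
    · simp [max_eq_right (sub_nonpos.2 hx), max_eq_right (sub_nonpos.2 hy)]
    · rw [max_eq_right (sub_nonpos.2 hx), max_eq_left (sub_nonneg.2 hy)]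
      have : 0 ≤ (u y - k) * η y ^ 2 := mul_nonneg (by linarith) (sq_nonneg _)
      nlinarith
    · rw [max_eq_left (sub_nonneg.2 hx), max_eq_right (sub_nonpos.2 hy)]
      have : 0 ≤ (u x - k) * η x ^ 2 := mul_nonneg (by linarith) (sq_nonneg _)
      nlinarith
    · rw [max_eq_left (sub_nonneg.2 hx), max_eq_left (sub_nonneg.2 hy), sub_sub_sub_cancel_right]
  have hpos : ∀ z : X × X, 0 ≤ (u z.1 - u z.2) * (v z.1 - v z.2) / d z.1 z.2 ^ q + b z := fun z =>
    le_trans (div_nonneg (sq_nonneg _) (Real.rpow_nonneg (h.nonneg _ _) _)) (hpt z)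
  have hVuv : ∫ x, V x * u x * v x ∂μ ≤ ∫ x, |V x| * (u x * w x * η x ^ 2) ∂μ := by
    have hv0 : ∀ x, 0 ≤ v x := fun x => mul_nonneg (hw0 x) (sq_nonneg _)
    have e : ∀ x, |V x * u x * v x| = |V x| * (u x * w x * η x ^ 2) := fun x => by
      rw [abs_mul, abs_mul, abs_of_nonneg (hu0 x), abs_of_nonneg (hv0 x)]
      simp only [hv]
      ring
    simp_rw [← e]
    exact integral_mono hI₂ hI₂.abs fun x => le_abs_self _
  have hVI : Integrable (fun x => |V x| * (u x * w x * η x ^ 2)) μ := by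
    have hv0 : ∀ x, 0 ≤ v x := fun x => mul_nonneg (hw0 x) (sq_nonneg _)
    refine hI₂.abs.congr (Eventually.of_forall fun x => ?_)
    simp only
    rw [abs_mul, abs_mul, abs_of_nonneg (hu0 x), abs_of_nonneg (hv0 x)]
    simp only [hv]
    ring
  calc fracEnergy μ d q (fun x => w x * η x) ≤ ∫⁻ z : X × X, ENNReal.ofReal
        ((u z.1 - u z.2) * (v z.1 - v z.2) / d z.1 z.2 ^ q + b z) ∂(μ.prod μ) :=
        lintegral_mono fun z => ENNReal.ofReal_le_ofReal (hpt z)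
    _ = ENNReal.ofReal (∫ z : X × X, ((u z.1 - u z.2) * (v z.1 - v z.2) / d z.1 z.2 ^ q + b z)
        ∂(μ.prod μ)) :=
        (ofReal_integral_eq_lintegral_ofReal (hI₁.add hbI) (Eventually.of_forall hpos)).symm
    _ ≤ ENNReal.ofReal (∫ x, |V x| * (u x * w x * η x ^ 2) ∂μ + ∫ z, b z ∂(μ.prod μ)) := by
        rw [integral_add hI₁ hbI]
        apply ENNReal.ofReal_le_ofReal
        linarith
    _ ≤ ENNReal.ofReal (∫ x, |V x| * (u x * w x * η x ^ 2) ∂μ) +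
        ENNReal.ofReal (∫ z, b z ∂(μ.prod μ)) := ENNReal.ofReal_add_le
    _ = _ := by
        rw [ofReal_integral_eq_lintegral_ofReal hVI (Eventually.of_forall fun x =>
          mul_nonneg (abs_nonneg _) (mul_nonneg (mul_nonneg (hu0 x) (hw0 x)) (sq_nonneg _))),
          ofReal_integral_eq_lintegral_ofReal hbI (Eventually.of_forall hb0)]

end IsAhlforsRegular
end

/-! ### Exponential coordinates, left invariance of the measure, and the homogeneous norm. -/

noncomputable section

namespace HomogeneousGroup

variable {n : ℕ} {E G : Type*} [NormedAddCommGroup E] [NormedSpace ℝ E]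
  [Group G] [TopologicalSpace G] [ChartedSpace E G]

/-- The exponential coordinates with respect to the basis of the Lie algebra. -/
def expCoord (H : HomogeneousGroup n E G) :
    Diffeomorph 𝓘(ℝ, Fin (n + 1) → ℝ) 𝓘(ℝ, E) (Fin (n + 1) → ℝ) G ∞ :=
  Diffeomorph.trans (H.basis.equivFunL.symm.toDiffeomorph) H.exp

lemma expCoord_apply (H : HomogeneousGroup n E G) (x : Fin (n + 1) → ℝ) :
    H.expCoord x = H.exp (∑ j, x j • H.basis j) := by
  change H.exp (H.basis.equivFun.symm x) = _
  rw [Module.Basis.equivFun_symm_apply]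

lemma haar_eq_map [MeasurableSpace G] (H : HomogeneousGroup n E G) :
    H.haar = Measure.map H.expCoord volume := by
  unfold haar
  congr 1
  ext x
  rw [expCoord_apply]

lemma exp_zero (H : HomogeneousGroup n E G) : H.exp 0 = 1 := by
  have h := H.exp_add_smul 0 0 0
  simpa using h

lemma expCoord_zero (H : HomogeneousGroup n E G) : H.expCoord 0 = 1 := by
  rw [expCoord_apply]
  simp [H.exp_zero]

lemma secondCountableTopology (H : HomogeneousGroup n E G) : SecondCountableTopology G :=
  H.expCoord.toHomeomorph.symm.secondCountableTopology

lemma t2Space (H : HomogeneousGroup n E G) : T2Space G :=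
  H.expCoord.toHomeomorph.t2Space

lemma weight_pos (H : HomogeneousGroup n E G) (j : Fin (n + 1)) : 1 ≤ H.weight j :=
  H.weight_zero ▸ H.weight_mono (Fin.zero_le j)

/-- The dilations in exponential coordinates. -/
def coordDilation (H : HomogeneousGroup n E G) (r : ℝ) :
    (Fin (n + 1) → ℝ) →ₗ[ℝ] (Fin (n + 1) → ℝ) :=
  Matrix.toLin' (Matrix.diagonal fun j => r ^ H.weight j)

lemma coordDilation_apply (H : HomogeneousGroup n E G) (r : ℝ) (x : Fin (n + 1) → ℝ)
    (j : Fin (n + 1)) : H.coordDilation r x j = r ^ H.weight j * x j := by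
  simp [coordDilation, Matrix.mulVec_diagonal]

lemma det_coordDilation (H : HomogeneousGroup n E G) {r : ℝ} (hr : 0 < r) :
    LinearMap.det (H.coordDilation r) = r ^ H.homDim := by
  rw [coordDilation, LinearMap.det_toLin', Matrix.det_diagonal, homDim, Real.rpow_sum_of_pos hr]

lemma dilation_expCoord (H : HomogeneousGroup n E G) {r : ℝ} (hr : 0 < r)
    (x : Fin (n + 1) → ℝ) : H.dilation r (H.expCoord x) = H.expCoord (H.coordDilation r x) := by
  rw [expCoord_apply, expCoord_apply, dilation, Diffeomorph.symm_apply_apply, map_sum]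
  congr 1
  refine Finset.sum_congr rfl fun j _ => ?_
  rw [map_smul, H.algDilation_basis r hr, coordDilation_apply, smul_smul, mul_comm]

/-- The group multiplication in exponential coordinates. -/
def coordMul (H : HomogeneousGroup n E G) (p : (Fin (n + 1) → ℝ) × (Fin (n + 1) → ℝ)) :
    Fin (n + 1) → ℝ :=
  H.expCoord.symm (H.expCoord p.1 * H.expCoord p.2)

lemma contMDiff_expCoord_mul [LieGroup 𝓘(ℝ, E) ∞ G] (H : HomogeneousGroup n E G) :
    ContMDiff 𝓘(ℝ, (Fin (n + 1) → ℝ) × (Fin (n + 1) → ℝ)) 𝓘(ℝ, E) ∞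
      fun p : (Fin (n + 1) → ℝ) × (Fin (n + 1) → ℝ) => H.expCoord p.1 * H.expCoord p.2 :=
  ContMDiff.mul (H.expCoord.contMDiff.comp contDiff_fst.contMDiff)
    (H.expCoord.contMDiff.comp contDiff_snd.contMDiff)

lemma contDiff_coordMul [LieGroup 𝓘(ℝ, E) ∞ G] (H : HomogeneousGroup n E G) :
    ContDiff ℝ ∞ H.coordMul :=
  (H.expCoord.symm.contMDiff.comp H.contMDiff_expCoord_mul).contDiff

lemma coordMul_coordDilation (H : HomogeneousGroup n E G) {r : ℝ} (hr : 0 < r)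
    (a x : Fin (n + 1) → ℝ) :
    H.coordMul (H.coordDilation r a, H.coordDilation r x) =
      H.coordDilation r (H.coordMul (a, x)) := by
  unfold coordMul
  apply H.expCoord.injective
  change H.expCoord _ = H.expCoord _
  rw [Diffeomorph.apply_symm_apply, ← H.dilation_expCoord hr, ← H.dilation_expCoord hr,
    ← H.dilation_expCoord hr, Diffeomorph.apply_symm_apply]
  exact (H.exp_algDilation_mul r hr _ _).symm

lemma coordMul_zero_left (H : HomogeneousGroup n E G) (x : Fin (n + 1) → ℝ) :
    H.coordMul (0, x) = x := by
  simp [coordMul, H.expCoord_zero]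

/-- The derivative of a left translation in exponential coordinates. -/
def leftDeriv (H : HomogeneousGroup n E G) (p : (Fin (n + 1) → ℝ) × (Fin (n + 1) → ℝ)) :
    (Fin (n + 1) → ℝ) →L[ℝ] (Fin (n + 1) → ℝ) :=
  (fderiv ℝ H.coordMul p).comp (ContinuousLinearMap.inr ℝ _ _)

lemma hasFDerivAt_coordMul [LieGroup 𝓘(ℝ, E) ∞ G] (H : HomogeneousGroup n E G)
    (a x : Fin (n + 1) → ℝ) :
    HasFDerivAt (fun y => H.coordMul (a, y)) (H.leftDeriv (a, x)) x :=
  (H.contDiff_coordMul.differentiable (by simp) (a, x)).hasFDerivAt.comp x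
    (hasFDerivAt_prodMk_right a x)

lemma continuous_leftDeriv [LieGroup 𝓘(ℝ, E) ∞ G] (H : HomogeneousGroup n E G) :
    Continuous H.leftDeriv :=
  (H.contDiff_coordMul.continuous_fderiv (by simp)).clm_comp continuous_const

/-- Differentiating the relation that dilations are automorphisms puts `det δ_r` on both sides,
where it cancels. -/
lemma det_leftDeriv_coordDilation [LieGroup 𝓘(ℝ, E) ∞ G] (H : HomogeneousGroup n E G) {r : ℝ}
    (hr : 0 < r) (a x : Fin (n + 1) → ℝ) :
    (H.leftDeriv (H.coordDilation r a, H.coordDilation r x)).det = (H.leftDeriv (a, x)).det := by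
  set D := LinearMap.toContinuousLinearMap (H.coordDilation r) with hD
  have h1 : HasFDerivAt (fun y => H.coordMul (H.coordDilation r a, H.coordDilation r y))
      ((H.leftDeriv (H.coordDilation r a, H.coordDilation r x)).comp D) x :=
    (H.hasFDerivAt_coordMul (H.coordDilation r a) (H.coordDilation r x)).comp x D.hasFDerivAt
  have h2 : HasFDerivAt (fun y => H.coordMul (H.coordDilation r a, H.coordDilation r y))
      (D.comp (H.leftDeriv (a, x))) x := by
    simp_rw [H.coordMul_coordDilation hr]
    exact D.hasFDerivAt.comp x (H.hasFDerivAt_coordMul a x)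
  have h3 := congrArg ContinuousLinearMap.det (h1.unique h2)
  have hdet : LinearMap.det (H.coordDilation r) ≠ 0 := by
    rw [H.det_coordDilation hr]
    positivity
  have h4 : ∀ A B : (Fin (n + 1) → ℝ) →L[ℝ] (Fin (n + 1) → ℝ),
      (A.comp B).det = A.det * B.det := fun A B =>
    LinearMap.det_comp (A : (Fin (n + 1) → ℝ) →ₗ[ℝ] (Fin (n + 1) → ℝ)) B
  rw [h4, h4, mul_comm] at h3
  exact mul_left_cancel₀ hdet h3

lemma tendsto_coordDilation (H : HomogeneousGroup n E G) (x : Fin (n + 1) → ℝ) :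
    Tendsto (fun k : ℕ => H.coordDilation (1 / ((k : ℝ) + 1)) x) atTop (𝓝 0) := by
  rw [tendsto_pi_nhds]
  intro j
  simp_rw [coordDilation_apply]
  have hw : 0 < H.weight j := by linarith [H.weight_pos j]
  have h1 := (tendsto_one_div_add_atTop_nhds_zero_nat (𝕜 := ℝ)).rpow_const
    (p := H.weight j) (Or.inr hw.le)
  rw [Real.zero_rpow hw.ne'] at h1
  simpa using h1.mul_const (x j)

/-- Left translations have Jacobian one in exponential coordinates. -/
lemma det_leftDeriv [LieGroup 𝓘(ℝ, E) ∞ G] (H : HomogeneousGroup n E G)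
    (a x : Fin (n + 1) → ℝ) : (H.leftDeriv (a, x)).det = 1 := by
  have h0 : H.leftDeriv (0, 0) = ContinuousLinearMap.id ℝ _ := by
    have h1 := H.hasFDerivAt_coordMul 0 0
    simp_rw [H.coordMul_zero_left] at h1
    exact h1.unique (hasFDerivAt_id 0)
  -- The determinant is continuous and constant along dilation orbits. Contracting to the origin,
  -- where translation is the identity, gives the value one. No triangular form of the group law is
  -- needed.
  have h1 : Tendsto (fun k : ℕ => (H.leftDeriv (H.coordDilation (1 / ((k : ℝ) + 1)) a,
      H.coordDilation (1 / ((k : ℝ) + 1)) x)).det) atTop (𝓝 (H.leftDeriv (0, 0)).det) :=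
    ((ContinuousLinearMap.continuous_det.comp H.continuous_leftDeriv).tendsto (0, 0)).comp
      ((H.tendsto_coordDilation a).prodMk_nhds (H.tendsto_coordDilation x))
  have h2 : ∀ k : ℕ, (H.leftDeriv (H.coordDilation (1 / ((k : ℝ) + 1)) a,
      H.coordDilation (1 / ((k : ℝ) + 1)) x)).det = (H.leftDeriv (a, x)).det := fun k =>
    H.det_leftDeriv_coordDilation (by positivity) a x
  simp_rw [h2] at h1
  rw [tendsto_nhds_unique tendsto_const_nhds h1, h0]
  exact LinearMap.det_id

/-- The homogeneous norm controls the exponential coordinates. -/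
lemma exists_abs_coord_le (H : HomogeneousGroup n E G) {N : G → ℝ}
    (hN : H.IsHomogeneousNorm N) :
    ∃ c₀ : ℝ, 0 < c₀ ∧ ∀ (x : Fin (n + 1) → ℝ) (j : Fin (n + 1)),
      |x j| ≤ (N (H.expCoord x) / c₀) ^ H.weight j := by
  have hcont : Continuous fun x => N (H.expCoord x) := hN.continuous.comp H.expCoord.continuous
  have hne : (Metric.sphere (0 : Fin (n + 1) → ℝ) 1).Nonempty :=
    NormedSpace.sphere_nonempty.2 zero_le_one
  obtain ⟨x₁, hx₁, hmin⟩ := (isCompact_sphere (0 : Fin (n + 1) → ℝ) 1).exists_isMinOn hne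
    hcont.continuousOn
  have hx₁0 : x₁ ≠ 0 := by
    rintro rfl
    simp at hx₁
  have hpos : 0 < N (H.expCoord x₁) := by
    refine lt_of_le_of_ne (hN.nonneg _) fun h0 => hx₁0 ?_
    have h1 := (hN.eq_zero_iff _).1 h0.symm
    rw [← H.expCoord_zero] at h1
    exact H.expCoord.injective h1
  refine ⟨N (H.expCoord x₁), hpos, fun x j => ?_⟩
  have hw : ∀ j, 0 < H.weight j := fun j => by linarith [H.weight_pos j]
  -- `t = max |x_j|^(1/d_j)` is itself homogeneous of degree one. Dilating by `t⁻¹` puts `x` on the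
  -- unit sphere of the supremum norm, where `N` has a positive minimum.
  obtain ⟨j₀, -, hj₀⟩ := Finset.exists_max_image Finset.univ
    (fun j => |x j| ^ (1 / H.weight j)) Finset.univ_nonempty
  set t := |x j₀| ^ (1 / H.weight j₀) with ht
  have hxt : ∀ j, |x j| ≤ t ^ H.weight j := fun j => by
    have h1 := hj₀ j (Finset.mem_univ j)
    have h2 := Real.rpow_le_rpow (by positivity) h1 (hw j).le
    rwa [← Real.rpow_mul (abs_nonneg _), one_div_mul_cancel (hw j).ne', Real.rpow_one] at h2
  have hxt₀ : |x j₀| = t ^ H.weight j₀ := by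
    rw [ht, ← Real.rpow_mul (abs_nonneg _), one_div_mul_cancel (hw j₀).ne', Real.rpow_one]
  have ht0 : 0 ≤ t := by positivity
  suffices htN : t ≤ N (H.expCoord x) / N (H.expCoord x₁) from
    (hxt j).trans (Real.rpow_le_rpow ht0 htN (hw j).le)
  rcases ht0.eq_or_lt with h0 | h0
  · rw [← h0]
    exact div_nonneg (hN.nonneg _) (hN.nonneg _)
  rw [le_div_iff₀ hpos]
  have hmem : H.coordDilation t⁻¹ x ∈ Metric.sphere (0 : Fin (n + 1) → ℝ) 1 := by
    have habs : ∀ j, |H.coordDilation t⁻¹ x j| = |x j| / t ^ H.weight j := fun j => by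
      rw [coordDilation_apply, abs_mul, Real.inv_rpow ht0, abs_of_nonneg (by positivity)]
      ring
    rw [mem_sphere_zero_iff_norm]
    apply le_antisymm
    · refine (pi_norm_le_iff_of_nonneg zero_le_one).2 fun j => ?_
      rw [Real.norm_eq_abs, habs, div_le_one (by positivity)]
      exact hxt j
    · calc (1 : ℝ) = |H.coordDilation t⁻¹ x j₀| := by
            rw [habs, hxt₀, div_self (by positivity)]
        _ ≤ _ := norm_le_pi_norm (H.coordDilation t⁻¹ x) j₀
  have h1 := hmin hmem
  simp only [Set.mem_ofPred_eq] at h1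
  rw [← H.dilation_expCoord (by positivity), hN.dilation _ (by positivity),
    le_inv_mul_iff₀ h0] at h1
  exact h1

variable [MeasurableSpace G] [BorelSpace G]

lemma haar_apply (H : HomogeneousGroup n E G) {S : Set G} (hS : MeasurableSet S) :
    H.haar S = volume (H.expCoord ⁻¹' S) := by
  rw [haar_eq_map, Measure.map_apply H.expCoord.continuous.measurable hS]

instance (H : HomogeneousGroup n E G) : SFinite H.haar := by
  rw [haar_eq_map]
  infer_instance

/-- The measure `H.haar` is left invariant. -/
lemma haar_preimage_mul [LieGroup 𝓘(ℝ, E) ∞ G] (H : HomogeneousGroup n E G) (g : G) {S : Set G}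
    (hS : MeasurableSet S) : H.haar ((fun h => g⁻¹ * h) ⁻¹' S) = H.haar S := by
  have : IsTopologicalGroup G := topologicalGroup_of_lieGroup 𝓘(ℝ, E) ∞
  have hm : Measurable fun h : G => g⁻¹ * h := (continuous_const_mul g⁻¹).measurable
  rw [H.haar_apply (hm hS), H.haar_apply hS]
  set a := H.expCoord.symm g with ha
  have hga : g = H.expCoord a := by rw [ha, Diffeomorph.apply_symm_apply]
  -- The preimage under translation by `g⁻¹` is the image under translation by `g`, to which the
  -- change of variables formula applies.
  have himg : H.expCoord ⁻¹' ((fun h => g⁻¹ * h) ⁻¹' S) =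
      (fun y => H.coordMul (a, y)) '' (H.expCoord ⁻¹' S) := by
    ext x
    simp only [Set.mem_preimage, Set.mem_image]
    constructor
    · intro hx
      refine ⟨H.expCoord.symm (g⁻¹ * H.expCoord x), ?_, ?_⟩
      · rwa [Diffeomorph.apply_symm_apply]
      · simp [coordMul, ← hga]
    · rintro ⟨y, hy, rfl⟩
      simpa [coordMul, ← hga] using hy
  have hinj : Function.Injective fun y => H.coordMul (a, y) := by
    intro y y' hyy
    simp only [coordMul] at hyy
    exact H.expCoord.injective (mul_left_cancel (H.expCoord.symm.injective hyy))
  rw [himg, ← lintegral_abs_det_fderiv_eq_addHaar_image volume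
    (H.expCoord.continuous.measurable hS)
    (fun x _ => (H.hasFDerivAt_coordMul a x).hasFDerivWithinAt) hinj.injOn]
  simp [H.det_leftDeriv]

lemma haar_dilation (H : HomogeneousGroup n E G) {N : G → ℝ} (hN : H.IsHomogeneousNorm N) {r : ℝ}
    (hr : 0 < r) :
    H.haar {g | N g < r} = ENNReal.ofReal (r ^ H.homDim) * H.haar {g | N g < 1} := by
  have hms : ∀ r, MeasurableSet {g | N g < r} := fun r =>
    (isOpen_lt hN.continuous continuous_const).measurableSet
  rw [H.haar_apply (hms r), H.haar_apply (hms 1)]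
  have himg : H.expCoord ⁻¹' {g | N g < r} =
      H.coordDilation r '' (H.expCoord ⁻¹' {g | N g < 1}) := by
    ext x
    simp only [Set.mem_preimage, Set.mem_image, Set.mem_ofPred_eq]
    constructor
    · intro hx
      refine ⟨H.coordDilation r⁻¹ x, ?_, ?_⟩
      · rw [← H.dilation_expCoord (by positivity), hN.dilation _ (by positivity),
          inv_mul_lt_iff₀ hr]
        simpa using hx
      · ext j
        rw [coordDilation_apply, coordDilation_apply, ← mul_assoc,
          ← Real.mul_rpow hr.le (by positivity), mul_inv_cancel₀ hr.ne', Real.one_rpow, one_mul]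
    · rintro ⟨y, hy, rfl⟩
      rw [← H.dilation_expCoord hr, hN.dilation r hr]
      nlinarith
  rw [himg, Measure.addHaar_image_linearMap, H.det_coordDilation hr, abs_of_pos (by positivity)]

end HomogeneousGroup
end

/-! ### Test functions, cutoffs and Ahlfors regularity on the group. -/

noncomputable section

/-- The transition factors through the projection onto `[0, 1]`, and on this compact convex set a
`C¹` function is Lipschitz. -/
lemma exists_lipschitz_smoothTransition :
    ∃ K : ℝ, 0 ≤ K ∧ ∀ a b : ℝ, |Real.smoothTransition a - Real.smoothTransition b| ≤ K * |a - b| := by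
  obtain ⟨K, hK⟩ := (Real.smoothTransition.contDiff (n := 1)).contDiffOn.exists_lipschitzOnWith
    (by simp) (convex_Icc (0 : ℝ) 1) isCompact_Icc
  refine ⟨K, K.2, fun a b => ?_⟩
  have h1 := hK.dist_le_mul _ (Set.projIcc 0 1 zero_le_one a).2 _ (Set.projIcc 0 1 zero_le_one b).2
  rw [Real.smoothTransition.projIcc, Real.smoothTransition.projIcc, Real.dist_eq] at h1
  refine h1.trans (mul_le_mul_of_nonneg_left ?_ K.2)
  have h2 := (LipschitzWith.projIcc (zero_le_one (α := ℝ))).dist_le_mul a b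
  simpa [Real.dist_eq, Subtype.dist_eq] using h2

namespace HomogeneousGroup

/-- The smoothed truncation does not vanish where `φ` does, so compactness of the support comes from
`η` alone. -/
lemma isTestFunction_softPos_mul {E G : Type*} [NormedAddCommGroup E]
    [NormedSpace ℝ E] [TopologicalSpace G] [ChartedSpace E G] {φ η : G → ℝ} (hφ : IsTestFunction E φ)
    (hη : IsTestFunction E η) (k : ℝ) {ε : ℝ} (hε : 0 < ε) :
    IsTestFunction E fun g => softPos k ε (φ g) * η g ^ 2 := by
  constructor
  · have h1 : ContMDiff 𝓘(ℝ, E) 𝓘(ℝ, ℝ) ∞ fun g => softPos k ε (φ g) :=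
      (contDiff_softPos k hε).contMDiff.comp hφ.1
    have h2 : ContMDiff 𝓘(ℝ, E) 𝓘(ℝ, ℝ) ∞ fun g => η g ^ 2 :=
      (contDiff_id.pow 2).contMDiff.comp hη.1
    exact h1.smul h2
  · have h1 : HasCompactSupport fun g => η g ^ 2 := hη.2.comp_left (g := fun t => t ^ 2) (by simp)
    exact h1.mul_left

variable {n : ℕ} {E G : Type*} [NormedAddCommGroup E] [NormedSpace ℝ E]
  [Group G] [TopologicalSpace G] [ChartedSpace E G]

lemma homDim_pos (H : HomogeneousGroup n E G) : 0 < H.homDim :=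
  Finset.sum_pos (fun j _ => by linarith [H.weight_pos j]) Finset.univ_nonempty

lemma isCompact_norm_le (H : HomogeneousGroup n E G) {N : G → ℝ} (hN : H.IsHomogeneousNorm N)
    (ρ : ℝ) : IsCompact {g | N g ≤ ρ} := by
  obtain ⟨c₀, hc₀, hco⟩ := H.exists_abs_coord_le hN
  have himg : {g | N g ≤ ρ} = H.expCoord '' (H.expCoord ⁻¹' {g | N g ≤ ρ}) :=
    (Set.image_preimage_eq _ H.expCoord.surjective).symm
  rw [himg]
  refine IsCompact.image ?_ H.expCoord.continuous
  refine (isCompact_Icc (a := fun j => -(ρ / c₀) ^ H.weight j)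
    (b := fun j => (ρ / c₀) ^ H.weight j)).of_isClosed_subset
    ((isClosed_le hN.continuous continuous_const).preimage H.expCoord.continuous) fun x hx => ?_
  have hx' : N (H.expCoord x) ≤ ρ := hx
  have hb : ∀ j, |x j| ≤ (ρ / c₀) ^ H.weight j := fun j => (hco x j).trans
    (Real.rpow_le_rpow (div_nonneg (hN.nonneg _) hc₀.le) (by gcongr)
      (by linarith [H.weight_pos j]))
  exact ⟨fun j => (abs_le.1 (hb j)).1, fun j => (abs_le.1 (hb j)).2⟩

lemma contMDiff_mul_const_left [LieGroup 𝓘(ℝ, E) ∞ G] (g : G) :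
    ContMDiff 𝓘(ℝ, E) 𝓘(ℝ, E) ∞ fun h : G => g * h :=
  ContMDiff.mul contMDiff_const contMDiff_id

open scoped Pointwise in
/-- Test functions are Lipschitz with respect to the homogeneous norm. -/
lemma exists_sq_sub_le_of_isTestFunction [LieGroup 𝓘(ℝ, E) ∞ G] (H : HomogeneousGroup n E G)
    {N : G → ℝ} (hN : H.IsHomogeneousNorm N) {φ : G → ℝ} (hφ : IsTestFunction E φ) :
    ∃ A : ℝ, 0 ≤ A ∧ ∀ g h, (φ g - φ h) ^ 2 ≤ A * min 1 ((N (g⁻¹ * h) / 1) ^ 2) := by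
  have : IsTopologicalGroup G := topologicalGroup_of_lieGroup 𝓘(ℝ, E) ∞
  obtain ⟨c₀, hc₀, hco⟩ := H.exists_abs_coord_le hN
  obtain ⟨S, hS⟩ := hφ.2.exists_bound_of_continuous hφ.1.continuous
  have hS0 : 0 ≤ S := (norm_nonneg _).trans (hS 1)
  set Ψ : (Fin (n + 1) → ℝ) × (Fin (n + 1) → ℝ) → ℝ :=
    fun p => φ (H.expCoord p.1 * H.expCoord p.2) with hΨ
  have hΨd : ContDiff ℝ ∞ Ψ := (hφ.1.comp H.contMDiff_expCoord_mul).contDiff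
  set B₁ := H.expCoord '' Metric.closedBall 0 1 with hB₁
  have hB₁c : IsCompact B₁ := (isCompact_closedBall _ _).image H.expCoord.continuous
  have hKc : IsCompact (H.expCoord.symm '' (tsupport φ * B₁⁻¹)) :=
    (hφ.2.mul hB₁c.inv).image H.expCoord.symm.continuous
  -- With `h = g * exp y` and `y` in the unit ball, both values of `φ` vanish unless the coordinates
  -- of `g` lie in a fixed ball. Hence one Lipschitz constant serves all `g`.
  obtain ⟨R₀, hR₀⟩ := hKc.isBounded.subset_closedBall 0
  obtain ⟨K, hK⟩ := hΨd.contDiffOn.exists_lipschitzOnWith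
    (s := Metric.closedBall 0 R₀ ×ˢ Metric.closedBall 0 1) (by simp)
    ((convex_closedBall _ _).prod (convex_closedBall _ _))
    ((isCompact_closedBall _ _).prod (isCompact_closedBall _ _))
  have hout : ∀ x y : Fin (n + 1) → ℝ, x ∉ Metric.closedBall 0 R₀ →
      y ∈ Metric.closedBall 0 1 → Ψ (x, y) = 0 := by
    intro x y hx hy
    refine image_eq_zero_of_notMem_tsupport (f := φ) fun hmem => ?_
    apply hx
    apply hR₀
    refine ⟨H.expCoord x, ⟨_, hmem, (H.expCoord y)⁻¹, ?_, ?_⟩, ?_⟩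
    · exact Set.inv_mem_inv.2 ⟨y, hy, rfl⟩
    · simp
    · simp
  have hlip : ∀ x y : Fin (n + 1) → ℝ, y ∈ Metric.closedBall 0 1 →
      |Ψ (x, 0) - Ψ (x, y)| ≤ K * ‖y‖ := by
    intro x y hy
    have h0 : (0 : Fin (n + 1) → ℝ) ∈ Metric.closedBall (0 : Fin (n + 1) → ℝ) 1 :=
      Metric.mem_closedBall_self zero_le_one
    by_cases hx : x ∈ Metric.closedBall 0 R₀
    · have h1 := hK.dist_le_mul (x, 0) ⟨hx, h0⟩ (x, y) ⟨hx, hy⟩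
      rw [Real.dist_eq, Prod.dist_eq, dist_self, max_eq_right dist_nonneg, dist_zero_left] at h1
      exact h1
    · rw [hout x 0 hx h0, hout x y hx hy, sub_zero, abs_zero]
      positivity
  set a := 2 * S + K / c₀ + 2 * S / c₀ with ha
  have hKc₀ : 0 ≤ (K : ℝ) / c₀ := by positivity
  have hSc₀ : 0 ≤ 2 * S / c₀ := by positivity
  have ha0 : 0 ≤ a := by positivity
  refine ⟨a ^ 2, by positivity, fun g h => ?_⟩
  set t := N (g⁻¹ * h) with ht
  have ht0 : 0 ≤ t := hN.nonneg _
  have h2S : |φ g - φ h| ≤ 2 * S := by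
    have h1 := hS g
    have h2 := hS h
    rw [Real.norm_eq_abs] at h1 h2
    have := abs_sub (φ g) (φ h)
    linarith
  have hA1 : |φ g - φ h| ≤ a := by linarith
  have hA2 : |φ g - φ h| ≤ a * t := by
    rcases le_or_gt t c₀ with hle | hgt
    · set y := H.expCoord.symm (g⁻¹ * h) with hy
      have hyt : ‖y‖ ≤ t / c₀ := by
        refine (pi_norm_le_iff_of_nonneg (by positivity)).2 fun j => ?_
        have h1 := hco y j
        rw [hy, Diffeomorph.apply_symm_apply, ← hy] at h1
        refine h1.trans ?_
        -- All weights are at least one, so near the identity the homogeneous norm dominates the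
        -- Euclidean size of the coordinates.
        calc (t / c₀) ^ H.weight j ≤ (t / c₀) ^ (1 : ℝ) :=
              Real.rpow_le_rpow_of_exponent_ge' (by positivity)
                ((div_le_one hc₀).2 hle) zero_le_one (H.weight_pos j)
          _ = t / c₀ := Real.rpow_one _
      have hy1 : y ∈ Metric.closedBall (0 : Fin (n + 1) → ℝ) 1 := by
        rw [mem_closedBall_zero_iff]
        exact hyt.trans ((div_le_one hc₀).2 hle)
      have h1 := hlip (H.expCoord.symm g) y hy1
      simp only [hΨ, hy, Diffeomorph.apply_symm_apply, H.expCoord_zero, mul_one,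
        mul_inv_cancel_left] at h1
      calc |φ g - φ h| ≤ K * ‖y‖ := h1
        _ ≤ K * (t / c₀) := by gcongr
        _ = K / c₀ * t := by ring
        _ ≤ a * t := by
          gcongr
          linarith
    · calc |φ g - φ h| ≤ 2 * S := h2S
        _ = 2 * S / c₀ * c₀ := by field_simp
        _ ≤ a * t := by
          gcongr
          linarith
  rw [div_one, mul_min_of_nonneg _ _ (by positivity), mul_one, ← mul_pow, le_min_iff,
    ← sq_abs (φ g - φ h)]
  exact ⟨by gcongr, by gcongr⟩

lemma abs_norm_sub_le (H : HomogeneousGroup n E G) {N : G → ℝ} (hN : H.IsHomogeneousNorm N)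
    (g₀ g h : G) : |N (g₀⁻¹ * g) - N (g₀⁻¹ * h)| ≤ N (g⁻¹ * h) := by
  rw [abs_le]
  have h1 := hN.mul_le (g₀⁻¹ * g) (g⁻¹ * h)
  have h2 := hN.mul_le (g₀⁻¹ * h) (h⁻¹ * g)
  have h3 : N (h⁻¹ * g) = N (g⁻¹ * h) := by
    rw [← hN.inv (g⁻¹ * h)]
    simp
  rw [show g₀⁻¹ * g * (g⁻¹ * h) = g₀⁻¹ * h by group] at h1
  rw [show g₀⁻¹ * h * (h⁻¹ * g) = g₀⁻¹ * g by group] at h2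
  constructor <;> linarith

/-- Smooth cutoff functions between concentric balls. -/
lemma exists_cutoff [LieGroup 𝓘(ℝ, E) ∞ G] [MeasurableSpace G] [BorelSpace G]
    (H : HomogeneousGroup n E G) {N : G → ℝ} (hN : H.IsHomogeneousNorm N) :
    ∃ L : ℝ, 0 < L ∧ ∀ (g₀ : G) (r ρ : ℝ), 0 < r → r < ρ →
      ∃ η, IsCutoff (fun g h => N (g⁻¹ * h)) L g₀ r ρ η ∧ IsTestFunction E η := by
  have : IsTopologicalGroup G := topologicalGroup_of_lieGroup 𝓘(ℝ, E) ∞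
  have : T2Space G := H.t2Space
  obtain ⟨K, hK0, hK⟩ := exists_lipschitz_smoothTransition
  refine ⟨K ^ 2 + 1, by positivity, fun g₀ r ρ hr hrρ => ?_⟩
  have hρr : 0 < ρ - r := by linarith
  set η : G → ℝ := fun g => 1 - Real.smoothTransition ((N (g₀⁻¹ * g) - r) / (ρ - r)) with hη
  have hNc : Continuous fun g => N (g₀⁻¹ * g) := hN.continuous.comp (continuous_const_mul _)
  have hsmooth : ContMDiff 𝓘(ℝ, E) 𝓘(ℝ, ℝ) ∞ η := by
    intro g
    -- `N` need not be smooth at the identity, but `η` is constant near `g₀`.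
    by_cases hg : g = g₀
    · have hev : η =ᶠ[𝓝 g] fun _ => 1 := by
        have hopen : IsOpen {h | N (g₀⁻¹ * h) < r} := isOpen_lt hNc continuous_const
        have hmem : g ∈ {h | N (g₀⁻¹ * h) < r} := by
          simp only [Set.mem_ofPred_eq, hg, inv_mul_cancel, (hN.eq_zero_iff 1).2 rfl]
          exact hr
        filter_upwards [hopen.mem_nhds hmem] with h hh
        have hh' : N (g₀⁻¹ * h) < r := hh
        simp only [hη]
        rw [Real.smoothTransition.zero_of_nonpos (div_nonpos_of_nonpos_of_nonneg (by linarith)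
          hρr.le), sub_zero]
      exact contMDiffAt_const.congr_of_eventuallyEq hev
    · have hne : g₀⁻¹ * g ∈ ({1}ᶜ : Set G) := by
        simp only [Set.mem_compl_iff, Set.mem_singleton_iff, inv_mul_eq_one]
        exact fun h => hg h.symm
      have h1 : ContMDiffAt 𝓘(ℝ, E) 𝓘(ℝ, ℝ) ∞ N (g₀⁻¹ * g) :=
        hN.smooth.contMDiffAt (isOpen_compl_singleton.mem_nhds hne)
      have h2 : ContMDiffAt 𝓘(ℝ, E) 𝓘(ℝ, ℝ) ∞ (fun h => N (g₀⁻¹ * h)) g :=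
        h1.comp g (contMDiff_mul_const_left (E := E) g₀⁻¹ g)
      have h3 : ContDiff ℝ ∞ fun t : ℝ => 1 - Real.smoothTransition ((t - r) / (ρ - r)) :=
        contDiff_const.sub (Real.smoothTransition.contDiff.comp
          ((contDiff_id.sub contDiff_const).div_const _))
      exact h3.contMDiff.contMDiffAt.comp g h2
  have hzero : ∀ g, ρ ≤ N (g₀⁻¹ * g) → η g = 0 := fun g hg => by
    simp only [hη]
    rw [Real.smoothTransition.one_of_one_le, sub_self]
    rw [one_le_div hρr]
    linarith
  refine ⟨η, ⟨hsmooth.continuous.measurable, fun g => ?_, fun g => ?_, fun g hg => ?_, hzero,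
    fun g h => ?_⟩, hsmooth, ?_⟩
  · simp only [hη]
    linarith [Real.smoothTransition.le_one ((N (g₀⁻¹ * g) - r) / (ρ - r))]
  · simp only [hη]
    linarith [Real.smoothTransition.nonneg ((N (g₀⁻¹ * g) - r) / (ρ - r))]
  · simp only [hη]
    rw [Real.smoothTransition.zero_of_nonpos (div_nonpos_of_nonpos_of_nonneg (by linarith)
      hρr.le), sub_zero]
  · set t := N (g⁻¹ * h) with ht
    have ht0 : 0 ≤ t := hN.nonneg _
    have h1 : |η g - η h| ≤ K * (t / (ρ - r)) := by
      simp only [hη]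
      rw [sub_sub_sub_cancel_left, abs_sub_comm]
      refine (hK _ _).trans ?_
      rw [← sub_div, sub_sub_sub_cancel_right, abs_div, abs_of_pos hρr]
      gcongr
      exact H.abs_norm_sub_le hN g₀ g h
    have h2 : |η g - η h| ≤ 1 := by
      simp only [hη]
      rw [abs_le]
      have a1 := Real.smoothTransition.nonneg ((N (g₀⁻¹ * g) - r) / (ρ - r))
      have a2 := Real.smoothTransition.nonneg ((N (g₀⁻¹ * h) - r) / (ρ - r))
      have a3 := Real.smoothTransition.le_one ((N (g₀⁻¹ * g) - r) / (ρ - r))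
      have a4 := Real.smoothTransition.le_one ((N (g₀⁻¹ * h) - r) / (ρ - r))
      constructor <;> linarith
    rw [mul_min_of_nonneg _ _ (by positivity), mul_one, le_min_iff, ← sq_abs (η g - η h)]
    constructor
    · calc |η g - η h| ^ 2 ≤ 1 ^ 2 := by gcongr
        _ ≤ K ^ 2 + 1 := by nlinarith
    · calc |η g - η h| ^ 2 ≤ (K * (t / (ρ - r))) ^ 2 := by gcongr
        _ ≤ (K ^ 2 + 1) * (t / (ρ - r)) ^ 2 := by
          rw [mul_pow]
          gcongr
          linarith
  · refine HasCompactSupport.intro (K := (fun h => g₀ * h) '' {g | N g ≤ ρ})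
      ((H.isCompact_norm_le hN ρ).image (continuous_const_mul g₀)) fun g hg => hzero g ?_
    by_contra hcon
    push Not at hcon
    exact hg ⟨g₀⁻¹ * g, hcon.le, by simp⟩

variable [MeasurableSpace G] [BorelSpace G]

instance isFiniteMeasureOnCompacts_haar (H : HomogeneousGroup n E G) :
    IsFiniteMeasureOnCompacts H.haar := by
  have : T2Space G := H.t2Space
  refine ⟨fun K hK => ?_⟩
  rw [H.haar_apply hK.measurableSet]
  exact (H.expCoord.toHomeomorph.isCompact_preimage.2 hK).measure_lt_top

lemma haar_unitBall_pos (H : HomogeneousGroup n E G) {N : G → ℝ} (hN : H.IsHomogeneousNorm N) :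
    0 < (H.haar {g | N g < 1}).toReal := by
  have hopen : IsOpen {g | N g < 1} := isOpen_lt hN.continuous continuous_const
  apply ENNReal.toReal_pos
  · rw [H.haar_apply hopen.measurableSet]
    refine ((hopen.preimage H.expCoord.continuous).measure_pos volume ⟨0, ?_⟩).ne'
    simp [H.expCoord_zero, (hN.eq_zero_iff 1).2 rfl]
  · exact ne_top_of_le_ne_top (H.isCompact_norm_le hN 1).measure_lt_top.ne
      (measure_mono fun g (hg : N g < 1) => show N g ≤ 1 from hg.le)

/-- Homogeneous groups are Ahlfors regular. -/
lemma isAhlforsRegular [LieGroup 𝓘(ℝ, E) ∞ G] (H : HomogeneousGroup n E G) {N : G → ℝ}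
    (hN : H.IsHomogeneousNorm N) :
    IsAhlforsRegular H.haar (fun g h => N (g⁻¹ * h)) H.homDim
      (H.haar {g | N g < 1}).toReal where
  measurable_dist := by
    have : IsTopologicalGroup G := topologicalGroup_of_lieGroup 𝓘(ℝ, E) ∞
    have : SecondCountableTopology G := H.secondCountableTopology
    exact (hN.continuous.comp (continuous_fst.inv.mul continuous_snd)).measurable
  nonneg g h := hN.nonneg _
  pos_of_ne g h hgh := by
    refine lt_of_le_of_ne (hN.nonneg _) fun h0 => hgh ?_
    exact inv_mul_eq_one.1 ((hN.eq_zero_iff _).1 h0.symm)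
  symm g h := by
    rw [← hN.inv (g⁻¹ * h)]
    simp
  triangle g h k := by
    have := hN.mul_le (g⁻¹ * h) (h⁻¹ * k)
    rwa [show g⁻¹ * h * (h⁻¹ * k) = g⁻¹ * k by group] at this
  dim_pos := H.homDim_pos
  density_pos := H.haar_unitBall_pos hN
  measure_ball g r hr := by
    have hms : MeasurableSet {g | N g < r} :=
      (isOpen_lt hN.continuous continuous_const).measurableSet
    have h1 := H.haar_preimage_mul g hms
    have hfin : H.haar {g | N g < 1} ≠ ⊤ := fun htop => by
      have := H.haar_unitBall_pos hN
      simp [htop] at this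
    have h2 : H.haar {h | N (g⁻¹ * h) < r} = H.haar {g | N g < r} := h1
    rw [h2, H.haar_dilation hN hr, ENNReal.ofReal_mul ENNReal.toReal_nonneg,
      ENNReal.ofReal_toReal hfin, mul_comm]

lemma lintegral_rpow_ne_top_of_isTestFunction (H : HomogeneousGroup n E G) {φ : G → ℝ}
    (hφ : IsTestFunction E φ) {p : ℝ} (hp : 0 < p) :
    ∫⁻ g, ENNReal.ofReal (|φ g| ^ p) ∂H.haar ≠ ⊤ := by
  have hc : Continuous fun g => |φ g| ^ p :=
    hφ.1.continuous.abs.rpow_const fun _ => Or.inr hp.le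
  have hs : HasCompactSupport fun g => |φ g| ^ p :=
    hφ.2.comp_left (g := fun t => |t| ^ p) (by simp [hp.ne'])
  have hS : SecondCountableTopology G := H.secondCountableTopology
  exact (lintegral_ofReal_ne_top_iff_integrable hc.aestronglyMeasurable
    (Eventually.of_forall fun g => by positivity)).2 (hc.integrable_of_hasCompactSupport hs)

end HomogeneousGroup
end

/-! ### Convergence of the integrals, change of representatives, and the potential. -/

noncomputable section

namespace IsAhlforsRegular

variable {X : Type*} [MeasurableSpace X] {μ : Measure X} {d : X → X → ℝ} {Q c s : ℝ}

/-- Use `u ≤ 1 + u^p`. The constant is integrable against the kernel away from `x₀`, and against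
`u^p` the kernel is bounded by `R^(-(Q + 2s))`. -/
lemma lintegral_tail_ne_top (h : IsAhlforsRegular μ d Q c) {Ck p R : ℝ} (hs0 : 0 < s)
    (hp : 1 ≤ p) (hR : 0 < R)
    (hker : ∀ (x : X) (ℓ : ℝ), 0 < ℓ →
      ∫⁻ y, ENNReal.ofReal (min 1 ((d x y / ℓ) ^ 2) / d x y ^ (Q + 2 * s)) ∂μ ≤
        ENNReal.ofReal (Ck * ℓ ^ (-(2 * s))))
    {u : X → ℝ} (hu : Measurable u) (hu0 : ∀ x, 0 ≤ u x)
    (hup : ∫⁻ x, ENNReal.ofReal (|u x| ^ p) ∂μ ≠ ⊤) (x₀ : X) :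
    ∫⁻ y in {y | R < d x₀ y}, ENNReal.ofReal (u y / d x₀ y ^ (Q + 2 * s)) ∂μ ≠ ⊤ := by
  have hq : 0 < Q + 2 * s := by linarith [h.dim_pos]
  have hm : MeasurableSet {y | R < d x₀ y} :=
    measurableSet_lt measurable_const (h.measurable_dist_right x₀)
  have hup' : ∫⁻ y, ENNReal.ofReal (1 / R ^ (Q + 2 * s)) * ENNReal.ofReal (|u y| ^ p) ∂μ ≠ ⊤ := by
    rw [lintegral_const_mul' _ _ ENNReal.ofReal_ne_top]
    exact ENNReal.mul_ne_top ENNReal.ofReal_ne_top hup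
  refine ne_top_of_le_ne_top (ENNReal.add_ne_top.2
    ⟨ne_top_of_le_ne_top ENNReal.ofReal_ne_top (hker x₀ R hR), hup'⟩) ?_
  rw [← lintegral_add_right _ (((hu.abs.pow_const p).ennreal_ofReal).const_mul _)]
  refine (setLIntegral_mono' hm fun y (hy : R < d x₀ y) => ?_).trans (setLIntegral_le_lintegral _ _)
  have hd : 0 < d x₀ y := hR.trans hy
  have hdq : 0 < d x₀ y ^ (Q + 2 * s) := by positivity
  have hmin : min 1 ((d x₀ y / R) ^ 2) = 1 :=
    min_eq_left (one_le_pow₀ ((one_le_div hR).2 hy.le))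
  rw [hmin, ← ENNReal.ofReal_mul (by positivity), ← ENNReal.ofReal_add (by positivity)
    (by positivity)]
  apply ENNReal.ofReal_le_ofReal
  have hle : u y ≤ 1 + |u y| ^ p := by
    rw [abs_of_nonneg (hu0 y)]
    have hpow : 0 ≤ u y ^ p := Real.rpow_nonneg (hu0 y) p
    rcases le_total (u y) 1 with h1 | h1
    · linarith
    · have := Real.rpow_le_rpow_of_exponent_le h1 hp
      rw [Real.rpow_one] at this
      linarith
  calc u y / d x₀ y ^ (Q + 2 * s) ≤ (1 + |u y| ^ p) / d x₀ y ^ (Q + 2 * s) := by gcongr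
    _ = 1 / d x₀ y ^ (Q + 2 * s) + 1 / d x₀ y ^ (Q + 2 * s) * |u y| ^ p := by ring
    _ ≤ _ := by gcongr

lemma lintegral_ball_ne_top (h : IsAhlforsRegular μ d Q c) {p R : ℝ} (hp : 1 < p) (hR : 0 < R)
    {u : X → ℝ} (hu : Measurable u) (hu0 : ∀ x, 0 ≤ u x)
    (hup : ∫⁻ x, ENNReal.ofReal (|u x| ^ p) ∂μ ≠ ⊤) (x₀ : X) :
    ∫⁻ y in {y | d x₀ y < R}, ENNReal.ofReal (u y) ∂μ ≠ ⊤ := by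
  have h1 := setLIntegral_rpow_le (μ := μ) (f := fun x => ENNReal.ofReal |u x|)
    hu.abs.ennreal_ofReal.aemeasurable one_pos hp {y | d x₀ y < R}
  simp only [ENNReal.rpow_one, ← ofReal_abs_rpow (zero_le_one.trans hp.le)] at h1
  have h2 : ∫⁻ y in {y | d x₀ y < R}, ENNReal.ofReal (u y) ∂μ =
      ∫⁻ y in {y | d x₀ y < R}, ENNReal.ofReal |u y| ∂μ := by
    simp only [abs_of_nonneg (hu0 _)]
  have hp0 : 0 < p := by linarith
  rw [h2]
  refine ne_top_of_le_ne_top (ENNReal.mul_ne_top ?_ ?_) h1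
  · exact ENNReal.rpow_ne_top_of_nonneg (by positivity)
      (ne_top_of_le_ne_top hup (setLIntegral_le_lintegral _ _))
  · rw [h.measure_ball x₀ R hR]
    refine ENNReal.rpow_ne_top_of_nonneg ?_ ENNReal.ofReal_ne_top
    rw [sub_nonneg, div_le_one hp0]
    exact hp.le

end IsAhlforsRegular

namespace HomogeneousGroup

variable {n : ℕ} {E G : Type*} [NormedAddCommGroup E] [NormedSpace ℝ E]
  [Group G] [TopologicalSpace G] [ChartedSpace E G] [MeasurableSpace G]

lemma seminormSq_congr (H : HomogeneousGroup n E G) [SFinite H.haar] (N : G → ℝ) (s : ℝ)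
    {u v : G → ℝ} (huv : u =ᵐ[H.haar] v) : H.seminormSq N s u = H.seminormSq N s v := by
  refine lintegral_congr_ae ?_
  filter_upwards [Measure.quasiMeasurePreserving_fst.ae huv,
    Measure.quasiMeasurePreserving_snd.ae huv] with p h1 h2
  rw [h1, h2]

lemma quadForm_congr (H : HomogeneousGroup n E G) [SFinite H.haar] (N : G → ℝ) (s : ℝ)
    {u v : G → ℝ} (huv : u =ᵐ[H.haar] v) (φ : G → ℝ) :
    H.quadForm N s u φ = H.quadForm N s v φ := by
  refine integral_congr_ae ?_
  filter_upwards [Measure.quasiMeasurePreserving_fst.ae huv,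
    Measure.quasiMeasurePreserving_snd.ae huv] with p h1 h2
  rw [h1, h2]

/-- Being a subsolution is insensitive to null sets, so the main argument may assume measurable
representatives with `u ≥ 0` everywhere. -/
lemma IsWeakSubsolution.congr {H : HomogeneousGroup n E G} [SFinite H.haar] {N : G → ℝ} {s : ℝ}
    {u v F F' : G → ℝ} (h : H.IsWeakSubsolution N s u F) (huv : u =ᵐ[H.haar] v)
    (hF : F =ᵐ[H.haar] F') : H.IsWeakSubsolution N s v F' := by
  obtain ⟨⟨φ, hφ, hE, hlim⟩, hsub⟩ := h
  refine ⟨⟨φ, hφ, ?_, ?_⟩, fun ψ hψ hψ0 => ?_⟩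
  · refine hE.congr fun k => H.seminormSq_congr N s ?_
    filter_upwards [huv] with g hg
    rw [hg]
  · filter_upwards [huv, hlim] with g hg hl
    rwa [← hg]
  · rw [← H.quadForm_congr N s huv]
    refine (hsub ψ hψ hψ0).trans_eq (integral_congr_ae ?_)
    filter_upwards [hF] with g hg
    rw [hg]

/-- The potential is controlled on balls away from the identity. -/
lemma lintegral_potential_le (H : HomogeneousGroup n E G) {N : G → ℝ}
    (hN : H.IsHomogeneousNorm N) {s t₀ : ℝ} (hs0 : 0 < s) (ht₀ : H.homDim / (2 * s) < t₀)
    (K₀ : ℝ) {V : G → ℝ} (hV : MemLp V (ENNReal.ofReal t₀) H.haar) {g₀ : G} {R₀ R : ℝ}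
    (hR : 0 < R) (hRR₀ : R ≤ R₀) (hg₀ : N g₀ = 2 * R₀)
    (hK : ∫ g in {g | R₀ < N g}, |V g| ^ t₀ ∂H.haar ≤ K₀ / R₀ ^ (2 * s * t₀ - H.homDim)) :
    (∫⁻ g in {g | N (g₀⁻¹ * g) < R}, ENNReal.ofReal |V g| ^ t₀ ∂H.haar) ^ (1 / t₀) ≤
      ENNReal.ofReal ((max K₀ 0 ^ (1 / t₀) + 1) *
        R ^ (-(H.homDim * (2 * s / H.homDim - 1 / t₀)))) := by
  have hQ := H.homDim_pos
  have ht : 0 < t₀ := lt_trans (by positivity) ht₀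
  have hexp : 0 < 2 * s * t₀ - H.homDim := by
    rw [div_lt_iff₀ (by positivity)] at ht₀
    linarith
  have hR₀ : 0 < R₀ := hR.trans_le hRR₀
  -- The centre is at distance `2 R₀` from the identity and the radius is at most `R₀`.
  have hsub : {g | N (g₀⁻¹ * g) < R} ⊆ {g | R₀ < N g} := by
    intro g (hg : N (g₀⁻¹ * g) < R)
    change R₀ < N g
    have h1 := hN.mul_le g (g₀⁻¹ * g)⁻¹
    rw [hN.inv] at h1
    simp only [mul_inv_rev, inv_inv, mul_inv_cancel_left] at h1
    linarith
  have hint : Integrable (fun g => |V g| ^ t₀) H.haar := by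
    have := hV.integrable_norm_rpow (by simpa using ht) ENNReal.ofReal_ne_top
    simpa only [ENNReal.toReal_ofReal ht.le, Real.norm_eq_abs] using this
  have hle : ∫⁻ g in {g | N (g₀⁻¹ * g) < R}, ENNReal.ofReal |V g| ^ t₀ ∂H.haar ≤
      ENNReal.ofReal (max K₀ 0 * R ^ (-(2 * s * t₀ - H.homDim))) := by
    calc ∫⁻ g in {g | N (g₀⁻¹ * g) < R}, ENNReal.ofReal |V g| ^ t₀ ∂H.haar
        ≤ ∫⁻ g in {g | R₀ < N g}, ENNReal.ofReal |V g| ^ t₀ ∂H.haar := lintegral_mono_set hsub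
      _ = ENNReal.ofReal (∫ g in {g | R₀ < N g}, |V g| ^ t₀ ∂H.haar) := by
        rw [ofReal_integral_eq_lintegral_ofReal hint.integrableOn
          (Eventually.of_forall fun g => by positivity)]
        simp only [ofReal_abs_rpow ht.le]
      _ ≤ _ := by
        apply ENNReal.ofReal_le_ofReal
        refine hK.trans ?_
        rw [Real.rpow_neg hR.le, ← div_eq_mul_inv]
        have h1 : (0 : ℝ) ≤ max K₀ 0 := le_max_right _ _
        calc K₀ / R₀ ^ (2 * s * t₀ - H.homDim) ≤ max K₀ 0 / R₀ ^ (2 * s * t₀ - H.homDim) := by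
              gcongr
              exact le_max_left _ _
          _ ≤ _ := by gcongr
  refine (ENNReal.rpow_le_rpow hle (by positivity)).trans ?_
  rw [ENNReal.ofReal_rpow_of_nonneg (by positivity) (by positivity),
    Real.mul_rpow (le_max_right _ _) (by positivity), ← Real.rpow_mul hR.le]
  apply ENNReal.ofReal_le_ofReal
  have he : -(2 * s * t₀ - H.homDim) * (1 / t₀) =
      -(H.homDim * (2 * s / H.homDim - 1 / t₀)) := by
    field_simp
  rw [he]
  gcongr
  linarith

variable [BorelSpace G]

lemma MemFracSobolev.aemeasurable {H : HomogeneousGroup n E G} {N : G → ℝ} {s : ℝ} {u : G → ℝ}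
    (h : H.MemFracSobolev N s u) : AEMeasurable u H.haar := by
  obtain ⟨φ, hφ, -, hlim⟩ := h
  exact aemeasurable_of_tendsto_metrizable_ae atTop
    (fun k => (hφ k).1.continuous.measurable.aemeasurable) hlim

/-- Test functions approximating an element of the fractional Sobolev space can be chosen with
bounded energy. -/
lemma MemFracSobolev.exists_bounded_approx [LieGroup 𝓘(ℝ, E) ∞ G] {H : HomogeneousGroup n E G}
    {N : G → ℝ} (hN : H.IsHomogeneousNorm N) {s : ℝ} (hs0 : 0 < s) (hs1 : s < 1) {u : G → ℝ}
    (hu : Measurable u) (h : H.MemFracSobolev N s u) :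
    fracEnergy H.haar (fun g h => N (g⁻¹ * h)) (H.homDim + 2 * s) u ≠ ⊤ ∧
    ∃ φ : ℕ → G → ℝ, (∀ k, IsTestFunction E (φ k)) ∧
      (∀ᵐ g ∂H.haar, Tendsto (fun k => φ k g) atTop (𝓝 (u g))) ∧
      ∃ M : ℝ≥0∞, M ≠ ⊤ ∧
        ∀ k, fracEnergy H.haar (fun g h => N (g⁻¹ * h)) (H.homDim + 2 * s) (φ k) ≤ M := by
  have hreg := H.isAhlforsRegular hN
  obtain ⟨φ, hφ, hE, hlim⟩ := h
  obtain ⟨Ck, -, hker⟩ := hreg.exists_lintegral_kernel_le hs0 hs1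
  have hE' : Tendsto (fun k => fracEnergy H.haar (fun g h => N (g⁻¹ * h)) (H.homDim + 2 * s)
      (fun g => u g - φ k g)) atTop (𝓝 0) := hE
  have hm : ∀ k, Measurable (φ k) := fun k => (hφ k).1.continuous.measurable
  -- From `k₀` on the energy of `u - φ k` is below one. One such index shows that `u` has finite
  -- energy, and the shifted sequence is then bounded.
  obtain ⟨k₀, hk₀⟩ := eventually_atTop.1 (hE'.eventually (gt_mem_nhds zero_lt_one))
  have hφE : ∀ k, fracEnergy H.haar (fun g h => N (g⁻¹ * h)) (H.homDim + 2 * s) (φ k) ≠ ⊤ := by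
    intro k
    obtain ⟨A, hA, hAφ⟩ := H.exists_sq_sub_le_of_isTestFunction hN (hφ k)
    exact hreg.fracEnergy_ne_top hA one_pos hker (hm k) hAφ (isClosed_tsupport _).measurableSet
      (hφ k).2.isCompact.measure_lt_top.ne fun g hg => image_eq_zero_of_notMem_tsupport hg
  have huE : fracEnergy H.haar (fun g h => N (g⁻¹ * h)) (H.homDim + 2 * s) u ≠ ⊤ := by
    refine ne_top_of_le_ne_top ?_ (hreg.fracEnergy_le_two_mul_add _ (hm k₀))
    exact ENNReal.add_ne_top.2 ⟨ENNReal.mul_ne_top (by simp) (hφE k₀),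
      ENNReal.mul_ne_top (by simp) (hk₀ k₀ le_rfl).ne_top⟩
  refine ⟨huE, fun k => φ (k + k₀), fun k => hφ _, ?_,
    2 * fracEnergy H.haar (fun g h => N (g⁻¹ * h)) (H.homDim + 2 * s) u + 2 * 1,
    ENNReal.add_ne_top.2 ⟨ENNReal.mul_ne_top (by simp) huE, by simp⟩, fun k => ?_⟩
  · filter_upwards [hlim] with g hg
    exact hg.comp (tendsto_add_atTop_nat k₀)
  · refine (hreg.fracEnergy_le_two_mul_add _ hu).trans (add_le_add le_rfl (mul_le_mul_right ?_ 2))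
    refine le_trans (le_of_eq ?_) (hk₀ (k + k₀) (by omega)).le
    unfold fracEnergy
    congr 1
    ext z
    congr 2
    ring

end HomogeneousGroup
end

/-! ### Assembly of the estimate. -/

noncomputable section

namespace HomogeneousGroup

/-- Local boundedness of nonnegative subsolutions, for measurable representatives. -/
theorem exists_le_of_isWeakSubsolution {n : ℕ} {E G : Type*} [NormedAddCommGroup E]
    [NormedSpace ℝ E] [Group G] [TopologicalSpace G] [ChartedSpace E G] [LieGroup 𝓘(ℝ, E) ∞ G]
    [MeasurableSpace G] [BorelSpace G] (H : HomogeneousGroup n E G) {N : G → ℝ}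
    (hN : H.IsHomogeneousNorm N) {s : ℝ} (hs0 : 0 < s) (hs1 : s < 1) (hsQ : 2 * s < H.homDim)
    {t₀ : ℝ} (ht₀ : H.homDim / (2 * s) < t₀) (K₀ : ℝ) :
    ∃ C : ℝ, 0 < C ∧ ∀ u V : G → ℝ, Measurable u → (∀ g, 0 ≤ u g) → Measurable V →
      H.IsWeakSubsolution N s u (fun g => V g * u g) →
      MemLp V (ENNReal.ofReal (H.homDim / (2 * s))) H.haar →
      MemLp V (ENNReal.ofReal t₀) H.haar →
      ∀ (g₀ : G) (R₀ R : ℝ), 0 < R → R ≤ R₀ → N g₀ = 2 * R₀ →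
      ∫ g in {g | R₀ < N g}, |V g| ^ t₀ ∂H.haar ≤ K₀ / R₀ ^ (2 * s * t₀ - H.homDim) →
      ∫⁻ g in {g | N (g₀⁻¹ * g) < R}, ENNReal.ofReal (u g) ∂H.haar ≠ ⊤ ∧
      ∫⁻ g in {g | R / 2 < N (g₀⁻¹ * g)},
        ENNReal.ofReal (u g / N (g₀⁻¹ * g) ^ (H.homDim + 2 * s)) ∂H.haar ≠ ⊤ ∧
      ∀ᵐ g ∂H.haar, N (g₀⁻¹ * g) < R / 2 → u g ≤
        C * ((∫⁻ g in {g | N (g₀⁻¹ * g) < R}, ENNReal.ofReal (u g) ∂H.haar).toReal /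
          R ^ H.homDim) +
        2 * (R ^ (2 * s) * (∫⁻ g in {g | R / 2 < N (g₀⁻¹ * g)},
          ENNReal.ofReal (u g / N (g₀⁻¹ * g) ^ (H.homDim + 2 * s)) ∂H.haar).toReal) := by
  have hreg := H.isAhlforsRegular hN
  have hQ := H.homDim_pos
  obtain ⟨Ck, hCk, hker⟩ := hreg.exists_lintegral_kernel_le hs0 hs1
  obtain ⟨CS, hCS, hsob⟩ := hreg.exists_sobolev hs0 hsQ
  obtain ⟨L, hL, hcut⟩ := H.exists_cutoff hN
  -- The summand `1` keeps the constant positive also for `K₀ ≤ 0`.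
  have hK : 0 < max K₀ 0 ^ (1 / t₀) + 1 := by positivity
  obtain ⟨C, hC, hmain⟩ := exists_le_of_lintegral_le (X := G) (μ := H.haar)
    (d := fun g h => N (g⁻¹ * h)) (c := (H.haar {g | N g < 1}).toReal) hs0 hsQ ht₀ hL hCk hCS hK
  refine ⟨C, hC, fun u V hu hu0 hV hsub hVQ hVt g₀ R₀ R hR hRR₀ hg₀ hpot => ?_⟩
  obtain ⟨huE, φ, hφ, hlim, M, hM, hφM⟩ := hsub.1.exists_bounded_approx hN hs0 hs1 hu
  have hφm : ∀ j, Measurable (φ j) := fun j => (hφ j).1.continuous.measurable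
  have hQs : 0 < H.homDim - 2 * s := by linarith
  have hp1 : 1 < 2 * H.homDim / (H.homDim - 2 * s) := by
    rw [one_lt_div hQs]
    linarith
  have hφp : ∀ j, ∫⁻ g, ENNReal.ofReal (|φ j g| ^ (2 * H.homDim / (H.homDim - 2 * s))) ∂H.haar ≠ ⊤ :=
    fun j => H.lintegral_rpow_ne_top_of_isTestFunction (hφ j) (by linarith)
  have hup := IsAhlforsRegular.lintegral_rpow_ne_top_of_tendsto hs0 hsQ hsob hφm hφp hM hφM hlim
  have hexp : 0 < H.homDim / (2 * s) := by positivity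
  have hVQ' : ∫⁻ g, ENNReal.ofReal |V g| ^ (H.homDim / (2 * s)) ∂H.haar ≠ ⊤ := by
    have h1 := lintegral_rpow_enorm_lt_top_of_eLpNorm_lt_top (by simpa using hexp)
      ENNReal.ofReal_ne_top hVQ.2
    simp only [ENNReal.toReal_ofReal hexp.le, Real.enorm_eq_ofReal_abs] at h1
    exact h1.ne
  have hball := hreg.lintegral_ball_ne_top hp1 hR hu hu0 hup g₀
  have htail := hreg.lintegral_tail_ne_top hs0 hp1.le (half_pos hR) hker hu hu0 hup g₀
  refine ⟨hball, htail, ?_⟩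
  -- The parameter `T` of the iteration is `R^(2s)` times the tail integral outside `B(g₀, R/2)`.
  refine hmain u V g₀ R _ ⟨hreg, hs0, hsQ, ht₀, hL, hCk, hCS, hK, hR, by positivity, hker, hsob, hu,
    hu0, hV, hup, H.lintegral_potential_le hN hs0 ht₀ K₀ hVt hR hRR₀ hg₀ hpot, ?_,
    fun r ρ hr hrρ _ => ?_⟩ _ (by positivity) ?_
  · rw [mul_right_comm, ← Real.rpow_add hR, add_neg_cancel, Real.rpow_zero, one_mul,
      ENNReal.ofReal_toReal htail]
  · obtain ⟨η, hη, hηt⟩ := hcut g₀ r ρ hr hrρ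
    refine ⟨η, hη, hreg.caccioppoliIneq hs0 hsQ hL hker hsob hr hrρ hη hu hu0 hV hVQ' huE hup hφm
      hφp hM hφM hlim fun k ε hk hε j => ?_⟩
    exact hsub.2 _ (isTestFunction_softPos_mul (hφ j) hηt k hε) fun g =>
      mul_nonneg (softPos_nonneg _ _ _) (sq_nonneg _)
  · rw [div_mul_cancel₀ _ (by positivity), ENNReal.ofReal_toReal hball]

end HomogeneousGroup

end

theorem theorem1p1 {n : ℕ} {E G : Type*} [NormedAddCommGroup E] [NormedSpace ℝ E]
    [Group G] [TopologicalSpace G] [ChartedSpace E G] [LieGroup 𝓘(ℝ, E) ∞ G]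
    [MeasurableSpace G] [BorelSpace G]
    (H : HomogeneousGroup n E G) (N : G → ℝ) (hN : H.IsHomogeneousNorm N)
    (s : ℝ) (hs0 : 0 < s) (hs1 : s < 1) (hsQ : 2 * s < H.homDim)
    (t₀ : ℝ) (ht₀ : H.homDim / (2 * s) < t₀) (K₀ : ℝ) :
    ∃ C : ℝ, 0 < C ∧
      ∀ u V : G → ℝ,
        (∀ᵐ g ∂H.haar, 0 ≤ u g) →
        H.IsWeakSubsolution N s u (fun g => V g * u g) →
        MemLp V (ENNReal.ofReal (H.homDim / (2 * s))) H.haar →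
        MemLp V (ENNReal.ofReal t₀) H.haar →
        ∀ Rbar : ℝ, 0 ≤ Rbar →
        (∀ R : ℝ, Rbar < R →
          ∫ g in {g | R < N g}, |V g| ^ t₀ ∂H.haar ≤ K₀ / R ^ (2 * s * t₀ - H.homDim)) →
        ∀ (g₀ : G) (R₀ : ℝ), N g₀ = 2 * R₀ → 2 * R₀ ≥ 4 * Rbar →
        ∀ R : ℝ, 0 < R → R ≤ R₀ →
          IntegrableOn u (HomogeneousGroup.gaugeBall N g₀ R) H.haar ∧
          IntegrableOn (H.tailIntegrand N s u g₀) {h | R / 2 < N (g₀⁻¹ * h)} H.haar ∧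
          essSup (fun g => (u g : EReal))
              (H.haar.restrict (HomogeneousGroup.gaugeBall N g₀ (R / 2))) ≤
            ((C * (⨍ g in HomogeneousGroup.gaugeBall N g₀ R, u g ∂H.haar) +
              C * H.tail N s u g₀ (R / 2) : ℝ) : EReal) := by
  have hreg := H.isAhlforsRegular hN
  have hQ := H.homDim_pos
  set c := (H.haar {g | N g < 1}).toReal with hc
  have hc0 : 0 < c := H.haar_unitBall_pos hN
  obtain ⟨C, hC, hmain⟩ := H.exists_le_of_isWeakSubsolution hN hs0 hs1 hsQ ht₀ K₀
  -- The factor `c` turns division by `R^Q` into the mean value, and `2^(2s)` accounts for the tail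
  -- being normalized with `R/2`.
  refine ⟨C * c + 2 * 2 ^ (2 * s), by positivity, ?_⟩
  intro u V hu0 hsub hVQ hVt Rbar hRbar hpot g₀ R₀ hg₀ hR₀ R hR hRR₀
  have hum := hsub.1.aemeasurable
  have hVm : AEMeasurable V H.haar := hVt.1.aemeasurable
  set v : G → ℝ := fun g => max (hum.mk u g) 0 with hv
  have hvm : Measurable v := hum.measurable_mk.max measurable_const
  have huv : u =ᵐ[H.haar] v := by
    filter_upwards [hum.ae_eq_mk, hu0] with g h1 h2
    simp only [hv]
    rw [← h1, max_eq_left h2]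
  have hVW := hVm.ae_eq_mk
  set W := hVm.mk V with hW
  -- The decay hypothesis is used at the single radius `R₀`. It exceeds `Rbar` because `R₀ ≥ 2 Rbar`
  -- and `R₀ > 0`.
  have hpot' : ∫ g in {g | R₀ < N g}, |W g| ^ t₀ ∂H.haar ≤ K₀ / R₀ ^ (2 * s * t₀ - H.homDim) := by
    refine le_trans (le_of_eq (integral_congr_ae ?_)) (hpot R₀ (by linarith))
    filter_upwards [ae_restrict_of_ae hVW] with g hg
    rw [hg]
  obtain ⟨hball, htail, hsup⟩ := hmain v W hvm (fun g => le_max_right _ _) hVm.measurable_mk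
    (hsub.congr huv (hVW.mul huv)) ((memLp_congr_ae hVW).1 hVQ) ((memLp_congr_ae hVW).1 hVt)
    g₀ R₀ R hR hRR₀ hg₀ hpot'
  have hv0 : ∀ g, 0 ≤ v g := fun g => le_max_right _ _
  have hdm := hreg.measurable_dist_right g₀
  have htm : Measurable (H.tailIntegrand N s v g₀) := hvm.div (hdm.pow_const _)
  have ht0 : ∀ g, 0 ≤ H.tailIntegrand N s v g₀ g := fun g =>
    div_nonneg (hv0 g) (Real.rpow_nonneg (hN.nonneg _) _)
  have htuv : H.tailIntegrand N s u g₀ =ᵐ[H.haar] H.tailIntegrand N s v g₀ := by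
    filter_upwards [huv] with g hg
    simp only [HomogeneousGroup.tailIntegrand, hg]
  refine ⟨?_, ?_, ?_⟩
  · refine Integrable.congr ?_ (ae_restrict_of_ae huv.symm)
    exact (lintegral_ofReal_ne_top_iff_integrable hvm.aestronglyMeasurable
      (Eventually.of_forall hv0)).1 hball
  · refine Integrable.congr ?_ (ae_restrict_of_ae htuv.symm)
    exact (lintegral_ofReal_ne_top_iff_integrable htm.aestronglyMeasurable
      (Eventually.of_forall ht0)).1 htail
  · have hmb : MeasurableSet (HomogeneousGroup.gaugeBall N g₀ (R / 2)) :=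
      hreg.measurableSet_ball g₀ (R / 2)
    refine essSup_le_of_ae_le _ ?_
    rw [EventuallyLE, ae_restrict_iff' hmb]
    filter_upwards [hsup, huv] with g hg huvg hgm
    refine EReal.coe_le_coe_iff.2 ?_
    rw [huvg]
    refine (hg hgm).trans ?_
    have hI : ∫ g in HomogeneousGroup.gaugeBall N g₀ R, u g ∂H.haar =
        (∫⁻ g in {g | N (g₀⁻¹ * g) < R}, ENNReal.ofReal (v g) ∂H.haar).toReal := by
      rw [integral_congr_ae (ae_restrict_of_ae huv), integral_eq_lintegral_of_nonneg_ae
        (Eventually.of_forall hv0) hvm.aestronglyMeasurable]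
      rfl
    have hT : ∫ g in {g | R / 2 < N (g₀⁻¹ * g)}, H.tailIntegrand N s u g₀ g ∂H.haar =
        (∫⁻ g in {g | R / 2 < N (g₀⁻¹ * g)},
          ENNReal.ofReal (v g / N (g₀⁻¹ * g) ^ (H.homDim + 2 * s)) ∂H.haar).toReal := by
      rw [integral_congr_ae (ae_restrict_of_ae htuv), integral_eq_lintegral_of_nonneg_ae
        (Eventually.of_forall ht0) htm.aestronglyMeasurable]
      rfl
    have hμ : H.haar.real (HomogeneousGroup.gaugeBall N g₀ R) = c * R ^ H.homDim := by
      have h1 := hreg.measure_ball g₀ R hR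
      change (H.haar {h | N (g₀⁻¹ * h) < R}).toReal = _
      rw [h1, ENNReal.toReal_ofReal (by positivity)]
    rw [setAverage_eq, hμ, smul_eq_mul, HomogeneousGroup.tail, hI, hT]
    generalize (∫⁻ g in {g | N (g₀⁻¹ * g) < R}, ENNReal.ofReal (v g) ∂H.haar) = I
    generalize (∫⁻ g in {g | R / 2 < N (g₀⁻¹ * g)},
      ENNReal.ofReal (v g / N (g₀⁻¹ * g) ^ (H.homDim + 2 * s)) ∂H.haar) = T
    have hI0 : 0 ≤ I.toReal := ENNReal.toReal_nonneg
    have hT0 : 0 ≤ T.toReal := ENNReal.toReal_nonneg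
    have e1 : C * (I.toReal / R ^ H.homDim) =
        C * c * ((c * R ^ H.homDim)⁻¹ * I.toReal) := by
      field_simp
    have e2 : 2 * (R ^ (2 * s) * T.toReal) =
        2 * 2 ^ (2 * s) * ((R / 2) ^ (2 * s) * T.toReal) := by
      rw [Real.div_rpow hR.le zero_le_two]
      field_simp
    rw [e1, e2]
    gcongr
    · have : (0 : ℝ) ≤ 2 * 2 ^ (2 * s) := by positivity
      linarith
    · have : 0 ≤ C * c := by positivity
      linarith
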